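/- Write $[n]=\{1,\dots,n\}$ and, for $x\in\mathbb R^n$ and $T=(T_1,\dots,T_k)\in[n]^k$, write $x^T=\prod_{i=1}^k x_{T_i}$. Algorithms are deterministic; they answer "certified" or "fail", and they are efficient: for each fixed $k$ the running time, counted in bit operations, is polynomial in the bit length of the input. (1) There is an absolute constant $K>0$ such that for every $k\ge 2$ there is an efficient algorithm $\mathcal A$ of the following kind. Its input consists of $n$, an integer scale $N\ge 1$, an integer bound $\theta$ and a tensor of integers $(z(T))_{T\in[n]^k}$; it represents every real tensor $w$ with $|w(T)-z(T)/N|\le 1/N$ for all $T\in[n]^k$. Never errs: whenever $\mathcal A$ answers "certified" on such an input, then for every real tensor $w$ that the input represents, $$\sum_{T\in[n]^k}w(T)\,x^T\le\theta\qquad\text{for all }x\in\mathbb R^n\text{ with }\|x\|_\infty\le 1 .$$ Succeeds with high probability: there is a sequence $\varepsilon_n\to 0$ (depending only on $k$) such that the following holds for every $n$ and every real $p\ge n^{-k/2}$. Let $w(T)$, $T\in[n]^k$, be independent real random variables with $\mathbb E[w(T)]=0$, $\Pr[w(T)\ne 0]\le p$ and $|w(T)|\le 1$ almost surely. Then for every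 integer $\theta$ with $$\theta\ \ge\ K^k\sqrt p\;n^{3k/4}\,(\log n)^{3/2}$$ and every integer $N\ge \max(1,n^k)$, the algorithm $\mathcal A$, run on $n,N,\theta$ and the rounded coefficients $z(T)=\lfloor N\,w(T)\rfloor$ (an input that represents $w$), answers "fail" with probability at most $\varepsilon_n$. (2) Consequently random $k$-XOR is strongly refuted at density $\tilde O(n^{k/2})$. An instance $\mathcal I$ of $k$-XOR on $n$ variables is a multiset of constraints $(c,S)\in\{-1,1\}^k\times[n]^k$; an assignment $x\in\{-1,1\}^n$ satisfies $(c,S)$ if $\prod_{i=1}^k c_i x_{S_i}=-1$, and $\mathrm{Opt}(\mathcal I)$ is the largest fraction of the constraints that an assignment satisfies ($0$ if there are no constraints). An instance is given to an algorithm by $n$ and the table of the multiplicities of all $2^kn^k$ constraints. There is an absolute constant $K>0$ such that for every $k\ge2$ there is an efficient algorithm $\mathcal A$ with the following two properties. Whenever $\mathcal A$ answers "certified" on an instance $\mathcal I$ on $n\ge 2$ variables, then $$\mathrm{Opt}(\mathcal I)\le\tfrac12+\tfrac1{\log n}.$$ And there is a sequence $\varepsilon_n\to0$ (depending only on $k$)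 such that for every $n$ and every $p\in[0,1]$ for which the expected number of constraints satisfies $2^kn^kp\ge K^k\,n^{k/2}(\log n)^5$, the algorithm answers "fail" with probability at most $\varepsilon_n$ on the random instance that contains each of the $2^kn^k$ constraints independently with probability $p$. -/

import Mathlib

open MeasureTheory ProbabilityTheory Filter Topology

/-! ## Machine model: a random access machine over `ℤ` with logarithmic (bit) cost

A program works with integer variables and integer arrays, both named by natural numbers; a program
mentions only finitely many of them. The time charged for a step grows with the bit lengths of all
the integers it handles (addresses included), so that polynomial time here is polynomial time on a
Turing machine. -/

/-- A store: integer variables and integer arrays. -/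
structure Store where
  var : ℕ → ℤ
  arr : ℕ → ℕ → ℤ

/-- Change the value of a variable. -/
def Store.setVar (s : Store) (i : ℕ) (z : ℤ) : Store where
  var := Function.update s.var i z
  arr := s.arr

/-- Change the content of cell `j` of array `A`. -/
def Store.setCell (s : Store) (A j : ℕ) (z : ℤ) : Store where
  var := s.var
  arr := Function.update s.arr A (Function.update (s.arr A) j z)

/-- Integer expressions. `get A e` reads the cell of array `A` at the address given by `e`;
`div` is integer division. -/
inductive AExp where
  | lit (z : ℤ)
  | var (i : ℕ)
  | get (A : ℕ) (e : AExp)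
  | add (e f : AExp)
  | sub (e f : AExp)
  | mul (e f : AExp)
  | div (e f : AExp)

/-- The value of an expression in a store. -/
def AExp.value (s : Store) : AExp → ℤ
  | .lit z => z
  | .var i => s.var i
  | .get A e => s.arr A (e.value s).toNat
  | .add e f => e.value s + f.value s
  | .sub e f => e.value s - f.value s
  | .mul e f => e.value s * f.value s
  | .div e f => e.value s / f.value s

/-- The number of binary digits of `|z|`. -/
def bitLength (z : ℤ) : ℕ := Nat.size z.natAbs

/-- The cost of evaluating an expression: for each of its nodes, one plus the bit length of the
value found there. -/
def AExp.cost (s : Store) : AExp → ℕ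
  | .lit z => bitLength z + 1
  | .var i => bitLength (s.var i) + 1
  | .get A e => e.cost s + (bitLength ((AExp.get A e).value s) + 1)
  | .add e f => e.cost s + f.cost s + (bitLength ((AExp.add e f).value s) + 1)
  | .sub e f => e.cost s + f.cost s + (bitLength ((AExp.sub e f).value s) + 1)
  | .mul e f => e.cost s + f.cost s + (bitLength ((AExp.mul e f).value s) + 1)
  | .div e f => e.cost s + f.cost s + (bitLength ((AExp.div e f).value s) + 1)

/-- Programs. -/
inductive Prog where
  | skip
  /-- `var i := e` -/
  | assign (i : ℕ) (e : AExp)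
  /-- `arr A [e] := f` -/
  | write (A : ℕ) (e f : AExp)
  | seq (P Q : Prog)
  /-- `if 0 < e then P else Q` -/
  | ifPos (e : AExp) (P Q : Prog)
  /-- `while 0 < e do P` -/
  | whilePos (e : AExp) (P : Prog)

/-- `Exec P s t s'`: started in the store `s`, the program `P` halts at cost `t` in the store
`s'`. -/
inductive Exec : Prog → Store → ℕ → Store → Prop where
  | skip (s : Store) : Exec .skip s 1 s
  | assign (s : Store) (i : ℕ) (e : AExp) :
      Exec (.assign i e) s (e.cost s + 1) (s.setVar i (e.value s))
  | write (s : Store) (A : ℕ) (e f : AExp) :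
      Exec (.write A e f) s (e.cost s + f.cost s + 1)
        (s.setCell A (e.value s).toNat (f.value s))
  | seq {P Q : Prog} {s s' s'' : Store} {t u : ℕ}
      (hP : Exec P s t s') (hQ : Exec Q s' u s'') : Exec (.seq P Q) s (t + u) s''
  | ifTrue {e : AExp} {P Q : Prog} {s s' : Store} {t : ℕ}
      (h : 0 < e.value s) (hP : Exec P s t s') : Exec (.ifPos e P Q) s (e.cost s + 1 + t) s'
  | ifFalse {e : AExp} {P Q : Prog} {s s' : Store} {t : ℕ}
      (h : ¬ 0 < e.value s) (hQ : Exec Q s t s') : Exec (.ifPos e P Q) s (e.cost s + 1 + t) s'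
  | whileDone {e : AExp} {P : Prog} {s : Store}
      (h : ¬ 0 < e.value s) : Exec (.whilePos e P) s (e.cost s + 1) s
  | whileStep {e : AExp} {P : Prog} {s s' s'' : Store} {t u : ℕ}
      (h : 0 < e.value s) (hP : Exec P s t s') (hW : Exec (.whilePos e P) s' u s'') :
      Exec (.whilePos e P) s (e.cost s + 1 + t + u) s''

/-- Execution is deterministic. -/
theorem Exec.unique {P : Prog} {s s₁ s₂ : Store} {t₁ t₂ : ℕ}
    (h₁ : Exec P s t₁ s₁) (h₂ : Exec P s t₂ s₂) : t₁ = t₂ ∧ s₁ = s₂ := by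
  induction h₁ generalizing t₂ s₂ with
  | skip s => cases h₂; exact ⟨rfl, rfl⟩
  | assign s i e => cases h₂; exact ⟨rfl, rfl⟩
  | write s A e f => cases h₂; exact ⟨rfl, rfl⟩
  | seq _ _ ihP ihQ =>
    cases h₂ with
    | seq hP hQ =>
      obtain ⟨rfl, rfl⟩ := ihP hP
      obtain ⟨rfl, rfl⟩ := ihQ hQ
      exact ⟨rfl, rfl⟩
  | ifTrue h _ ih =>
    cases h₂ with
    | ifTrue _ hP => obtain ⟨rfl, rfl⟩ := ih hP; exact ⟨rfl, rfl⟩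
    | ifFalse h' _ => exact absurd h h'
  | ifFalse h _ ih =>
    cases h₂ with
    | ifTrue h' _ => exact absurd h' h
    | ifFalse _ hP => obtain ⟨rfl, rfl⟩ := ih hP; exact ⟨rfl, rfl⟩
  | whileDone h =>
    cases h₂ with
    | whileDone _ => exact ⟨rfl, rfl⟩
    | whileStep h' _ _ => exact absurd h' h
  | whileStep h _ _ ihP ihW =>
    cases h₂ with
    | whileDone h' => exact absurd h h'
    | whileStep _ hP hW =>
      obtain ⟨rfl, rfl⟩ := ihP hP
      obtain ⟨rfl, rfl⟩ := ihW hW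
      exact ⟨rfl, rfl⟩

/-- The initial store on the input `L`: array `0` holds `L`, everything else is `0`. -/
def initialStore (L : List ℤ) : Store where
  var := fun _ => 0
  arr := fun A j => if A = 0 then L.getD j 0 else 0

/-- The size in bits of an input. -/
def inputSize (L : List ℤ) : ℕ := (L.map fun z => bitLength z + 1).sum

/-- The yes/no algorithm `A` runs in polynomial time: one program halts on every input `a`, encoded by `enc a`, at
a cost that is polynomial in the size of the encoding, with the answer (`1` or `0`) in
variable `0`. -/
def PolyTime {α : Type} (enc : α → List ℤ) (A : α → Bool) : Prop :=
  ∃ (P : Prog) (c : ℕ), ∀ a : α, ∃ (t : ℕ) (s : Store),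
    Exec P (initialStore (enc a)) t s ∧ t ≤ c * inputSize (enc a) ^ c + c ∧
      s.var 0 = if A a then 1 else 0

/-! ## Polynomials given by a tensor of coefficients -/

/-- `∑_{T ∈ [n]^k} w(T) x^T`, where `x^T = ∏ i, x_{T_i}`. -/
noncomputable def tensorPoly {k n : ℕ} (w : (Fin k → Fin n) → ℝ) (x : Fin n → ℝ) : ℝ :=
  ∑ T : Fin k → Fin n, w T * ∏ i, x (T i)

/-- An input of a certification algorithm: the coefficients, as integer multiples of
`1 / scale`, and the bound that is to be certified. -/
structure TensorInput (k : ℕ) where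
  n : ℕ
  scale : ℕ
  scale_pos : 0 < scale
  bound : ℤ
  entry : (Fin k → Fin n) → ℤ

/-- `n`, the scale and the bound, followed by the `n ^ k` entries. -/
def TensorInput.encode {k : ℕ} (d : TensorInput k) : List ℤ :=
  (d.n : ℤ) :: (d.scale : ℤ) :: d.bound ::
    List.ofFn fun j : Fin (d.n ^ k) => d.entry (finFunctionFinEquiv.symm j)

/-- The real coefficients `w` are given by the input `d` up to an error of at most `1 / scale`. -/
def TensorInput.Represents {k : ℕ} (d : TensorInput k) (w : (Fin k → Fin d.n) → ℝ) : Prop :=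
  ∀ T, |w T - (d.entry T : ℝ) / (d.scale : ℝ)| ≤ 1 / (d.scale : ℝ)

/-- The input for the real coefficients `w`, rounded down to multiples of `1 / N`, and the
bound `θ`. -/
noncomputable def roundedInput {k n : ℕ} (w : (Fin k → Fin n) → ℝ) (N : ℕ) (hN : 0 < N) (θ : ℤ) :
    TensorInput k where
  n := n
  scale := N
  scale_pos := hN
  bound := θ
  entry := fun T => ⌊(N : ℝ) * w T⌋

/-! ## Constraint satisfaction problems over `{-1, 1} = ℤˣ` -/

/-- A constraint: a negation pattern and a scope. -/
abbrev Constraint (k n : ℕ) : Type := (Fin k → ℤˣ) × (Fin k → Fin n)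

/-- An instance is a multiset of constraints, given by the multiplicities. -/
abbrev Instance (k n : ℕ) : Type := Constraint k n → ℕ

/-- The fraction of the constraints `P (c ∘ x_S)` of the instance that `x` satisfies. -/
noncomputable def Instance.val {k n : ℕ} (P : (Fin k → ℤˣ) → Prop) [DecidablePred P]
    (I : Instance k n) (x : Fin n → ℤˣ) : ℝ :=
  (∑ C : Constraint k n, if P (fun i => C.1 i * x (C.2 i)) then (I C : ℝ) else 0) /
    ∑ C : Constraint k n, (I C : ℝ)

/-- The optimum of an instance. -/
noncomputable def Instance.opt {k n : ℕ} (P : (Fin k → ℤˣ) → Prop) [DecidablePred P]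
    (I : Instance k n) : ℝ :=
  ⨆ x : Fin n → ℤˣ, I.val P x

/-- The `k`-XOR predicate, where `-1` stands for `true`. -/
abbrev kXor (k : ℕ) (z : Fin k → ℤˣ) : Prop := ∏ i, z i = -1

/-- The random instance that contains each of the `2 ^ k * n ^ k` constraints independently with
probability `p` (for `0 ≤ p ≤ 1`). -/
noncomputable def randomInstance (k n : ℕ) (p : ℝ) : Measure (Instance k n) :=
  Measure.pi fun _ : Constraint k n =>
    ENNReal.ofReal (1 - p) • Measure.dirac 0 + ENNReal.ofReal p • Measure.dirac 1

/-- `n`, followed by the multiplicities of the `2 ^ k * n ^ k` constraints; a pattern of signs is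
`(-1) ^ a` for a bit pattern `a`. -/
def encodeInstance {k : ℕ} (d : (n : ℕ) × Instance k n) : List ℤ :=
  (d.1 : ℤ) :: List.ofFn fun j : Fin (2 ^ k * d.1 ^ k) =>
    (d.2 (fun i => (-1) ^ (finFunctionFinEquiv.symm (finProdFinEquiv.symm j).1 i : ℕ),
      finFunctionFinEquiv.symm (finProdFinEquiv.symm j).2) : ℤ)

/-! Write k = c + 2m with c in {0, 1}, r = n^c and N = n^m. Cutting T into three pieces turns the
polynomial into ∑ z(i,a,b) y_i u_a u_b with i among r values, a and b among N values, and |y|, |u| ≤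
1 (`splitEquiv`). Cauchy–Schwarz over i bounds its square by r ∑_i (∑ z(i,a,b) u_a u_b)². Expand the
square and regroup the pairs (a,b), (a',b') as x = (a,b'), y = (a',b): what results is the quadratic
form of the symmetric matrix `pairMatrix` at u ⊗ u, plus a diagonal part of size at most ∑ z²
(`sq_sum_le_pairMatrix`). The regrouping matters, since ∑_i z(i,x) z(i,y) itself has rank at most r.

The quadratic form of a symmetric A at a vector U satisfies (U·AU)^t ≤ (U·U)^t tr A^t for t = 2^j, j
≥ 1, so two integer inequalities, `Certified`, prove the bound θ (`abs_sum_le_of_certificate`). With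
t of order log n the dimension factor in the trace costs only a constant (for fixed k) after the
t-th root, while repeated squaring keeps all numbers at polynomially many bits
(`polyTime_certified`).

Success is Markov's inequality. Put ρ = n^{k/2}, a = 1/ρ, q = √(pρ) ≥ 1. An entry v with |v| ≤ 1, |E
v| ≤ a and E|v| ≤ p = q²a has |E v^l| ≤ q^l a for all l ≥ 1, so by independence a product of 2t
entries along a walk has expectation at most q^{2t} a^{number of distinct entries}
(`abs_integral_prod_le`). No walk shapes are enumerated: extending a walk that has used a set F of
entries by one step multiplies the total weight by at most (1 + |F|)², because the factors a pay for
the free choices (`sum_step_le`). Hence E tr A^t ≤ N² (4q²t²)^t (`integral_trace_pow_le`).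

Real coefficients are rounded to multiples of 1/N for the scale N. This biases the means by at most
1/N ≤ a, which the moment bound tolerates, and the total rounding error is subtracted from the bound
to be certified. For k-XOR, the sum of the sign products of the constraints on a scope is the
coefficient of that scope; these coefficients are independent and centred, and a bound on the
resulting polynomial bounds Opt - 1/2 (`Instance.sum_ite_kXor`). -/

/-! ## A program logic with bit costs -/

theorem bitLength_add_le (a b : ℤ) : bitLength (a + b) ≤ bitLength a + bitLength b + 1 := by
  unfold bitLength
  rw [Nat.size_le]
  have h1 : a.natAbs < 2 ^ Nat.size a.natAbs := Nat.lt_size_self _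
  have h2 : b.natAbs < 2 ^ Nat.size b.natAbs := Nat.lt_size_self _
  have h3 := Int.natAbs_add_le a b
  have h4 : (2 : ℕ) ^ Nat.size a.natAbs ≤ 2 ^ (Nat.size a.natAbs + Nat.size b.natAbs) :=
    Nat.pow_le_pow_right (by norm_num) (by omega)
  have h5 : (2 : ℕ) ^ Nat.size b.natAbs ≤ 2 ^ (Nat.size a.natAbs + Nat.size b.natAbs) :=
    Nat.pow_le_pow_right (by norm_num) (by omega)
  rw [pow_succ]
  omega

theorem bitLength_neg (a : ℤ) : bitLength (-a) = bitLength a := by simp [bitLength]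

theorem bitLength_sub_le (a b : ℤ) : bitLength (a - b) ≤ bitLength a + bitLength b + 1 := by
  rw [sub_eq_add_neg, ← bitLength_neg b]
  exact bitLength_add_le a (-b)

theorem bitLength_mul_le (a b : ℤ) : bitLength (a * b) ≤ bitLength a + bitLength b := by
  unfold bitLength
  rw [Nat.size_le, Int.natAbs_mul, pow_add]
  exact Nat.mul_lt_mul'' (Nat.lt_size_self _) (Nat.lt_size_self _)

theorem bitLength_ediv_le (a b : ℤ) : bitLength (a / b) ≤ bitLength a :=
  Nat.size_le_size (Int.natAbs_ediv_le_natAbs a b)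

theorem bitLength_le_size {z : ℤ} {M : ℕ} (h : |z| ≤ M) : bitLength z ≤ M.size :=
  Nat.size_le_size (by rw [Int.abs_eq_natAbs] at h; exact_mod_cast h)

/-- All integers in the store are at most `M` in absolute value. -/
def Store.Bounded (M : ℕ) (s : Store) : Prop :=
  (∀ i, |s.var i| ≤ M) ∧ ∀ A j, |s.arr A j| ≤ M

/-- A weight that bounds the cost of an expression relative to the bit length of the store. -/
def AExp.weight : AExp → ℕ
  | .lit z => bitLength z + 1
  | .var _ => 1
  | .get _ e => e.weight + 1
  | .add e f => e.weight + f.weight + 1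
  | .sub e f => e.weight + f.weight + 1
  | .mul e f => e.weight + f.weight + 1
  | .div e f => e.weight + f.weight + 1

/-- Bit lengths are subadditive under every operation, up to one extra bit for sums and differences.
That bit is paid by the 1 which each node adds to the weight. -/
theorem AExp.bitLength_value_lt {M : ℕ} {s : Store} (hs : s.Bounded M) (e : AExp) :
    bitLength (e.value s) + 1 ≤ e.weight * (M.size + 1) := by
  induction e with
  | lit z => simp only [value, weight]; nlinarith [Nat.zero_le (bitLength z), Nat.zero_le M.size]
  | var i => simpa [value, weight] using bitLength_le_size (hs.1 i)
  | get A e ih =>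
    simp only [value, weight]
    have := bitLength_le_size (hs.2 A (e.value s).toNat)
    rw [add_mul]; omega
  | add e f he hf =>
    have := bitLength_add_le (e.value s) (f.value s)
    simp only [value, weight]; rw [add_mul, add_mul]; omega
  | sub e f he hf =>
    have := bitLength_sub_le (e.value s) (f.value s)
    simp only [value, weight]; rw [add_mul, add_mul]; omega
  | mul e f he hf =>
    have := bitLength_mul_le (e.value s) (f.value s)
    simp only [value, weight]; rw [add_mul, add_mul]; omega
  | div e f he hf =>
    have := bitLength_ediv_le (e.value s) (f.value s)
    simp only [value, weight]; rw [add_mul, add_mul]; omega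

/-- The weight is squared because it bounds both the number of nodes and, in units of `M.size + 1`,
the charge at each node. -/
theorem AExp.cost_le {M : ℕ} {s : Store} (hs : s.Bounded M) (e : AExp) :
    e.cost s ≤ e.weight ^ 2 * (M.size + 1) := by
  have aux : ∀ (a b X ca cb l : ℕ), ca ≤ a ^ 2 * X → cb ≤ b ^ 2 * X → l ≤ (a + b + 1) * X →
      ca + cb + l ≤ (a + b + 1) ^ 2 * X := by
    intro a b X ca cb l h1 h2 h3
    have : a ^ 2 * X + b ^ 2 * X + (a + b + 1) * X ≤ (a + b + 1) ^ 2 * X := by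
      rw [← add_mul, ← add_mul]
      exact Nat.mul_le_mul_right _ (by nlinarith)
    omega
  induction e with
  | lit z =>
    have := (AExp.lit z).bitLength_value_lt hs
    simp only [value, cost, weight] at this ⊢
    nlinarith [Nat.zero_le (bitLength z * M.size),
      Nat.zero_le (bitLength z * (bitLength z * M.size)),
      Nat.zero_le (bitLength z), Nat.zero_le M.size]
  | var i =>
    have := (AExp.var i).bitLength_value_lt hs
    simpa [value, cost, weight] using this
  | get A e ih =>
    have h := (AExp.get A e).bitLength_value_lt hs
    have := aux e.weight 0 _ _ 0 _ ih (by simp) h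
    simpa only [cost, weight, add_zero] using this
  | add e f he hf => exact aux _ _ _ _ _ _ he hf ((AExp.add e f).bitLength_value_lt hs)
  | sub e f he hf => exact aux _ _ _ _ _ _ he hf ((AExp.sub e f).bitLength_value_lt hs)
  | mul e f he hf => exact aux _ _ _ _ _ _ he hf ((AExp.mul e f).bitLength_value_lt hs)
  | div e f he hf => exact aux _ _ _ _ _ _ he hf ((AExp.div e f).bitLength_value_lt hs)

/-- The weight of a program: the constant in its time bound. -/
def Prog.weight : Prog → ℕ
  | .skip => 1
  | .assign _ e => e.weight ^ 2 + 1
  | .write _ e f => e.weight ^ 2 + f.weight ^ 2 + 1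
  | .seq P Q => P.weight + Q.weight
  | .ifPos e P Q => e.weight ^ 2 + 1 + P.weight + Q.weight
  | .whilePos e P => 2 * (e.weight ^ 2 + 1) + P.weight

/-- The loop depth of a program: the exponent in its time bound. -/
def Prog.depth : Prog → ℕ
  | .skip => 1
  | .assign _ _ => 1
  | .write _ _ _ => 1
  | .seq P Q => P.depth + Q.depth
  | .ifPos _ P Q => P.depth + Q.depth
  | .whilePos _ P => P.depth + 1

/-- The variables that a program may change. -/
def Prog.vars : Prog → List ℕ
  | .skip => []
  | .assign i _ => [i]
  | .write _ _ _ => []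
  | .seq P Q => P.vars ++ Q.vars
  | .ifPos _ P Q => P.vars ++ Q.vars
  | .whilePos _ P => P.vars

/-- The arrays that a program may change. -/
def Prog.arrs : Prog → List ℕ
  | .skip => []
  | .assign _ _ => []
  | .write A _ _ => [A]
  | .seq P Q => P.arrs ++ Q.arrs
  | .ifPos _ P Q => P.arrs ++ Q.arrs
  | .whilePos _ P => P.arrs

/-- `s'` agrees with `s` on everything that `P` does not mention as a target. -/
def Prog.Frame (P : Prog) (s s' : Store) : Prop :=
  (∀ i, i ∉ P.vars → s'.var i = s.var i) ∧ ∀ A, A ∉ P.arrs → s'.arr A = s.arr A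

theorem Prog.Frame.refl (P : Prog) (s : Store) : P.Frame s s := ⟨fun _ _ => rfl, fun _ _ => rfl⟩

theorem Prog.Frame.trans {P : Prog} {s s' s'' : Store} (h : P.Frame s s') (h' : P.Frame s' s'') :
    P.Frame s s'' :=
  ⟨fun i hi => (h'.1 i hi).trans (h.1 i hi), fun A hA => (h'.2 A hA).trans (h.2 A hA)⟩

theorem Prog.Frame.mono {P Q : Prog} {s s' : Store} (h : P.Frame s s') (hv : P.vars ⊆ Q.vars)
    (ha : P.arrs ⊆ Q.arrs) : Q.Frame s s' :=
  ⟨fun i hi => h.1 i fun h' => hi (hv h'), fun A hA => h.2 A fun h' => hA (ha h')⟩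

theorem Exec.frame {P : Prog} {s s' : Store} {t : ℕ} (h : Exec P s t s') : P.Frame s s' := by
  induction h with
  | skip s => exact .refl _ _
  | assign s i e =>
    refine ⟨fun j hj => ?_, fun _ _ => rfl⟩
    simp only [Prog.vars, List.mem_singleton] at hj
    simp [Store.setVar, hj]
  | write s A e f =>
    refine ⟨fun _ _ => rfl, fun B hB => ?_⟩
    simp only [Prog.arrs, List.mem_singleton] at hB
    simp [Store.setCell, hB]
  | seq _ _ ihP ihQ =>
    exact (ihP.mono (by simp [Prog.vars]) (by simp [Prog.arrs])).trans
      (ihQ.mono (by simp [Prog.vars]) (by simp [Prog.arrs]))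
  | ifTrue _ _ ih => exact ih.mono (by simp [Prog.vars]) (by simp [Prog.arrs])
  | ifFalse _ _ ih => exact ih.mono (by simp [Prog.vars]) (by simp [Prog.arrs])
  | whileDone _ => exact .refl _ _
  | whileStep _ _ _ ihP ihW => exact (ihP.mono (fun _ h => h) (fun _ h => h)).trans ihW

theorem Prog.depth_pos (P : Prog) : 1 ≤ P.depth := by
  induction P <;> simp only [depth] <;> omega

/-- Started in the store `s` with entries at most `M`, the program `P` halts in a store with
entries at most `M` that satisfies `Q`, at a cost that is polynomial in `X`. -/
def Ok (M X : ℕ) (P : Prog) (s : Store) (Q : Store → Prop) : Prop :=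
  s.Bounded M → ∃ t s', Exec P s t s' ∧ t ≤ P.weight * X ^ P.depth ∧ s'.Bounded M ∧ Q s'

/-! ### Total correctness rules with a cost bound -/

section rules

variable {M X : ℕ} {s : Store} {Q : Store → Prop}

theorem Ok.mono {P : Prog} {Q' : Store → Prop} (h : Ok M X P s Q)
    (h' : ∀ s', P.Frame s s' → Q s' → Q' s') : Ok M X P s Q' := by
  intro hs
  obtain ⟨t, s', he, ht, hb, hq⟩ := h hs
  exact ⟨t, s', he, ht, hb, h' s' he.frame hq⟩

/-- Makes the size bound on an intermediate store available in a verification; copying an array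
needs it. -/
theorem Ok.of_bounded {P : Prog} (h : s.Bounded M → Ok M X P s Q) : Ok M X P s Q :=
  fun hs => h hs hs

theorem Ok.skip (hX : M.size + 2 ≤ X) (h : Q s) : Ok M X .skip s Q := fun hs =>
  ⟨1, s, .skip s, by simp [Prog.weight, Prog.depth]; omega, hs, h⟩

theorem AExp.cost_add_one_le (hX : M.size + 2 ≤ X) (hs : s.Bounded M) (e : AExp) :
    e.cost s + 1 ≤ (e.weight ^ 2 + 1) * X := by
  have h := e.cost_le hs
  have : e.weight ^ 2 * (M.size + 1) ≤ e.weight ^ 2 * X := Nat.mul_le_mul_left _ (by omega)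
  rw [add_mul]; omega

theorem Store.Bounded.setVar (hs : s.Bounded M) (i : ℕ) {z : ℤ} (hz : |z| ≤ M) :
    (s.setVar i z).Bounded M := by
  refine ⟨fun j => ?_, hs.2⟩
  simp only [Store.setVar, Function.update_apply]
  split
  · exact hz
  · exact hs.1 j

theorem Ok.assign (hX : M.size + 2 ≤ X) {i : ℕ} {e : AExp} (hv : |e.value s| ≤ M)
    (h : Q (s.setVar i (e.value s))) : Ok M X (.assign i e) s Q := fun hs =>
  ⟨_, _, .assign s i e, by simpa [Prog.weight, Prog.depth] using e.cost_add_one_le hX hs,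
    hs.setVar i hv, h⟩

theorem Ok.write (hX : M.size + 2 ≤ X) {A : ℕ} {e f : AExp} (hv : |f.value s| ≤ M)
    (h : Q (s.setCell A (e.value s).toNat (f.value s))) : Ok M X (.write A e f) s Q := by
  intro hs
  refine ⟨_, _, .write s A e f, ?_, ⟨hs.1, fun B j => ?_⟩, h⟩
  · have h1 := e.cost_add_one_le hX hs
    have h2 := f.cost_add_one_le hX hs
    have h3 := f.cost_le hs
    have : f.weight ^ 2 * (M.size + 1) ≤ f.weight ^ 2 * X := Nat.mul_le_mul_left _ (by omega)
    simp only [Prog.weight, Prog.depth, pow_one]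
    rw [add_mul] at h1
    rw [add_mul, add_mul]
    omega
  · simp only [Store.setCell, Function.update_apply]
    split
    · simp only [Function.update_apply]
      split
      · exact hv
      · exact hs.2 A j
    · exact hs.2 B j

theorem Ok.seq (hX : M.size + 2 ≤ X) {P R : Prog}
    (h : Ok M X P s fun s' => Ok M X R s' Q) : Ok M X (.seq P R) s Q := by
  intro hs
  obtain ⟨t, s', he, ht, hb, hq⟩ := h hs
  obtain ⟨u, s'', he', hu, hb', hq'⟩ := hq hb
  refine ⟨_, _, .seq he he', ?_, hb', hq'⟩
  have h1 : X ^ P.depth ≤ X ^ (P.depth + R.depth) := Nat.pow_le_pow_right (by omega) (by omega)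
  have h2 : X ^ R.depth ≤ X ^ (P.depth + R.depth) := Nat.pow_le_pow_right (by omega) (by omega)
  have h3 := Nat.mul_le_mul_left P.weight h1
  have h4 := Nat.mul_le_mul_left R.weight h2
  simp only [Prog.weight, Prog.depth]
  rw [add_mul]
  omega

theorem Ok.ifPos (hX : M.size + 2 ≤ X) {e : AExp} {P R : Prog}
    (h₁ : 0 < e.value s → Ok M X P s Q) (h₂ : ¬ 0 < e.value s → Ok M X R s Q) :
    Ok M X (.ifPos e P R) s Q := by
  intro hs
  have hc := e.cost_add_one_le hX hs
  have hP := P.depth_pos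
  have hR := R.depth_pos
  have h0 : (e.weight ^ 2 + 1) * X ≤ (e.weight ^ 2 + 1) * X ^ (P.depth + R.depth) :=
    Nat.mul_le_mul_left _ (Nat.le_self_pow (by omega) _)
  have h1 := Nat.mul_le_mul_left P.weight
    (Nat.pow_le_pow_right (show 0 < X by omega) (show P.depth ≤ P.depth + R.depth by omega))
  have h2 := Nat.mul_le_mul_left R.weight
    (Nat.pow_le_pow_right (show 0 < X by omega) (show R.depth ≤ P.depth + R.depth by omega))
  by_cases h : 0 < e.value s
  · obtain ⟨t, s', he, ht, hb, hq⟩ := h₁ h hs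
    refine ⟨_, _, .ifTrue h he, ?_, hb, hq⟩
    simp only [Prog.weight, Prog.depth]
    rw [add_mul (e.weight ^ 2 + 1 + P.weight), add_mul (e.weight ^ 2 + 1)]
    omega
  · obtain ⟨t, s', he, ht, hb, hq⟩ := h₂ h hs
    refine ⟨_, _, .ifFalse h he, ?_, hb, hq⟩
    simp only [Prog.weight, Prog.depth]
    rw [add_mul (e.weight ^ 2 + 1 + P.weight), add_mul (e.weight ^ 2 + 1)]
    omega

/-- The invariant is indexed by the iteration, so termination follows from the guard being
equivalent to q < n. The guard is evaluated n + 1 ≤ 2X times, whence the factor 2 in `Prog.weight`;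
the iterations account for one more power of X. -/
theorem Ok.whilePos (hX : M.size + 2 ≤ X) {e : AExp} {P : Prog} {n : ℕ} (hn : n ≤ X)
    (Inv : ℕ → Store → Prop) (h0 : Inv 0 s)
    (hcond : ∀ q s', q ≤ n → P.Frame s s' → Inv q s' → (0 < e.value s' ↔ q < n))
    (hstep : ∀ q s', q < n → P.Frame s s' → Inv q s' → Ok M X P s' (Inv (q + 1))) :
    Ok M X (.whilePos e P) s (Inv n) := by
  -- Induction on the number d of iterations that remain.
  have key : ∀ d q s', q + d = n → P.Frame s s' → Inv q s' → s'.Bounded M →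
      ∃ t s'', Exec (.whilePos e P) s' t s'' ∧
        t ≤ (d + 1) * ((e.weight ^ 2 + 1) * X) + d * (P.weight * X ^ P.depth) ∧
        s''.Bounded M ∧ Inv n s'' := by
    intro d
    induction d with
    | zero =>
      intro q s' hq hF hI hb
      obtain rfl : q = n := by omega
      refine ⟨_, s', .whileDone ?_, ?_, hb, hI⟩
      · rw [hcond q s' le_rfl hF hI]; omega
      · have := e.cost_add_one_le hX hb
        omega
    | succ d ih =>
      intro q s' hq hF hI hb
      obtain ⟨t, s₁, he, ht, hb₁, hI₁⟩ := hstep q s' (by omega) hF hI hb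
      obtain ⟨u, s₂, he', hu, hb₂, hI₂⟩ :=
        ih (q + 1) s₁ (by omega) (hF.trans he.frame) hI₁ hb₁
      refine ⟨_, s₂, .whileStep ((hcond q s' (by omega) hF hI).2 (by omega)) he he', ?_, hb₂, hI₂⟩
      have := e.cost_add_one_le hX hb
      rw [add_mul (d + 1) 1, add_mul d 1 (P.weight * X ^ P.depth)]
      omega
  intro hs
  obtain ⟨t, s', he, ht, hb, hI⟩ := key n 0 s (by omega) (.refl _ _) h0 hs
  refine ⟨t, s', he, ht.trans ?_, hb, hI⟩
  have hP := P.depth_pos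
  simp only [Prog.weight, Prog.depth]
  have h1 : X * X ≤ X ^ (P.depth + 1) := by
    rw [pow_succ]; exact Nat.mul_le_mul_right _ (Nat.le_self_pow (by omega) _)
  have h2 : (n + 1) * ((e.weight ^ 2 + 1) * X) ≤ 2 * (e.weight ^ 2 + 1) * X ^ (P.depth + 1) := by
    calc (n + 1) * ((e.weight ^ 2 + 1) * X) ≤ (2 * X) * ((e.weight ^ 2 + 1) * X) :=
          Nat.mul_le_mul_right _ (by omega)
      _ = 2 * (e.weight ^ 2 + 1) * (X * X) := by ring
      _ ≤ _ := Nat.mul_le_mul_left _ h1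
  have h3 : n * (P.weight * X ^ P.depth) ≤ P.weight * X ^ (P.depth + 1) := by
    calc n * (P.weight * X ^ P.depth) ≤ X * (P.weight * X ^ P.depth) := Nat.mul_le_mul_right _ hn
      _ = _ := by ring
  rw [add_mul (2 * (e.weight ^ 2 + 1))]
  omega

/-- `for i := 0, 1, ..., var u - 1 do P` -/
def Prog.forLoop (i u : ℕ) (P : Prog) : Prog :=
  .seq (.assign i (.lit 0))
    (.whilePos (.sub (.var u) (.var i)) (.seq P (.assign i (.add (.var i) (.lit 1)))))

@[simp] theorem Store.setVar_var_self (s : Store) (i : ℕ) (z : ℤ) : (s.setVar i z).var i = z := by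
  simp [Store.setVar]

theorem Store.setVar_var_of_ne (s : Store) {i j : ℕ} (z : ℤ) (h : j ≠ i) :
    (s.setVar i z).var j = s.var j := by
  simp [Store.setVar, h]

@[simp] theorem Store.setVar_arr (s : Store) (i : ℕ) (z : ℤ) : (s.setVar i z).arr = s.arr := rfl

theorem Store.setVar_var (s : Store) (i j : ℕ) (z : ℤ) :
    (s.setVar i z).var j = if j = i then z else s.var j := by
  simp [Store.setVar, Function.update_apply]

theorem Store.setCell_arr (s : Store) (A B j l : ℕ) (z : ℤ) :
    (s.setCell A j z).arr B l = if B = A ∧ l = j then z else s.arr B l := by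
  by_cases h : B = A
  · subst h; simp [Store.setCell, Function.update_apply]
  · simp [Store.setCell, h]

theorem Ok.forLoop (hX : M.size + 2 ≤ X) {i u n : ℕ} {P : Prog} (hu : s.var u = n) (hn : n ≤ X)
    (hnM : n ≤ M) (hi : i ∉ P.vars) (hu' : u ∉ P.vars) (hiu : u ≠ i) (Inv : ℕ → Store → Prop)
    (h0 : Inv 0 (s.setVar i 0))
    (hstep : ∀ q s', q < n → (Prog.forLoop i u P).Frame s s' → s'.var i = q → Inv q s' →
      Ok M X P s' fun s'' => Inv (q + 1) (s''.setVar i (q + 1))) :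
    Ok M X (Prog.forLoop i u P) s (Inv n) := by
  refine .seq hX (.assign hX (by simp [AExp.value]) ?_)
  have hF0 : (Prog.forLoop i u P).Frame s (s.setVar i 0) := by
    refine ⟨fun j hj => Store.setVar_var_of_ne _ _ ?_, fun _ _ => rfl⟩
    rintro rfl
    simp [Prog.forLoop, Prog.vars] at hj
  have hFb : ∀ s', (Prog.seq P (.assign i (.add (.var i) (.lit 1)))).Frame (s.setVar i 0) s' →
      (Prog.forLoop i u P).Frame s s' := fun s' h =>
    hF0.trans (h.mono (by simp [Prog.forLoop, Prog.vars]) (by simp [Prog.forLoop, Prog.arrs]))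
  have hFu : ∀ s', (Prog.seq P (.assign i (.add (.var i) (.lit 1)))).Frame (s.setVar i 0) s' →
      s'.var u = n := fun s' h => by
    rw [h.1 u (by simp [Prog.vars, hu', hiu]), Store.setVar_var_of_ne _ _ hiu, hu]
  refine (Ok.whilePos hX hn (fun q s' => s'.var i = q ∧ Inv q s') ⟨by simp, h0⟩
    ?_ ?_).mono fun s' _ h => h.2
  · rintro q s' hq hF ⟨hiq, -⟩
    simp only [AExp.value, hiq, hFu s' hF]
    omega
  · rintro q s' hq hF ⟨hiq, hI⟩
    refine .seq hX ((hstep q s' hq (hFb s' hF) hiq hI).mono fun s'' hF' hI' => ?_)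
    have hi'' : s''.var i = q := by rw [hF'.1 i hi, hiq]
    refine .assign hX ?_ ?_
    · simp only [AExp.value, hi'']
      rw [abs_of_nonneg (by positivity)]
      norm_cast
      omega
    · simp only [AExp.value, hi'']
      exact ⟨by simp, hI'⟩

end rules

/-! ## The certificate and a program that checks it -/

/-- The matrix `x, y ↦ ∑ i, z (i, x₁, y₂) z (i, y₁, x₂)` off the diagonal, and `0` on it,
as an array.
The triple `(i, a, b)` has the index `i + r (a + N b)` and the pair `(a, b)` the index `a + N b`. -/
def pairFlat (r N : ℕ) (z : ℕ → ℤ) (q : ℕ) : ℤ :=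
  if q / (N * N) = q % (N * N) then 0 else
    ∑ i ∈ Finset.range r, z (i + r * (q / (N * N) % N + N * (q % (N * N) / N))) *
      z (i + r * (q % (N * N) % N + N * (q / (N * N) / N)))

/-- The square of an `S × S` matrix, as an array. -/
def sqFlat (S : ℕ) (B : ℕ → ℤ) (q : ℕ) : ℤ :=
  ∑ t ∈ Finset.range S, B (q / S * S + t) * B (t * S + q % S)

/-- The number of times that the matrix is squared. -/
def levels (n : ℕ) : ℕ := Nat.clog 2 (n.size + 2)

/-- The certificate for the bound `θ`. -/
def Certified (n r N : ℕ) (z : ℕ → ℤ) (θ : ℤ) : Prop :=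
  0 ≤ θ ∧ 2 * r * ∑ q ∈ Finset.range (r * (N * N)), z q * z q ≤ θ * θ ∧
    (2 * r * (N * N)) ^ 2 ^ levels n *
      ∑ t ∈ Finset.range (N * N), (sqFlat (N * N))^[levels n] (pairFlat r N z) (t * (N * N) + t) ≤
    (θ * θ) ^ 2 ^ levels n

/-! ### Loops that accumulate a sum and loops that fill an array -/

section rules

variable {M X : ℕ} {s : Store}

/-- The bound is on the sum of absolute values because every partial sum passes through the
accumulator and must stay below M. -/
theorem Ok.sumLoop (hX : M.size + 2 ≤ X) {i u a n : ℕ} {E : AExp} (f : ℕ → ℤ) (hu : s.var u = n)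
    (hn : n ≤ X) (hnM : n ≤ M) (hia : i ≠ a) (hua : u ≠ a) (hui : u ≠ i) (ha : s.var a = 0)
    (hM : ∑ q ∈ Finset.range n, |f q| ≤ M)
    (hE : ∀ q s', q < n → (∀ v, v ≠ i → v ≠ a → s'.var v = s.var v) → s'.arr = s.arr →
      s'.var i = (q : ℤ) → E.value s' = f q) :
    Ok M X (.forLoop i u (.assign a (.add (.var a) E))) s
      fun s' => s'.var a = ∑ q ∈ Finset.range n, f q := by
  have hpart : ∀ q, q ≤ n → |∑ j ∈ Finset.range q, f j| ≤ M := fun q hq =>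
    (Finset.abs_sum_le_sum_abs _ _).trans ((Finset.sum_le_sum_of_subset_of_nonneg
      (Finset.range_subset_range.2 hq) fun _ _ _ => abs_nonneg _).trans hM)
  refine .forLoop hX hu hn hnM (by simpa [Prog.vars] using hia) (by simpa [Prog.vars] using hua) hui
    (fun q s' => s'.var a = ∑ j ∈ Finset.range q, f j) ?_ ?_
  · simpa [Store.setVar_var, hia.symm] using ha
  · intro q s' hq hF hi hI
    have hv : (AExp.add (.var a) E).value s' = ∑ j ∈ Finset.range (q + 1), f j := by
      rw [Finset.sum_range_succ, ← hI, ← hE q s' hq (fun v h1 h2 => hF.1 v ?_)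
        (funext fun A => hF.2 A ?_) hi]
      · rfl
      · simp [Prog.forLoop, Prog.vars, h1, h2]
      · simp [Prog.forLoop, Prog.arrs]
    refine .assign hX (by rw [hv]; exact hpart _ hq) ?_
    rw [hv]
    simp [Store.setVar_var, hia.symm]

theorem Ok.fillLoop (hX : M.size + 2 ≤ X) {i u A n : ℕ} {P : Prog} {E : AExp} (F : ℕ → ℤ)
    (hu : s.var u = n) (hn : n ≤ X) (hnM : n ≤ M) (hi : i ∉ P.vars) (hu' : u ∉ P.vars)
    (hiu : u ≠ i) (hA : A ∉ P.arrs) (hF : ∀ q < n, |F q| ≤ M)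
    (hP : ∀ q s', q < n → (Prog.forLoop i u (.seq P (.write A (.var i) E))).Frame s s' →
      s'.var i = q → Ok M X P s' fun s'' => E.value s'' = F q) :
    Ok M X (.forLoop i u (.seq P (.write A (.var i) E))) s
      fun s' => ∀ j, s'.arr A j = if j < n then F j else s.arr A j := by
  refine .forLoop hX hu hn hnM (by simpa [Prog.vars] using hi) (by simpa [Prog.vars] using hu') hiu
    (fun q s' => ∀ j, s'.arr A j = if j < q then F j else s.arr A j) (by simp) ?_
  intro q s' hq hF' hiq hI
  refine .seq hX ((hP q s' hq hF' hiq).mono fun s'' hF'' hE => ?_)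
  refine .write hX (by rw [hE]; exact hF q hq) fun j => ?_
  rw [Store.setVar_arr, Store.setCell_arr, hE, hF''.2 A hA, hI j]
  have : (AExp.value s'' (.var i)).toNat = q := by simp [AExp.value, hF''.1 i hi, hiq]
  rw [this]
  by_cases h : j = q
  · simp [h]
  · have : j < q + 1 ↔ j < q := by omega
    simp [h, this]

end rules

/-- `e ^ m` -/
def AExp.pow (e : AExp) : ℕ → AExp
  | 0 => .lit 1
  | m + 1 => .mul (e.pow m) e

@[simp] theorem AExp.value_pow (s : Store) (e : AExp) (m : ℕ) :
    (e.pow m).value s = e.value s ^ m := by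
  induction m with
  | zero => simp [AExp.pow, AExp.value]
  | succ m ih => simp [AExp.pow, AExp.value, ih, pow_succ]

/-- Expressions have no remainder operation, so programs compute q mod S in this way. -/
theorem Int.natCast_sub_mul_ediv (q S : ℕ) : (q : ℤ) - S * (q / S : ℤ) = ((q % S : ℕ) : ℤ) := by
  rw [Int.natCast_mod, Int.emod_def]

/-- Computes the row and the column of the position `var 9`. -/
def rowCol : Prog :=
  .seq (.assign 18 (.div (.var 9) (.var 4)))
    (.assign 19 (.sub (.var 9) (.mul (.var 4) (.var 18))))

/-- Fills array `2` with the matrix of pairs. -/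
def pairLoop : Prog :=
  .forLoop 9 6 (.seq
    (.seq rowCol
    (.seq (.assign 20 (.add (.sub (.var 18) (.mul (.var 3) (.div (.var 18) (.var 3))))
      (.mul (.var 3) (.div (.var 19) (.var 3)))))
    (.seq (.assign 21 (.add (.sub (.var 19) (.mul (.var 3) (.div (.var 19) (.var 3))))
      (.mul (.var 3) (.div (.var 18) (.var 3)))))
    (.seq (.assign 11 (.lit 0))
    (.ifPos (.mul (.sub (.var 18) (.var 19)) (.sub (.var 18) (.var 19)))
      (.forLoop 10 2 (.assign 11 (.add (.var 11)
        (.mul (.get 1 (.add (.var 10) (.mul (.var 2) (.var 20))))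
          (.get 1 (.add (.var 10) (.mul (.var 2) (.var 21))))))))
      .skip)))))
    (.write 2 (.var 9) (.var 11)))

/-- Fills array `3` with the square of the matrix in array `2`. -/
def sqLoop : Prog :=
  .forLoop 9 6 (.seq
    (.seq rowCol
    (.seq (.assign 11 (.lit 0))
    (.forLoop 10 4 (.assign 11 (.add (.var 11)
      (.mul (.get 2 (.add (.mul (.var 18) (.var 4)) (.var 10)))
        (.get 2 (.add (.mul (.var 10) (.var 4)) (.var 19)))))))))
    (.write 3 (.var 9) (.var 11)))

/-- Copies array `3` into array `2`. -/
def copyLoop : Prog := .forLoop 9 6 (.seq .skip (.write 2 (.var 9) (.get 3 (.var 9))))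

/-- Squares the matrix until `var 7 ≤ var 15`. -/
def powerLoop : Prog :=
  .whilePos (.sub (.var 7) (.var 15))
    (.seq sqLoop (.seq copyLoop
    (.seq (.assign 16 (.mul (.var 16) (.var 16)))
    (.seq (.assign 17 (.mul (.var 17) (.var 17)))
      (.assign 15 (.add (.var 15) (.var 15)))))))

/-! ### Computing the matrix of pairs and its iterated squares -/

section loops

variable {M X : ℕ} {s : Store} {N r : ℕ}

theorem rowCol_ok (hX : M.size + 2 ≤ X) {q S : ℕ} (hq : s.var 9 = q) (hS : s.var 4 = S)
    (hqM : q ≤ M) :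
    Ok M X rowCol s fun s' => s'.var 18 = (q / S : ℕ) ∧ s'.var 19 = (q % S : ℕ) := by
  have hd : ((q / S : ℕ) : ℤ) ≤ M := by exact_mod_cast (Nat.div_le_self q S).trans hqM
  have hm : ((q % S : ℕ) : ℤ) ≤ M := by exact_mod_cast (Nat.mod_le q S).trans hqM
  refine .seq hX (.assign hX ?_ (.assign hX ?_ ?_))
  · simp only [AExp.value, hq, hS]
    rw [← Int.natCast_div, abs_of_nonneg (Int.natCast_nonneg _)]
    exact hd
  · simp only [AExp.value, Store.setVar_var, hq, hS]
    norm_num [hS]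
    rw [Int.natCast_sub_mul_ediv, abs_of_nonneg (Int.natCast_nonneg _)]
    exact hm
  · simp only [AExp.value, Store.setVar_var, hq, hS]
    norm_num [hS]
    rw [Int.natCast_sub_mul_ediv, Int.natCast_mod]

theorem pairLoop_ok (hX : M.size + 2 ≤ X) (hr : s.var 2 = r) (hN : s.var 3 = N)
    (hS : s.var 4 = (N * N : ℕ)) (hSS : s.var 6 = (N * N * (N * N) : ℕ)) (hrX : r ≤ X) (hrM : r ≤ M)
    (hSX : N * N * (N * N) ≤ X) (hSM : N * N * (N * N) ≤ M)
    (hb : ∀ q, ∑ i ∈ Finset.range r,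
      |s.arr 1 (i + r * (q / (N * N) % N + N * (q % (N * N) / N))) *
        s.arr 1 (i + r * (q % (N * N) % N + N * (q / (N * N) / N)))| ≤ M) :
    Ok M X pairLoop s fun s' => ∀ j < N * N * (N * N), s'.arr 2 j = pairFlat r N (s.arr 1) j := by
  have hpb : ∀ q, |pairFlat r N (s.arr 1) q| ≤ M := fun q => by
    unfold pairFlat
    split
    · simp
    · exact (Finset.abs_sum_le_sum_abs _ _).trans (hb q)
  refine (Ok.fillLoop hX (pairFlat r N (s.arr 1)) hSS hSX hSM ?_ ?_ (by norm_num) ?_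
    (fun q _ => hpb q) ?_).mono fun s' _ h j hj => by rw [h j, if_pos hj]
  · simp [Prog.vars, rowCol, Prog.forLoop]
  · simp [Prog.vars, rowCol, Prog.forLoop]
  · simp [Prog.arrs, rowCol, Prog.forLoop]
  intro q s₁ hq hF h9
  have hv : ∀ v, v ∉ [9, 18, 19, 20, 21, 11, 10] → s₁.var v = s.var v := fun v hv => by
    refine hF.1 v ?_
    simp [Prog.vars, rowCol, Prog.forLoop] at hv ⊢
    omega
  have ha : s₁.arr 1 = s.arr 1 := hF.2 1 (by simp [Prog.arrs, rowCol, Prog.forLoop])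
  clear hF
  have hNpos : 0 < N := Nat.pos_of_ne_zero fun h => by simp [h] at hq
  refine .seq hX ((rowCol_ok hX h9 ((hv 4 (by simp)).trans hS) (by omega)).mono ?_)
  rintro s₂ hF₂ ⟨h18, h19⟩
  have hv₂ : ∀ v, v ∉ [9, 18, 19, 20, 21, 11, 10] → s₂.var v = s.var v := fun v hv' => by
    rw [hF₂.1 v, hv v hv']
    simp [Prog.vars, rowCol] at hv' ⊢
    omega
  have ha₂ : s₂.arr 1 = s.arr 1 := (hF₂.2 1 (by simp [Prog.arrs, rowCol])).trans ha
  clear hF₂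
  set S := N * N with hSdef
  have hSpos : 0 < S := Nat.mul_pos hNpos hNpos
  have hx : q / S < S := Nat.div_lt_of_lt_mul hq
  have hy : q % S < S := Nat.mod_lt _ hSpos
  have huv : ∀ a b, a < S → b < S → a % N + N * (b / N) < S := fun a b _ hb' => by
    have h1 : a % N < N := Nat.mod_lt _ hNpos
    have h2 : b / N < N := Nat.div_lt_of_lt_mul hb'
    nlinarith
  have hSle : S ≤ S * S := Nat.le_mul_self S
  have h3 : s₂.var 3 = N := (hv₂ 3 (by simp)).trans hN
  have hval : ∀ a b : ℕ, ((a : ℤ) - N * (a / N : ℤ)) + N * (b / N : ℤ) =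
      ((a % N + N * (b / N) : ℕ) : ℤ) := fun a b => by
    rw [Int.natCast_sub_mul_ediv]; push_cast; rfl
  have hle : ∀ a b : ℕ, a < S → b < S → |((a % N + N * (b / N) : ℕ) : ℤ)| ≤ M := fun a b h h' => by
    rw [abs_of_nonneg (Int.natCast_nonneg _)]
    have := huv a b h h'
    exact_mod_cast (by omega)
  refine .seq hX (.assign hX ?_ ?_)
  · simp only [AExp.value, h18, h19, h3, hval]
    exact hle _ _ hx hy
  simp only [AExp.value, h18, h19, h3, hval]
  refine .seq hX (.assign hX ?_ ?_)
  · simp only [AExp.value, Store.setVar_var, h18, h19, h3]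
    norm_num only [h18, h19, h3, hval, if_true, if_false]
    exact hle _ _ hy hx
  simp only [AExp.value, Store.setVar_var, h18, h19, h3]
  norm_num only [h18, h19, h3, hval, if_true, if_false]
  refine .seq hX (.assign hX (by simp [AExp.value]) ?_)
  -- The guard is the square of row minus column: positivity is the only available test, and this
  -- square is positive exactly off the diagonal.
  refine .ifPos hX (fun hpos => ?_) (fun hpos => ?_)
  · have hne : q / S ≠ q % S := by
      intro h
      simp only [AExp.value, Store.setVar_var] at hpos
      norm_num only [h18, h19, h, if_false, sub_self] at hpos
    have hpf : pairFlat r N (s.arr 1) q = ∑ i ∈ Finset.range r,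
        s.arr 1 (i + r * (q / S % N + N * (q % S / N))) *
        s.arr 1 (i + r * (q % S % N + N * (q / S / N))) := by
      rw [pairFlat, if_neg hne]
    refine (Ok.sumLoop hX (fun i => s.arr 1 (i + r * (q / S % N + N * (q % S / N))) *
        s.arr 1 (i + r * (q % S % N + N * (q / S / N)))) (n := r) ?_ hrX hrM (by norm_num)
        (by norm_num) (by norm_num) (by simp [AExp.value]) (hb q) ?_).mono ?_
    · simpa [Store.setVar_var] using (hv₂ 2 (by simp)).trans hr
    · intro i s' hi hF ha' h10
      have e1 := hF 20 (by norm_num) (by norm_num)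
      have e2 := hF 21 (by norm_num) (by norm_num)
      have e3 := hF 2 (by norm_num) (by norm_num)
      have e4 := (hv₂ 2 (by simp)).trans hr
      simp only [Store.setVar_var] at e1 e2 e3
      norm_num only [if_true, if_false] at e1 e2 e3
      simp only [AExp.value, ha', Store.setVar_arr, ha₂, h10, e1, e2, e3, e4]
      norm_cast
    · intro s' _ h
      rw [hpf, ← h]
  · have he : q / S = q % S := by
      by_contra h
      apply hpos
      simp only [AExp.value, Store.setVar_var, h18, h19]
      norm_num only [h18, h19, if_true, if_false]
      apply mul_self_pos.2
      rw [sub_ne_zero]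
      exact_mod_cast h
    refine .skip hX ?_
    rw [pairFlat, if_pos he]
    simp [AExp.value]

theorem sqLoop_ok (hX : M.size + 2 ≤ X) {S : ℕ} (hS : s.var 4 = S) (hSS : s.var 6 = (S * S : ℕ))
    (hSX : S * S ≤ X) (hSM : S * S ≤ M) (B : ℕ → ℤ) (hB : ∀ q < S * S, s.arr 2 q = B q)
    (hb : ∀ q < S * S, ∑ t ∈ Finset.range S, |B (q / S * S + t) * B (t * S + q % S)| ≤ M) :
    Ok M X sqLoop s fun s' => ∀ j < S * S, s'.arr 3 j = sqFlat S B j := by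
  refine (Ok.fillLoop hX (sqFlat S B) hSS hSX hSM ?_ ?_ (by norm_num) ?_
    (fun q hq => (Finset.abs_sum_le_sum_abs _ _).trans (hb q hq)) ?_).mono
      fun s' _ h j hj => by rw [h j, if_pos hj]
  · simp [Prog.vars, rowCol, Prog.forLoop]
  · simp [Prog.vars, rowCol, Prog.forLoop]
  · simp [Prog.arrs, rowCol, Prog.forLoop]
  intro q s₁ hq hF h9
  have h4 : s₁.var 4 = S :=
    (hF.1 4 (by simp [Prog.vars, rowCol, Prog.forLoop])).trans hS
  have ha : s₁.arr 2 = s.arr 2 := hF.2 2 (by simp [Prog.arrs, rowCol, Prog.forLoop])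
  clear hF
  have hSpos : 0 < S := Nat.pos_of_ne_zero fun h => by simp [h] at hq
  have hx : q / S < S := Nat.div_lt_of_lt_mul hq
  have hy : q % S < S := Nat.mod_lt _ hSpos
  have hSle : S ≤ S * S := Nat.le_mul_self S
  refine .seq hX ((rowCol_ok hX h9 h4 (by omega)).mono ?_)
  rintro s₂ hF₂ ⟨h18, h19⟩
  have h4₂ : s₂.var 4 = S := (hF₂.1 4 (by simp [Prog.vars, rowCol])).trans h4
  have ha₂ : s₂.arr 2 = s.arr 2 := (hF₂.2 2 (by simp [Prog.arrs, rowCol])).trans ha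
  clear hF₂
  refine .seq hX (.assign hX (by simp [AExp.value]) ?_)
  refine Ok.sumLoop hX (fun t => B (q / S * S + t) * B (t * S + q % S)) (n := S) ?_ (by omega)
    (by omega) (by norm_num) (by norm_num) (by norm_num) (by simp [AExp.value]) (hb q hq) ?_
  · simpa [Store.setVar_var] using h4₂
  · intro t s' ht hF ha' h10
    have e1 := hF 18 (by norm_num) (by norm_num)
    have e2 := hF 19 (by norm_num) (by norm_num)
    have e3 := hF 4 (by norm_num) (by norm_num)
    simp only [Store.setVar_var] at e1 e2 e3
    norm_num only [if_true, if_false] at e1 e2 e3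
    simp only [AExp.value, ha', Store.setVar_arr, ha₂, h10, e1, e2, e3, h18, h19, h4₂]
    rw [← hB _ (by nlinarith), ← hB _ (by nlinarith)]
    norm_cast

theorem copyLoop_ok (hX : M.size + 2 ≤ X) {n : ℕ} (hn : s.var 6 = n) (hnX : n ≤ X) (hnM : n ≤ M)
    (hs : s.Bounded M) : Ok M X copyLoop s fun s' => ∀ j < n, s'.arr 2 j = s.arr 3 j := by
  refine (Ok.fillLoop hX (s.arr 3) hn hnX hnM (by simp [Prog.vars]) (by simp [Prog.vars])
    (by norm_num) (by simp [Prog.arrs]) (fun q _ => hs.2 3 q) ?_).mono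
      fun s' _ h j hj => by rw [h j, if_pos hj]
  intro q s' hq hF h9
  refine .skip hX ?_
  simp [AExp.value, h9, hF.2 3 (by simp [Prog.arrs, Prog.forLoop])]

/-- Variable 15 holds 2^j after j squarings, so the loop stops at the first power of two that
reaches L. The same loop raises the two scalars of the final comparison to the power 2^J. -/
theorem powerLoop_ok (hX : M.size + 2 ≤ X) {S L J : ℕ} (hS : s.var 4 = S)
    (hSS : s.var 6 = (S * S : ℕ)) (hSX : S * S ≤ X) (hSM : S * S ≤ M) (hL : s.var 7 = L)
    (hJ : ∀ j, j < J ↔ 2 ^ j < L) (hJX : J ≤ X) (h15 : s.var 15 = 1) (B : ℕ → ℤ)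
    (hB : ∀ q < S * S, s.arr 2 q = B q) {R T : ℤ} (hR : s.var 16 = R) (hT : s.var 17 = T)
    (hRM : ∀ j ≤ J, |R ^ 2 ^ j| ≤ M) (hTM : ∀ j ≤ J, |T ^ 2 ^ j| ≤ M) (hJM : 2 ^ J ≤ M)
    (hb : ∀ j < J, ∀ q < S * S, ∑ t ∈ Finset.range S,
      |(sqFlat S)^[j] B (q / S * S + t) * (sqFlat S)^[j] B (t * S + q % S)| ≤ M) :
    Ok M X powerLoop s fun s' => s'.var 16 = R ^ 2 ^ J ∧ s'.var 17 = T ^ 2 ^ J ∧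
      ∀ q < S * S, s'.arr 2 q = (sqFlat S)^[J] B q := by
  refine (Ok.whilePos hX hJX (fun j s' => s'.var 15 = 2 ^ j ∧ s'.var 16 = R ^ 2 ^ j ∧
    s'.var 17 = T ^ 2 ^ j ∧ ∀ q < S * S, s'.arr 2 q = (sqFlat S)^[j] B q) ?_ ?_ ?_).mono
      fun s' _ h => h.2
  · simpa [h15, hR, hT] using hB
  · rintro j s' - hF ⟨h, -⟩
    have h7 : s'.var 7 = L :=
      (hF.1 7 (by simp [Prog.vars, sqLoop, copyLoop, rowCol, Prog.forLoop])).trans hL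
    simp only [AExp.value, h7, h, hJ j, sub_pos]
    norm_cast
  · rintro j s₁ hj hF ⟨i15, i16, i17, iB⟩
    have i4 : s₁.var 4 = S :=
      (hF.1 4 (by simp [Prog.vars, sqLoop, copyLoop, rowCol, Prog.forLoop])).trans hS
    have i6 : s₁.var 6 = (S * S : ℕ) :=
      (hF.1 6 (by simp [Prog.vars, sqLoop, copyLoop, rowCol, Prog.forLoop])).trans hSS
    clear hF
    refine .seq hX ((sqLoop_ok hX i4 i6 hSX hSM _ iB (hb j hj)).mono ?_)
    intro s₂ hF₂ hC
    have k6 : s₂.var 6 = (S * S : ℕ) :=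
      (hF₂.1 6 (by simp [Prog.vars, sqLoop, rowCol, Prog.forLoop])).trans i6
    refine .seq hX (.of_bounded fun hbd => (copyLoop_ok hX k6 hSX hSM hbd).mono ?_)
    intro s₃ hF₃ hB'
    have hv : ∀ v ∈ [15, 16, 17], s₃.var v = s₁.var v := fun v hv => by
      rw [hF₃.1 v, hF₂.1 v]
      · simp [Prog.vars, sqLoop, rowCol, Prog.forLoop] at hv ⊢; omega
      · simp [Prog.vars, copyLoop, Prog.forLoop] at hv ⊢; omega
    have l15 := (hv 15 (by simp)).trans i15
    have l16 := (hv 16 (by simp)).trans i16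
    have l17 := (hv 17 (by simp)).trans i17
    have hsq : ∀ x : ℤ, x ^ 2 ^ j * x ^ 2 ^ j = x ^ 2 ^ (j + 1) := fun x => by
      rw [← pow_add, pow_succ 2 j, mul_two]
    have hd : (2 : ℤ) ^ j + 2 ^ j = 2 ^ (j + 1) := by rw [pow_succ, mul_two]
    refine .seq hX (.assign hX ?_ ?_)
    · simp only [AExp.value, l16, hsq]
      exact hRM _ hj
    refine .seq hX (.assign hX ?_ ?_)
    · simp [AExp.value, Store.setVar_var, l17, hsq]
      simpa using hTM _ hj
    refine .assign hX ?_ ?_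
    · simp only [AExp.value, Store.setVar_var]
      norm_num only [l15, hd, if_false]
      rw [abs_of_nonneg (by positivity)]
      exact_mod_cast (Nat.pow_le_pow_right (by norm_num) hj).trans hJM
    · refine ⟨?_, ?_, ?_, fun q hq => ?_⟩
      · simp [AExp.value, Store.setVar_var, l15, hd]
      · simp [AExp.value, Store.setVar_var, l16, hsq]
      · simp [AExp.value, Store.setVar_var, l17, hsq]
      · rw [Store.setVar_arr, Store.setVar_arr, Store.setVar_arr, hB' q hq, hC q hq,
          Function.iterate_succ_apply']

end loops

/-- Adds the bit length of `var 8` to `var 7`. -/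
def sizeLoop : Prog :=
  .whilePos (.var 8) (.seq (.assign 8 (.div (.var 8) (.lit 2)))
    (.assign 7 (.add (.var 7) (.lit 1))))

/-- Reads `n`, and computes the dimensions and the bit length of `n`. -/
def dimensions (c m : ℕ) : Prog :=
  .seq (.assign 1 (.get 0 (.lit 0)))
  (.seq (.assign 2 (.pow (.var 1) c))
  (.seq (.assign 3 (.pow (.var 1) m))
  (.seq (.assign 4 (.mul (.var 3) (.var 3)))
  (.seq (.assign 5 (.mul (.var 2) (.var 4)))
  (.seq (.assign 6 (.mul (.var 4) (.var 4)))
  (.seq (.assign 7 (.lit 2))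
  (.seq (.assign 8 (.var 1))
    sizeLoop)))))))

/-- Computes the coefficients and the bound from the input. -/
def loadInput (zE cE tE : AExp) : Prog :=
  .seq (.forLoop 9 5 (.seq .skip (.write 1 (.var 9) zE)))
  (.seq (.forLoop 9 5 (.assign 12 (.add (.var 12) cE)))
    (.assign 13 tE))

/-- The final comparison. -/
def verdict : Prog :=
  .ifPos (.add (.var 13) (.lit 1))
    (.ifPos (.sub (.add (.mul (.var 13) (.var 13)) (.lit 1))
      (.mul (.mul (.lit 2) (.var 2)) (.var 14)))
      (.ifPos (.sub (.add (.var 17) (.lit 1)) (.mul (.var 16) (.var 22)))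
        (.assign 0 (.lit 1)) .skip) .skip) .skip

/-- Checks the certificate. -/
def checkCertificate : Prog :=
  .seq (.forLoop 9 5 (.assign 14 (.add (.var 14) (.mul (.get 1 (.var 9)) (.get 1 (.var 9))))))
  (.seq pairLoop
  (.seq (.assign 15 (.lit 1))
  (.seq (.assign 16 (.mul (.mul (.lit 2) (.var 2)) (.var 4)))
  (.seq (.assign 17 (.mul (.var 13) (.var 13)))
  (.seq powerLoop
  (.seq (.forLoop 10 4 (.assign 22 (.add (.var 22)
    (.get 2 (.add (.mul (.var 10) (.var 4)) (.var 10))))))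
    verdict))))))

/-! ### Correctness of the checking program and the size of its numbers -/

section

variable {M X : ℕ} {s : Store}

theorem sizeLoop_ok (hX : M.size + 2 ≤ X) {n : ℕ} (h8 : s.var 8 = n) (h7 : s.var 7 = 2)
    (hnM : n ≤ M) (hnX : n.size ≤ X) (hLM : 2 + n.size ≤ M) :
    Ok M X sizeLoop s fun s' => s'.var 7 = (n.size + 2 : ℕ) := by
  refine (Ok.whilePos hX hnX (fun q s' => s'.var 8 = (n / 2 ^ q : ℕ) ∧ s'.var 7 = (q + 2 : ℕ))
    ⟨by simp [h8], by simp [h7]⟩ ?_ ?_).mono fun s' _ h => h.2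
  · rintro q s' hq - ⟨h, -⟩
    rw [AExp.value, h, Nat.lt_size]
    norm_cast
    exact Nat.div_pos_iff.trans (by simp)
  · rintro q s' hq - ⟨h, h'⟩
    have hd : ((n / 2 ^ q : ℕ) : ℤ) / 2 = ((n / 2 ^ (q + 1) : ℕ) : ℤ) := by
      rw [pow_succ, ← Nat.div_div_eq_div_mul]; norm_cast
    have hle : n / 2 ^ (q + 1) ≤ M := (Nat.div_le_self _ _).trans hnM
    refine .seq hX (.assign hX ?_ (.assign hX ?_ ?_))
    · simp only [AExp.value, h, hd]
      rw [abs_of_nonneg (Int.natCast_nonneg _)]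
      exact_mod_cast hle
    · simp only [AExp.value, Store.setVar_var]
      norm_num only [h', if_false]
      norm_cast
      omega
    · simp only [AExp.value, Store.setVar_var, h, h', hd]
      norm_num only [h', if_true, if_false]
      simp
      ring

theorem dimensions_ok (hX : M.size + 2 ≤ X) {c m n : ℕ} (hn : s.arr 0 0 = n) (hnM : n ≤ M)
    (hcM : n ^ c ≤ M) (hmM : n ^ m ≤ M) (hSM : n ^ m * n ^ m ≤ M)
    (hnk : n ^ c * (n ^ m * n ^ m) ≤ M) (hSS : n ^ m * n ^ m * (n ^ m * n ^ m) ≤ M)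
    (hnX : n.size ≤ X) (hLM : 2 + n.size ≤ M) :
    Ok M X (dimensions c m) s fun s' => s'.var 2 = (n ^ c : ℕ) ∧ s'.var 3 = (n ^ m : ℕ) ∧
      s'.var 4 = (n ^ m * n ^ m : ℕ) ∧ s'.var 5 = (n ^ c * (n ^ m * n ^ m) : ℕ) ∧
      s'.var 6 = (n ^ m * n ^ m * (n ^ m * n ^ m) : ℕ) ∧ s'.var 7 = (n.size + 2 : ℕ) := by
  refine .seq hX (.assign hX ?_ (.seq hX (.assign hX ?_ (.seq hX (.assign hX ?_ (.seq hX
    (.assign hX ?_ (.seq hX (.assign hX ?_ (.seq hX (.assign hX ?_ (.seq hX (.assign hX ?_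
    (.seq hX (.assign hX ?_ ((sizeLoop_ok hX (n := n) ?_ ?_ hnM hnX hLM).mono ?_))))))))))))))))
  iterate 10 (simp [AExp.value, Store.setVar_var, hn]; try (norm_cast; try omega))
  rintro s' hF h7
  have hv : ∀ v, v ≠ 7 → v ≠ 8 → v ∉ sizeLoop.vars := by simp +contextual [sizeLoop, Prog.vars]
  refine ⟨?_, ?_, ?_, ?_, ?_, h7⟩ <;> rw [hF.1 _ (hv _ (by norm_num) (by norm_num))] <;>
    simp [AExp.value, Store.setVar_var, hn]

theorem loadInput_ok (hX : M.size + 2 ≤ X) {n : ℕ} {zE cE tE : AExp} (h5 : s.var 5 = n)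
    (h12 : s.var 12 = 0) (hnX : n ≤ X) (hnM : n ≤ M) (h1 : ∀ j, s.arr 1 j = 0)
    {Z C : ℕ → ℤ} {θ : ℤ} (hZ : ∀ q, |Z q| ≤ M) (hC : ∑ q ∈ Finset.range n, |C q| ≤ M)
    (hθ : |θ| ≤ M)
    (hz : ∀ q s', q < n → s'.var 9 = (q : ℤ) → s'.var 5 = (n : ℤ) → s'.arr 0 = s.arr 0 →
      zE.value s' = Z q ∧ cE.value s' = C q)
    (ht : ∀ s' : Store, s'.var 5 = n → s'.var 7 = s.var 7 → s'.arr 0 = s.arr 0 →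
      s'.var 12 = ∑ q ∈ Finset.range n, C q → tE.value s' = θ) :
    Ok M X (loadInput zE cE tE) s fun s' =>
      (∀ j, s'.arr 1 j = if j < n then Z j else 0) ∧ s'.var 13 = θ := by
  refine .seq hX ((Ok.fillLoop hX Z h5 hnX hnM (by simp [Prog.vars]) (by simp [Prog.vars])
    (by norm_num) (by simp [Prog.arrs]) (fun q _ => hZ q) ?_).mono ?_)
  · intro q s' hq hF h9
    refine .skip hX (hz q s' hq h9 ?_ (hF.2 0 (by simp [Prog.arrs, Prog.forLoop]))).1
    exact (hF.1 5 (by simp [Prog.vars, Prog.forLoop])).trans h5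
  intro s₁ hF₁ hs₁
  have k5 : s₁.var 5 = n := (hF₁.1 5 (by simp [Prog.vars, Prog.forLoop])).trans h5
  have k7 : s₁.var 7 = s.var 7 := hF₁.1 7 (by simp [Prog.vars, Prog.forLoop])
  have k12 : s₁.var 12 = 0 := (hF₁.1 12 (by simp [Prog.vars, Prog.forLoop])).trans h12
  have k0 : s₁.arr 0 = s.arr 0 := hF₁.2 0 (by simp [Prog.arrs, Prog.forLoop])
  refine .seq hX ((Ok.sumLoop hX C k5 hnX hnM (by norm_num) (by norm_num) (by norm_num) k12 hC
    ?_).mono ?_)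
  · intro q s' hq hv ha h9
    exact (hz q s' hq h9 ((hv 5 (by norm_num) (by norm_num)).trans k5)
      ((congrFun ha 0).trans k0)).2
  intro s₂ hF₂ l12
  have l5 : s₂.var 5 = n := (hF₂.1 5 (by simp [Prog.vars, Prog.forLoop])).trans k5
  have l7 : s₂.var 7 = s.var 7 := (hF₂.1 7 (by simp [Prog.vars, Prog.forLoop])).trans k7
  have l0 : s₂.arr 0 = s.arr 0 := (hF₂.2 0 (by simp [Prog.arrs, Prog.forLoop])).trans k0
  have l1 : s₂.arr 1 = s₁.arr 1 := hF₂.2 1 (by simp [Prog.arrs, Prog.forLoop])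
  have hte := ht s₂ l5 l7 l0 l12
  refine .assign hX (by rwa [hte]) ⟨fun j => ?_, by simp [hte]⟩
  rw [Store.setVar_arr, l1, hs₁ j, h1 j]

/-- The spare factor g² makes the bound reproduce itself under squaring: a product of two entries
brings g⁴, of which one g² absorbs the S summands and the other remains in reserve. -/
theorem sum_abs_mul_le_pow {S g a : ℕ} (hg : 1 ≤ g) (hS : S ≤ g ^ 2) {B : ℕ → ℤ}
    (hB : ∀ q, |B q| * (g : ℤ) ^ 2 ≤ (g : ℤ) ^ a) (q : ℕ) :
    (∑ t ∈ Finset.range S, |B (q / S * S + t) * B (t * S + q % S)|) * (g : ℤ) ^ 2 ≤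
      (g : ℤ) ^ (a + a) := by
  have hS' : (S : ℤ) ≤ (g : ℤ) ^ 2 := by exact_mod_cast hS
  have hterm : ∀ t ∈ Finset.range S,
      (g : ℤ) ^ 2 * (|B (q / S * S + t) * B (t * S + q % S)| * (g : ℤ) ^ 2) ≤
      (g : ℤ) ^ (a + a) := fun t _ => by
    calc (g : ℤ) ^ 2 * (|B (q / S * S + t) * B (t * S + q % S)| * (g : ℤ) ^ 2)
        = (|B (q / S * S + t)| * (g : ℤ) ^ 2) * (|B (t * S + q % S)| * (g : ℤ) ^ 2) := by
          rw [abs_mul]; ring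
      _ ≤ (g : ℤ) ^ a * (g : ℤ) ^ a :=
          mul_le_mul (hB _) (hB _) (by positivity) (by positivity)
      _ = _ := by rw [← pow_add]
  have hsum := Finset.sum_le_card_nsmul _ _ _ hterm
  rw [← Finset.mul_sum, Finset.card_range, nsmul_eq_mul, ← Finset.sum_mul] at hsum
  refine le_of_mul_le_mul_left (hsum.trans ?_) (show (0 : ℤ) < (g : ℤ) ^ 2 by positivity)
  gcongr

/-- The exponent 5 is 3 + 2: entries of the matrix of pairs are at most r g² ≤ g³, and g² is the
reserve. -/
theorem abs_sqFlat_iterate_le {S g : ℕ} (hg : 1 ≤ g) (hS : S ≤ g ^ 2) {B : ℕ → ℤ}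
    (hB : ∀ q, |B q| * (g : ℤ) ^ 2 ≤ (g : ℤ) ^ 5) (j q : ℕ) :
    |(sqFlat S)^[j] B q| * (g : ℤ) ^ 2 ≤ (g : ℤ) ^ (5 * 2 ^ j) := by
  induction j generalizing q with
  | zero => simpa using hB q
  | succ j ih =>
    rw [Function.iterate_succ_apply', show 5 * 2 ^ (j + 1) = 5 * 2 ^ j + 5 * 2 ^ j by ring]
    refine le_trans ?_ (sum_abs_mul_le_pow hg hS ih q)
    gcongr
    exact Finset.abs_sum_le_sum_abs _ _

theorem abs_pairFlat_mul_le {r N g : ℕ} (hr : r ≤ g) {z : ℕ → ℤ} (hz : ∀ q, |z q| ≤ g) (q : ℕ) :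
    ∑ i ∈ Finset.range r, |z (i + r * (q / (N * N) % N + N * (q % (N * N) / N))) *
        z (i + r * (q % (N * N) % N + N * (q / (N * N) / N)))| ≤ (g : ℤ) ^ 3 ∧
      |pairFlat r N z q| ≤ (g : ℤ) ^ 3 := by
  have h1 : ∑ i ∈ Finset.range r, |z (i + r * (q / (N * N) % N + N * (q % (N * N) / N))) *
        z (i + r * (q % (N * N) % N + N * (q / (N * N) / N)))| ≤ (g : ℤ) ^ 3 := by
    refine (Finset.sum_le_card_nsmul _ _ ((g : ℤ) * g) fun i _ => ?_).trans ?_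
    · rw [abs_mul]
      exact mul_le_mul (hz _) (hz _) (abs_nonneg _) (by positivity)
    · rw [Finset.card_range, nsmul_eq_mul, pow_succ', pow_two]
      gcongr
  refine ⟨h1, ?_⟩
  unfold pairFlat
  split
  · simp
  · exact (Finset.abs_sum_le_sum_abs _ _).trans h1

open Classical in
theorem verdict_ok (hX : M.size + 2 ≤ X) {θ r D R T W : ℤ} (hM : 1 ≤ M) (h0 : s.var 0 = 0)
    (h2 : s.var 2 = r) (h13 : s.var 13 = θ) (h14 : s.var 14 = D) (h16 : s.var 16 = R)
    (h17 : s.var 17 = T) (h22 : s.var 22 = W) {C : Prop}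
    (hC : C ↔ 0 ≤ θ ∧ 2 * r * D ≤ θ * θ ∧ R * W ≤ T) :
    Ok M X verdict s fun s' => s'.var 0 = if C then 1 else 0 := by
  -- Over the integers a strict test on e + 1 - f decides the weak inequality f ≤ e.
  have hv : ∀ e f : ℤ, 0 < e + 1 - f ↔ f ≤ e := fun e f => by omega
  refine .ifPos hX (fun c1 => .ifPos hX (fun c2 => .ifPos hX (fun c3 => .assign hX ?_ ?_)
    fun c3 => .skip hX ?_) fun c2 => .skip hX ?_) fun c1 => .skip hX ?_
  · simpa [AExp.value] using hM
  all_goals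
    simp only [AExp.value, h2, h13, h14, h16, h17, h22, hv, Int.lt_add_one_iff] at *
    rw [hC]
  · rw [if_pos ⟨c1, c2, c3⟩, Store.setVar_var_self]
  · rw [if_neg fun h => c3 h.2.2, h0]
  · rw [if_neg fun h => c2 h.2.1, h0]
  · rw [if_neg fun h => c1 h.1, h0]

set_option maxHeartbeats 800000 in
open Classical in
-- Here g bounds r, N, the coefficients and θ, and its power 5 · 2^`levels n` bounds every number
-- that arises, including the powers of 2rN² and θ², whose bases are below g⁵.
theorem checkCertificate_ok (hX : M.size + 2 ≤ X) {n r N g : ℕ} {θ : ℤ} (h0 : s.var 0 = 0)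
    (h2 : s.var 2 = r) (h3 : s.var 3 = N) (h4 : s.var 4 = (N * N : ℕ))
    (h5 : s.var 5 = (r * (N * N) : ℕ)) (h6 : s.var 6 = (N * N * (N * N) : ℕ))
    (h7 : s.var 7 = (n.size + 2 : ℕ)) (h13 : s.var 13 = θ) (h14 : s.var 14 = 0)
    (h22 : s.var 22 = 0) (hg : 2 ≤ g) (hr : r ≤ g) (hN : N ≤ g) (hz : ∀ q, |s.arr 1 q| ≤ g)
    (hθ : |θ| ≤ g) (hM : g ^ (5 * 2 ^ levels n) ≤ M) (hrX : r ≤ X) (hnkX : r * (N * N) ≤ X)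
    (hSX : N * N * (N * N) ≤ X) (hJX : levels n ≤ X) :
    Ok M X checkCertificate s fun s' =>
      s'.var 0 = if Certified n r N (s.arr 1) θ then 1 else 0 := by
  have hg1 : 1 ≤ g := by omega
  have hg0 : (1 : ℤ) ≤ g := by exact_mod_cast hg1
  have hrg : (r : ℤ) ≤ g := by exact_mod_cast hr
  have hNg : (N : ℤ) ≤ g := by exact_mod_cast hN
  have hgM : ∀ j ≤ levels n, (g : ℤ) ^ (5 * 2 ^ j) ≤ M := fun j hj => by
    have h : g ^ (5 * 2 ^ j) ≤ M := (Nat.pow_le_pow_right hg1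
      (Nat.mul_le_mul_left _ (Nat.pow_le_pow_right (by norm_num) hj))).trans hM
    exact_mod_cast h
  have hg5 : g ^ 5 ≤ M := le_trans (Nat.pow_le_pow_right hg1
    (by nlinarith [Nat.one_le_two_pow (n := levels n)])) hM
  have hgle : ∀ i ≤ 5, g ^ i ≤ M := fun i hi => (Nat.pow_le_pow_right hg1 hi).trans hg5
  have hSg : N * N ≤ g ^ 2 := by rw [pow_two]; exact Nat.mul_le_mul hN hN
  have hnkg : r * (N * N) ≤ g ^ 3 := by
    rw [show g ^ 3 = g * g ^ 2 by ring]; exact Nat.mul_le_mul hr hSg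
  have hSSg : N * N * (N * N) ≤ g ^ 4 := by
    rw [show g ^ 4 = g ^ 2 * g ^ 2 by ring]; exact Nat.mul_le_mul hSg hSg
  have hrM : r ≤ M := (hr.trans (by simp)).trans (hgle 1 (by norm_num))
  have hnkM := hnkg.trans (hgle 3 (by norm_num))
  have hSSM := hSSg.trans (hgle 4 (by norm_num))
  have hSM : N * N ≤ M := hSg.trans (hgle 2 (by norm_num))
  have hSX' : N * N ≤ X := (Nat.le_mul_self _).trans hSX
  have hJM : 2 ^ levels n ≤ M := by
    refine le_trans ?_ hM
    calc 2 ^ levels n ≤ 2 ^ (5 * 2 ^ levels n) :=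
          Nat.pow_le_pow_right (by norm_num) (by have := Nat.lt_two_pow_self (n := levels n); omega)
      _ ≤ _ := Nat.pow_le_pow_left hg _
  have hA := fun q => abs_pairFlat_mul_le (N := N) hr hz q
  have hB : ∀ q, |pairFlat r N (s.arr 1) q| * (g : ℤ) ^ 2 ≤ (g : ℤ) ^ 5 := fun q => by
    calc _ ≤ (g : ℤ) ^ 3 * (g : ℤ) ^ 2 := by gcongr; exact (hA q).2
      _ = _ := by ring
  have hg2 : (1 : ℤ) ≤ (g : ℤ) ^ 2 := one_le_pow₀ hg0
  -- the sum of squares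
  have hcoreD : Ok M X (.forLoop 9 5 (.assign 14
      (.add (.var 14) (.mul (.get 1 (.var 9)) (.get 1 (.var 9)))))) s fun s' =>
      s'.var 14 = ∑ q ∈ Finset.range (r * (N * N)), s.arr 1 q * s.arr 1 q := by
    refine Ok.sumLoop hX (fun q => s.arr 1 q * s.arr 1 q) h5 hnkX hnkM (by norm_num) (by norm_num)
      (by norm_num) h14 ?_ ?_
    · refine (Finset.sum_le_card_nsmul _ _ ((g : ℤ) * g) fun q _ => ?_).trans ?_
      · rw [abs_mul]
        exact mul_le_mul (hz _) (hz _) (abs_nonneg _) (by positivity)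
      · rw [Finset.card_range, nsmul_eq_mul]
        norm_cast
        calc r * (N * N) * (g * g) ≤ g ^ 3 * (g * g) := Nat.mul_le_mul_right _ hnkg
          _ = g ^ 5 := by ring
          _ ≤ M := hg5
    · intro q s' _ _ ha h9
      simp [AExp.value, ha, h9]
  refine .seq hX (hcoreD.mono ?_)
  intro s₁ hF₁ d14
  have hv₁ : ∀ v, v ≠ 9 → v ≠ 14 → s₁.var v = s.var v := fun v h h' =>
    hF₁.1 v (by simp [Prog.vars, Prog.forLoop, h, h'])
  have ha₁ : s₁.arr 1 = s.arr 1 := hF₁.2 1 (by simp [Prog.arrs, Prog.forLoop])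
  clear hF₁ hcoreD
  refine .seq hX ((pairLoop_ok hX (r := r) (N := N) ((hv₁ 2 (by norm_num) (by norm_num)).trans h2)
    ((hv₁ 3 (by norm_num) (by norm_num)).trans h3) ((hv₁ 4 (by norm_num) (by norm_num)).trans h4)
    ((hv₁ 6 (by norm_num) (by norm_num)).trans h6) hrX hrM hSX hSSM ?_).mono ?_)
  · intro q
    rw [ha₁]
    exact (hA q).1.trans (by exact_mod_cast hgle 3 (by norm_num))
  intro s₂ hF₂ hs₂
  rw [ha₁] at hs₂
  have hv₂ : ∀ v, v ∉ [9, 18, 19, 20, 21, 11, 10, 14] → s₂.var v = s.var v := fun v hv => by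
    rw [hF₂.1 v, hv₁ v]
    · simp at hv; tauto
    · simp at hv; tauto
    · simp [Prog.vars, pairLoop, rowCol, Prog.forLoop] at hv ⊢; tauto
  have e14 : s₂.var 14 = ∑ q ∈ Finset.range (r * (N * N)), s.arr 1 q * s.arr 1 q := by
    rw [hF₂.1 14 (by simp [Prog.vars, pairLoop, rowCol, Prog.forLoop]), d14]
  clear hF₂
  have k2 := (hv₂ 2 (by simp)).trans h2
  have k4 := (hv₂ 4 (by simp)).trans h4
  have k6 := (hv₂ 6 (by simp)).trans h6
  have k7 := (hv₂ 7 (by simp)).trans h7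
  have k13 := (hv₂ 13 (by simp)).trans h13
  have k22 := (hv₂ 22 (by simp)).trans h22
  have k0 := (hv₂ 0 (by simp)).trans h0
  clear hv₂
  have hR : |(2 * r * (N * N : ℕ) : ℤ)| ≤ (g : ℤ) ^ 5 := by
    rw [abs_of_nonneg (by positivity)]
    norm_cast
    calc 2 * r * (N * N) ≤ g * g * g ^ 2 := Nat.mul_le_mul (Nat.mul_le_mul hg hr) hSg
      _ = g ^ 4 := by ring
      _ ≤ g ^ 5 := Nat.pow_le_pow_right hg1 (by norm_num)
  have hT : |θ * θ| ≤ (g : ℤ) ^ 5 := by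
    rw [abs_mul]
    calc |θ| * |θ| ≤ (g : ℤ) * g := mul_le_mul hθ hθ (abs_nonneg _) (by positivity)
      _ = (g : ℤ) ^ 2 := by ring
      _ ≤ (g : ℤ) ^ 5 := pow_le_pow_right₀ hg0 (by norm_num)
  have hpowM : ∀ x : ℤ, |x| ≤ (g : ℤ) ^ 5 → ∀ j ≤ levels n, |x ^ 2 ^ j| ≤ M := fun x hx j hj => by
    rw [abs_pow]
    refine le_trans (pow_le_pow_left₀ (abs_nonneg _) hx _) ?_
    rw [← pow_mul]
    exact hgM j hj
  have hg5M : (g : ℤ) ^ 5 ≤ M := by exact_mod_cast hg5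
  refine .seq hX (.assign hX ?_ (.seq hX (.assign hX ?_ (.seq hX (.assign hX ?_
    (.seq hX ((powerLoop_ok hX (S := N * N) (L := n.size + 2) (J := levels n) ?_ ?_ hSX hSSM ?_
      (fun j => Nat.lt_clog_iff_pow_lt (by norm_num)) hJX ?_ (pairFlat r N (s.arr 1)) ?_
      (R := 2 * r * (N * N : ℕ)) (T := θ * θ) ?_ ?_ (hpowM _ hR) (hpowM _ hT) hJM ?_).mono ?_)))))))
  · simp only [AExp.value, abs_one]
    exact hg0.trans ((le_self_pow₀ hg0 (by norm_num)).trans hg5M)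
  · simp only [AExp.value, Store.setVar_var]
    norm_num only [k2, k4, if_false]
    exact hR.trans hg5M
  · simp only [AExp.value, Store.setVar_var]
    norm_num only [k13, if_false]
    exact hT.trans hg5M
  · simpa [Store.setVar_var] using k4
  · simpa [Store.setVar_var] using k6
  · simpa [Store.setVar_var] using k7
  · simp [Store.setVar_var, AExp.value]
  · simpa using hs₂
  · simp [Store.setVar_var, AExp.value, k2, k4]
  · simp [Store.setVar_var, AExp.value, k13]
  · intro j hj q _
    have h := sum_abs_mul_le_pow hg1 hSg (abs_sqFlat_iterate_le hg1 hSg hB j) q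
    rw [show 5 * 2 ^ j + 5 * 2 ^ j = 5 * 2 ^ (j + 1) by ring] at h
    exact (le_mul_of_one_le_right (Finset.sum_nonneg fun _ _ => abs_nonneg _) hg2).trans
      (h.trans (hgM _ hj))
  rintro s₃ hF₃ ⟨l16, l17, hs₃⟩
  have hv₃ : ∀ v, v ∉ [9, 18, 19, 20, 21, 11, 10, 14, 15, 16, 17] → s₃.var v = s₂.var v := by
    intro v hv
    rw [hF₃.1 v]
    · simp at hv; simp [Store.setVar_var, hv]
    · simp [Prog.vars, powerLoop, sqLoop, copyLoop, rowCol, Prog.forLoop] at hv ⊢; tauto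
  have l14 : s₃.var 14 = ∑ q ∈ Finset.range (r * (N * N)), s.arr 1 q * s.arr 1 q := by
    rw [hF₃.1 14 (by simp [Prog.vars, powerLoop, sqLoop, copyLoop, rowCol, Prog.forLoop])]
    simpa [Store.setVar_var] using e14
  clear hF₃ hs₂ e14
  replace k2 := (hv₃ 2 (by simp)).trans k2
  replace k4 := (hv₃ 4 (by simp)).trans k4
  replace k13 := (hv₃ 13 (by simp)).trans k13
  replace k22 := (hv₃ 22 (by simp)).trans k22
  replace k0 := (hv₃ 0 (by simp)).trans k0
  clear hv₃
  refine .seq hX ((Ok.sumLoop hX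
    (fun t => (sqFlat (N * N))^[levels n] (pairFlat r N (s.arr 1)) (t * (N * N) + t)) k4 hSX' hSM
    (by norm_num) (by norm_num) (by norm_num) k22 ?_ ?_).mono ?_)
  · refine le_trans ?_ (hgM _ le_rfl)
    -- The reserve g² in the entry bound pays for the N² ≤ g² summands of the trace.
    have hb := abs_sqFlat_iterate_le hg1 hSg hB (levels n)
    have hsum := Finset.sum_le_card_nsmul (Finset.range (N * N)) (fun t =>
      |(sqFlat (N * N))^[levels n] (pairFlat r N (s.arr 1)) (t * (N * N) + t)| * (g : ℤ) ^ 2) _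
      fun t _ => hb _
    rw [← Finset.sum_mul, Finset.card_range, nsmul_eq_mul] at hsum
    refine le_of_mul_le_mul_left (le_trans (le_of_eq (mul_comm _ _)) (hsum.trans ?_))
      (show (0 : ℤ) < (g : ℤ) ^ 2 by positivity)
    gcongr
    exact_mod_cast hSg
  · intro t s' ht hv ha h10
    have hS1 : t * (N * N) + t < N * N * (N * N) := by nlinarith
    simp only [AExp.value, ha, h10, hv 4 (by norm_num) (by norm_num), k4]
    rw [← hs₃ _ hS1]
    norm_cast
  intro s₄ hF₄ m22
  have hv₄ : ∀ v, v ≠ 10 → v ≠ 22 → s₄.var v = s₃.var v := fun v h h' =>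
    hF₄.1 v (by simp [Prog.vars, Prog.forLoop, h, h'])
  have m0 := (hv₄ 0 (by norm_num) (by norm_num)).trans k0
  have m2 := (hv₄ 2 (by norm_num) (by norm_num)).trans k2
  have m13 := (hv₄ 13 (by norm_num) (by norm_num)).trans k13
  have m14 := (hv₄ 14 (by norm_num) (by norm_num)).trans l14
  have m16 := (hv₄ 16 (by norm_num) (by norm_num)).trans l16
  have m17 := (hv₄ 17 (by norm_num) (by norm_num)).trans l17
  clear hF₄ hv₄
  have hC : Certified n r N (s.arr 1) θ ↔ 0 ≤ θ ∧
      2 * r * ∑ q ∈ Finset.range (r * (N * N)), s.arr 1 q * s.arr 1 q ≤ θ * θ ∧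
      (2 * r * (N * N : ℕ) : ℤ) ^ 2 ^ levels n * ∑ t ∈ Finset.range (N * N),
        (sqFlat (N * N))^[levels n] (pairFlat r N (s.arr 1)) (t * (N * N) + t) ≤
      (θ * θ) ^ 2 ^ levels n := by
    unfold Certified; push_cast; rfl
  exact verdict_ok hX ((Nat.one_le_pow _ _ (by omega)).trans hM) m0 m2 m13 m14 m16 m17 m22 hC

end

/-! ### Polynomial running time of the certifier -/

theorem abs_lt_two_pow_inputSize {L : List ℤ} {z : ℤ} (hz : z ∈ L) : |z| ≤ 2 ^ inputSize L := by
  have h1 : bitLength z + 1 ≤ inputSize L :=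
    List.single_le_sum (by simp) _ (List.mem_map_of_mem (f := fun z => bitLength z + 1) hz)
  have h2 : z.natAbs < 2 ^ bitLength z := Nat.lt_size_self _
  have h3 : 2 ^ bitLength z ≤ 2 ^ inputSize L := Nat.pow_le_pow_right (by norm_num) (by omega)
  rw [Int.abs_eq_natAbs]
  exact_mod_cast (h2.trans_le h3).le

theorem abs_getD_le_two_pow_inputSize (L : List ℤ) (j : ℕ) : |L.getD j 0| ≤ 2 ^ inputSize L := by
  rw [List.getD_eq_getElem?_getD]
  rcases h : L[j]? with _ | z
  · simp
  · exact abs_lt_two_pow_inputSize (List.mem_of_getElem? h)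

theorem length_le_inputSize (L : List ℤ) : L.length ≤ inputSize L := by
  induction L with
  | nil => simp
  | cons z L ih =>
    simp only [inputSize, List.map_cons, List.sum_cons, List.length_cons] at ih ⊢
    omega

/-- Checks the certificate for the coefficients and the bound computed by the given expressions. -/
def certifier (c m : ℕ) (zE cE tE : AExp) : Prog :=
  .seq (dimensions c m) (.seq (loadInput zE cE tE) checkCertificate)

theorem certifier_vars (c m : ℕ) (zE cE tE : AExp) :
    (dimensions c m).vars = [1, 2, 3, 4, 5, 6, 7, 8, 8, 7] ∧ (dimensions c m).arrs = [] ∧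
    (loadInput zE cE tE).vars = [9, 9, 9, 12, 9, 13] ∧ (loadInput zE cE tE).arrs = [1] := by
  simp [dimensions, loadInput, sizeLoop, Prog.vars, Prog.arrs, Prog.forLoop]

/-- Rounding up to a power of two at most doubles. Thus the trace exponent stays logarithmic in n,
which is what keeps the powers short. -/
theorem two_pow_levels_le (n : ℕ) : 2 ^ levels n ≤ 2 * (n.size + 2) := by
  have h : 2 ^ (Nat.clog 2 (n.size + 2)).pred < n.size + 2 :=
    Nat.pow_pred_clog_lt_self (b := 2) (x := n.size + 2) (by norm_num) (by omega)
  have h0 : 0 < Nat.clog 2 (n.size + 2) := Nat.clog_pos (by norm_num) (by omega)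
  unfold levels
  rw [← Nat.succ_pred_eq_of_pos h0, pow_succ]
  omega

open Classical in
-- Variables: 1 is n; 2 to 6 are r, N, N², rN² = n^k, N⁴; 7 is `n.size + 2`; 9 and 10 are counters;
-- 11 is an accumulator; 12 is ∑ C; 13 is θ; 14 is ∑ z²; 15 is 2^j; 16 and 17 are the powers of 2rN²
-- and θ²; 18 and 19 are row and column; 20 and 21 are codes of pairs; 22 is the trace. Arrays: 0
-- input, 1 coefficients, 2 matrix, 3 its square. The sum of C serves k-XOR, where the bound θ
-- depends on the number of constraints.
theorem certifier_ok {M X c m n g : ℕ} {zE cE tE : AExp} {s : Store} {Z C : ℕ → ℤ} {θ : ℤ}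
    (hX : M.size + 2 ≤ X) (hv : ∀ i, s.var i = 0) (ha : ∀ j, s.arr 1 j = 0) (hn : s.arr 0 0 = n)
    (hg : 2 ≤ g) (hng : n + 2 ≤ g) (hc : n ^ c ≤ g) (hm : n ^ m ≤ g)
    (hM : g ^ (5 * 2 ^ levels n) ≤ M)
    (hrX : n ^ c ≤ X) (hnkX : n ^ c * (n ^ m * n ^ m) ≤ X)
    (hSX : n ^ m * n ^ m * (n ^ m * n ^ m) ≤ X) (hJX : levels n ≤ X) (hsX : n.size ≤ X)
    (hZ : ∀ q, |Z q| ≤ g) (hC : ∑ q ∈ Finset.range (n ^ c * (n ^ m * n ^ m)), |C q| ≤ g)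
    (hθ : |θ| ≤ g)
    (hz : ∀ q s', q < n ^ c * (n ^ m * n ^ m) → s'.var 9 = (q : ℤ) →
      s'.var 5 = ((n ^ c * (n ^ m * n ^ m) : ℕ) : ℤ) → s'.arr 0 = s.arr 0 →
      zE.value s' = Z q ∧ cE.value s' = C q)
    (ht : ∀ s' : Store, s'.var 5 = ((n ^ c * (n ^ m * n ^ m) : ℕ) : ℤ) →
      s'.var 7 = ((n.size + 2 : ℕ) : ℤ) →
      s'.arr 0 = s.arr 0 → s'.var 12 = ∑ q ∈ Finset.range (n ^ c * (n ^ m * n ^ m)), C q →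
      tE.value s' = θ) :
    Ok M X (certifier c m zE cE tE) s fun s' => s'.var 0 =
      if Certified n (n ^ c) (n ^ m) (fun q => if q < n ^ c * (n ^ m * n ^ m) then Z q else 0) θ
        then 1 else 0 := by
  have hg1 : 1 ≤ g := by omega
  have hg5 : g ^ 5 ≤ M := le_trans (Nat.pow_le_pow_right hg1
    (by nlinarith [Nat.one_le_two_pow (n := levels n)])) hM
  have hgle : ∀ i ≤ 5, g ^ i ≤ M := fun i hi => (Nat.pow_le_pow_right hg1 hi).trans hg5
  have hgM : g ≤ M := by simpa using hgle 1 (by norm_num)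
  have hgM' : (g : ℤ) ≤ M := by exact_mod_cast hgM
  have hSg : n ^ m * n ^ m ≤ g ^ 2 := by rw [pow_two g]; exact Nat.mul_le_mul hm hm
  have hnkg : n ^ c * (n ^ m * n ^ m) ≤ g ^ 3 := by
    rw [show g ^ 3 = g * g ^ 2 by ring]; exact Nat.mul_le_mul hc hSg
  have hSSg : n ^ m * n ^ m * (n ^ m * n ^ m) ≤ g ^ 4 := by
    rw [show g ^ 4 = g ^ 2 * g ^ 2 by ring]; exact Nat.mul_le_mul hSg hSg
  have hsz : n.size ≤ n := Nat.size_le.2 Nat.lt_two_pow_self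
  obtain ⟨v1, a1, v2, a2⟩ := certifier_vars c m zE cE tE
  refine .seq hX ((dimensions_ok hX hn (by omega) (hc.trans hgM) (hm.trans hgM)
    (hSg.trans (hgle 2 (by norm_num))) (hnkg.trans (hgle 3 (by norm_num)))
    (hSSg.trans (hgle 4 (by norm_num))) hsX (by omega)).mono ?_)
  rintro s₁ hF₁ ⟨k2, k3, k4, k5, k6, k7⟩
  have kv : ∀ v, v ∉ [1, 2, 3, 4, 5, 6, 7, 8, 8, 7] → s₁.var v = 0 := fun v h => by
    rw [hF₁.1 v (by rwa [v1]), hv]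
  have ka : s₁.arr = s.arr := funext fun A => hF₁.2 A (by simp [a1])
  clear hF₁
  refine .seq hX ((loadInput_ok hX k5 (kv 12 (by simp)) hnkX (hnkg.trans (hgle 3 (by norm_num)))
    (fun j => by rw [ka, ha]) (fun q => (hZ q).trans hgM') (hC.trans hgM') (hθ.trans hgM')
    (fun q s' hq h9 h5 h0 => hz q s' hq h9 h5 (by rw [h0, ka]))
    (fun s' h5 h7 h0 h12 => ht s' h5 (by rw [h7, k7]) (by rw [h0, ka]) h12)).mono ?_)
  rintro s₂ hF₂ ⟨l1, l13⟩
  have lv : ∀ v, v ∉ [9, 9, 9, 12, 9, 13] → s₂.var v = s₁.var v := fun v h =>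
    hF₂.1 v (by rwa [v2])
  have l1' : s₂.arr 1 = fun q => if q < n ^ c * (n ^ m * n ^ m) then Z q else 0 := funext l1
  rw [← l1']
  refine checkCertificate_ok hX ?_ ((lv 2 (by simp)).trans k2) ((lv 3 (by simp)).trans k3)
    ((lv 4 (by simp)).trans k4) ((lv 5 (by simp)).trans k5) ((lv 6 (by simp)).trans k6)
    ((lv 7 (by simp)).trans k7) l13 ?_ ?_ hg hc hm ?_ hθ hM hrX hnkX hSX hJX
  · rw [lv 0 (by simp), kv 0 (by simp)]
  · rw [lv 14 (by simp), kv 14 (by simp)]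
  · rw [lv 22 (by simp), kv 22 (by simp)]
  · intro q
    rw [l1]
    split
    · exact hZ q
    · simp

/-- `PolyTime` asks for one constant that is coefficient, exponent and additive term at once; for s
≥ 1 the shift is removed by s + 2 ≤ 3s. -/
theorem exists_poly_bound (W B d : ℕ) :
    ∃ c : ℕ, ∀ s : ℕ, W * (B * (s + 2) ^ 2) ^ d ≤ c * s ^ c + c := by
  refine ⟨W * B ^ d * 9 ^ d + 2 * d, fun s => ?_⟩
  have h : W * (B * (s + 2) ^ 2) ^ d = W * B ^ d * (s + 2) ^ (2 * d) := by
    rw [mul_pow, ← pow_mul, mul_assoc]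
  rw [h]
  rcases Nat.eq_zero_or_pos s with rfl | hs
  · have : (0 + 2) ^ (2 * d) ≤ 9 ^ d := by
      rw [pow_mul]; exact Nat.pow_le_pow_left (by norm_num) _
    have := Nat.mul_le_mul_left (W * B ^ d) this
    omega
  · have h1 : (s + 2) ^ (2 * d) ≤ 9 ^ d * s ^ (2 * d) := by
      calc (s + 2) ^ (2 * d) ≤ (3 * s) ^ (2 * d) := Nat.pow_le_pow_left (by omega) _
        _ = 9 ^ d * s ^ (2 * d) := by rw [mul_pow, pow_mul 3]; norm_num
    have h2 : s ^ (2 * d) ≤ s ^ (W * B ^ d * 9 ^ d + 2 * d) := Nat.pow_le_pow_right hs (by omega)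
    calc W * B ^ d * (s + 2) ^ (2 * d) ≤ W * B ^ d * (9 ^ d * s ^ (2 * d)) :=
          Nat.mul_le_mul_left _ h1
      _ = W * B ^ d * 9 ^ d * s ^ (2 * d) := by ring
      _ ≤ (W * B ^ d * 9 ^ d + 2 * d) * s ^ (W * B ^ d * 9 ^ d + 2 * d) :=
          Nat.mul_le_mul (by omega) h2
      _ ≤ _ := by omega

open Classical in
-- Let s be the input size. The numbers that enter the certificate have O(s) bits and are raised to
-- powers O(log n) = O(s), so all numbers have O(s²) bits. The loops have at most N⁴ ≤ s² rounds.
-- Hence X is quadratic in s.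
theorem polyTime_certified {α : Type} {enc : α → List ℤ} {c m κ : ℕ} (hc : c ≤ 1) (hm : 1 ≤ m)
    {zE cE tE : AExp} {n : α → ℕ} {Z C : α → ℕ → ℤ} {θ : α → ℤ}
    (hn : ∀ a, (enc a).getD 0 0 = n a)
    (hlen : ∀ a, n a ^ c * (n a ^ m * n a ^ m) ≤ inputSize (enc a))
    (hZ : ∀ a q, |Z a q| ≤ 2 ^ (κ * (inputSize (enc a) + 1)))
    (hC : ∀ a, ∑ q ∈ Finset.range (n a ^ c * (n a ^ m * n a ^ m)), |C a q| ≤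
      2 ^ (κ * (inputSize (enc a) + 1)))
    (hθ : ∀ a, |θ a| ≤ 2 ^ (κ * (inputSize (enc a) + 1)))
    (hz : ∀ a q (s' : Store), q < n a ^ c * (n a ^ m * n a ^ m) → s'.var 9 = (q : ℤ) →
      s'.var 5 = ((n a ^ c * (n a ^ m * n a ^ m) : ℕ) : ℤ) → (∀ j, s'.arr 0 j = (enc a).getD j 0) →
      zE.value s' = Z a q ∧ cE.value s' = C a q)
    (ht : ∀ a (s' : Store), s'.var 5 = ((n a ^ c * (n a ^ m * n a ^ m) : ℕ) : ℤ) →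
      s'.var 7 = (((n a).size + 2 : ℕ) : ℤ) → (∀ j, s'.arr 0 j = (enc a).getD j 0) →
      s'.var 12 = ∑ q ∈ Finset.range (n a ^ c * (n a ^ m * n a ^ m)), C a q →
      tE.value s' = θ a) :
    PolyTime enc fun a => decide (Certified (n a) (n a ^ c) (n a ^ m)
      (fun q => if q < n a ^ c * (n a ^ m * n a ^ m) then Z a q else 0) (θ a)) := by
  set P := certifier c m zE cE tE with hP
  obtain ⟨c', hc'⟩ := exists_poly_bound P.weight (20 * (κ + 2) + 10) P.depth
  refine ⟨P, c', fun a => ?_⟩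
  set s := inputSize (enc a) with hs
  set N := n a with hN
  set M := 2 ^ ((κ + 2) * (s + 1) * (5 * 2 ^ levels N)) with hMdef
  set X := (20 * (κ + 2) + 10) * (s + 2) ^ 2 with hXdef
  have hpow : ∀ i ≤ 1 + m, 1 ≤ i → N ^ i ≤ s ∨ N = 0 := fun i hi hi1 => by
    rcases Nat.eq_zero_or_pos N with h0 | h0
    · exact .inr h0
    · left
      refine le_trans ?_ (hlen a)
      rw [← pow_add, ← pow_add]
      exact Nat.pow_le_pow_right h0 (by omega)
  have hNs : N ≤ s := by
    rcases hpow 1 (by omega) le_rfl with h | h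
    · simpa using h
    · omega
  have hms : N ^ m ≤ s := by
    rcases hpow m (by omega) hm with h | h
    · exact h
    · simp [h, show m ≠ 0 by omega]
  have hSs : N ^ m * N ^ m ≤ s := by
    rcases Nat.eq_zero_or_pos N with h0 | h0
    · simp [h0, show m ≠ 0 by omega]
    · exact (Nat.le_mul_of_pos_left _ (Nat.pow_pos h0)).trans (hlen a)
  have hcs : N ^ c ≤ s + 1 := by
    interval_cases c
    · simp
    · simp; omega
  have hsz : N.size ≤ N := Nat.size_le.2 Nat.lt_two_pow_self
  have hJ := two_pow_levels_le N
  have hJlt := Nat.lt_two_pow_self (n := levels N)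
  have hsq : s + 2 ≤ (s + 2) ^ 2 := Nat.le_self_pow (by norm_num) _
  have hXle : 10 * (s + 2) ^ 2 ≤ X := Nat.mul_le_mul_right _ (by omega)
  have hX : M.size + 2 ≤ X := by
    rw [hMdef, Nat.size_pow]
    have : (κ + 2) * (s + 1) * (5 * 2 ^ levels N) ≤ (κ + 2) * (s + 2) * (5 * (2 * (s + 2))) :=
      Nat.mul_le_mul (Nat.mul_le_mul_left _ (by omega)) (Nat.mul_le_mul_left _ (by omega))
    have h2 : (κ + 2) * (s + 2) * (5 * (2 * (s + 2))) = 10 * (κ + 2) * (s + 2) ^ 2 := by ring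
    have h3 : X = 10 * (κ + 2) * (s + 2) ^ 2 + 10 * (κ + 2) * (s + 2) ^ 2 + 10 * (s + 2) ^ 2 := by
      rw [hXdef]; ring
    omega
  have hg2 : ∀ y : ℕ, y ≤ s + 2 → y ≤ 2 ^ ((κ + 2) * (s + 1)) := fun y hy => by
    refine hy.trans ?_
    have h1 : s + 2 ≤ 2 ^ (s + 1) := Nat.lt_two_pow_self (n := s + 1)
    exact h1.trans (Nat.pow_le_pow_right (by norm_num) (by nlinarith))
  have hbig : (2 : ℤ) ^ (κ * (s + 1)) ≤ ((2 ^ ((κ + 2) * (s + 1)) : ℕ) : ℤ) := by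
    push_cast
    exact pow_le_pow_right₀ (by norm_num) (Nat.mul_le_mul_right _ (by omega))
  have hM1 : (2 : ℤ) ^ s ≤ M := by
    rw [hMdef]
    push_cast
    refine pow_le_pow_right₀ (by norm_num) ?_
    have := Nat.one_le_two_pow (n := levels N)
    calc s ≤ 1 * (s + 1) * 1 := by omega
      _ ≤ _ := Nat.mul_le_mul (Nat.mul_le_mul_right _ (by omega)) (by omega)
  have hok := certifier_ok (M := M) (X := X) (c := c) (m := m) (n := N)
    (g := 2 ^ ((κ + 2) * (s + 1))) (zE := zE) (cE := cE) (tE := tE) (s := initialStore (enc a))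
    (Z := Z a) (C := C a) (θ := θ a) hX (fun _ => rfl) (fun j => by simp [initialStore])
    (by simpa [initialStore] using hn a) (hg2 2 (by omega)) (hg2 _ (by omega)) (hg2 _ (by omega))
    (hg2 _ (by omega)) (by rw [← pow_mul]) (by omega) ((hlen a).trans (by omega))
    ((Nat.mul_le_mul hSs hSs).trans (by nlinarith)) (by omega) (by omega)
    (fun q => (hZ a q).trans hbig) ((hC a).trans hbig) ((hθ a).trans hbig)
    (fun q s' hq h9 h5 h0 => hz a q s' hq h9 h5 fun j => by rw [h0]; simp [initialStore])
    (fun s' h5 h7 h0 h12 => ht a s' h5 h7 (fun j => by rw [h0]; simp [initialStore]) h12)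
  obtain ⟨t, s', he, htc, -, hq⟩ := hok ⟨fun i => by simp [initialStore], fun A j => by
    simp only [initialStore]
    split
    · exact (abs_getD_le_two_pow_inputSize _ _).trans hM1
    · simp⟩
  refine ⟨t, s', he, htc.trans (hc' s), ?_⟩
  rw [hq]
  simp only [decide_eq_true_eq]
  rfl

/-! ## Soundness of the certificate -/

/-- The off-diagonal part of the matrix `x, y ↦ ∑ i, z (i, x₁, y₂) z (i, y₁, x₂)`. -/
def pairMatrix {I V R : Type*} [Fintype I] [DecidableEq V] [CommRing R] (z : I × V × V → R) :
    Matrix (V × V) (V × V) R :=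
  fun x y => if x = y then 0 else ∑ i, z (i, x.1, y.2) * z (i, y.1, x.2)

/-- The tensor on `Fin r × Fin N × Fin N` stored in an array. -/
def unflatten {R : Type*} (r N : ℕ) (z : ℕ → R) (e : Fin r × Fin N × Fin N) : R :=
  z (e.1 + r * (e.2.1 + N * e.2.2))

theorem Finset.sum_range_mul_eq_sum_prod {R : Type*} [AddCommMonoid R] (a b : ℕ) (f : ℕ → R) :
    ∑ t ∈ Finset.range (a * b), f t = ∑ x : Fin a × Fin b, f (x.1 + a * x.2) := by
  rw [mul_comm, Finset.sum_range, ← finProdFinEquiv.sum_comp,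
    ← (Equiv.prodComm (Fin a) (Fin b)).sum_comp]
  simp [finProdFinEquiv_apply_val]

/-! ### The array layout and the matrices stored in it -/

section flat

variable {r N : ℕ}

theorem code_lt (x : Fin N × Fin N) : (x.1 + N * x.2 : ℕ) < N * N := by
  have h1 := x.1.2
  have h2 := x.2.2
  nlinarith

theorem code_mod (x : Fin N × Fin N) : (x.1 + N * x.2 : ℕ) % N = x.1 := by
  rw [Nat.add_mul_mod_self_left, Nat.mod_eq_of_lt x.1.2]

theorem code_div (x : Fin N × Fin N) : (x.1 + N * x.2 : ℕ) / N = x.2 := by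
  have h : 0 < N := (Nat.zero_le _).trans_lt x.1.2
  rw [Nat.add_mul_div_left _ _ h, Nat.div_eq_of_lt x.1.2, zero_add]

theorem code_inj {x y : Fin N × Fin N} :
    (x.1 + N * x.2 : ℕ) = y.1 + N * y.2 ↔ x = y := by
  refine ⟨fun h => ?_, fun h => by rw [h]⟩
  have h1 := code_mod x
  have h2 := code_div x
  rw [h, code_mod] at h1
  rw [h, code_div] at h2
  exact Prod.ext (Fin.ext h1.symm) (Fin.ext h2.symm)

theorem mul_add_code_div (a : ℕ) (y : Fin N × Fin N) :
    (a * (N * N) + (y.1 + N * y.2 : ℕ)) / (N * N) = a := by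
  have h := code_lt y
  rw [mul_comm a, Nat.mul_add_div (by omega), Nat.div_eq_of_lt h, add_zero]

theorem mul_add_code_mod (a : ℕ) (y : Fin N × Fin N) :
    (a * (N * N) + (y.1 + N * y.2 : ℕ)) % (N * N) = y.1 + N * y.2 := by
  rw [mul_comm a, Nat.mul_add_mod, Nat.mod_eq_of_lt (code_lt y)]

theorem pairFlat_code (z : ℕ → ℤ) (x y : Fin N × Fin N) :
    pairFlat r N z ((x.1 + N * x.2 : ℕ) * (N * N) + (y.1 + N * y.2 : ℕ)) =
      pairMatrix (unflatten r N z) x y := by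
  unfold pairFlat pairMatrix
  rw [mul_add_code_div, mul_add_code_mod]
  by_cases h : x = y
  · simp [h]
  · rw [if_neg (by rwa [code_inj]), if_neg h, code_mod, code_mod, code_div, code_div,
      Finset.sum_range]
    rfl

theorem sqFlat_iterate_code {B : ℕ → ℤ} {A : Matrix (Fin N × Fin N) (Fin N × Fin N) ℤ}
    (h : ∀ x y : Fin N × Fin N, B ((x.1 + N * x.2 : ℕ) * (N * N) + (y.1 + N * y.2 : ℕ)) = A x y)
    (j : ℕ) (x y : Fin N × Fin N) :
    (sqFlat (N * N))^[j] B ((x.1 + N * x.2 : ℕ) * (N * N) + (y.1 + N * y.2 : ℕ)) =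
      (A ^ 2 ^ j) x y := by
  induction j generalizing x y with
  | zero => simpa using h x y
  | succ j ih =>
    rw [Function.iterate_succ_apply', pow_succ 2, pow_mul, pow_two, Matrix.mul_apply, sqFlat,
      mul_add_code_div, mul_add_code_mod, Finset.sum_range_mul_eq_sum_prod]
    exact Finset.sum_congr rfl fun t _ => by rw [ih, ih]

/-- With this the certificate becomes a statement about matrices; soundness and probability no
longer see the array arithmetic. -/
theorem certified_iff {n : ℕ} {z : ℕ → ℤ} {θ : ℤ} :
    Certified n r N z θ ↔ 0 ≤ θ ∧ 2 * r * ∑ e, unflatten r N z e ^ 2 ≤ θ ^ 2 ∧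
      (2 * r * (N * N)) ^ 2 ^ levels n *
        (pairMatrix (unflatten r N z) ^ 2 ^ levels n).trace ≤ (θ ^ 2) ^ 2 ^ levels n := by
  have h1 : ∑ q ∈ Finset.range (r * (N * N)), z q * z q = ∑ e, unflatten r N z e ^ 2 := by
    rw [Finset.sum_range_mul_eq_sum_prod, Fintype.sum_prod_type, Fintype.sum_prod_type]
    refine Finset.sum_congr rfl fun i _ => ?_
    rw [← Finset.sum_range fun t => z (i + r * t) * z (i + r * t),
      Finset.sum_range_mul_eq_sum_prod]
    exact Finset.sum_congr rfl fun x _ => (pow_two _).symm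
  have h2 : ∑ t ∈ Finset.range (N * N),
      (sqFlat (N * N))^[levels n] (pairFlat r N z) (t * (N * N) + t) =
      (pairMatrix (unflatten r N z) ^ 2 ^ levels n).trace := by
    rw [Finset.sum_range_mul_eq_sum_prod, Matrix.trace]
    exact Finset.sum_congr rfl fun x _ => sqFlat_iterate_code (pairFlat_code z) _ x x
  rw [Certified, h1, h2, pow_two]

end flat

/-! ### Quadratic forms, traces of powers, and Cauchy–Schwarz -/

section sound

open Matrix

theorem pairMatrix_isSymm {I V R : Type*} [Fintype I] [DecidableEq V] [CommRing R]
    (z : I × V × V → R) :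
    (pairMatrix z).IsSymm := by
  ext x y
  simp only [Matrix.transpose_apply, pairMatrix, eq_comm (a := y)]
  congr 1
  exact Finset.sum_congr rfl fun i _ => mul_comm _ _

variable {I V W : Type*} [Fintype I] [Fintype V] [DecidableEq V] [Fintype W] [DecidableEq W]

/-- For j ≥ 1 the power is the square of a symmetric matrix, so its trace is a sum of squares. -/
theorem Matrix.IsSymm.trace_pow_nonneg {A : Matrix W W ℝ} (hA : A.IsSymm) {j : ℕ} (hj : 1 ≤ j) :
    0 ≤ (A ^ 2 ^ j).trace := by
  obtain ⟨i, rfl⟩ : ∃ i, j = i + 1 := ⟨j - 1, by omega⟩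
  rw [pow_succ 2, pow_mul, pow_two, Matrix.trace]
  refine Finset.sum_nonneg fun x _ => ?_
  rw [Matrix.diag_apply, Matrix.mul_apply]
  refine Finset.sum_nonneg fun y _ => ?_
  rw [(hA.pow (2 ^ i)).apply x y]
  exact mul_self_nonneg _

theorem Matrix.IsSymm.dotProduct_mulVec_sq_le {A : Matrix W W ℝ} (hA : A.IsSymm) (u : W → ℝ) :
    (u ⬝ᵥ A *ᵥ u) ^ 2 ≤ (u ⬝ᵥ u) * (u ⬝ᵥ (A ^ 2) *ᵥ u) := by
  have h := Finset.sum_mul_sq_le_sq_mul_sq Finset.univ u (A *ᵥ u)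
  have h1 : u ⬝ᵥ (A ^ 2) *ᵥ u = (A *ᵥ u) ⬝ᵥ (A *ᵥ u) := by
    rw [pow_two, ← Matrix.mulVec_mulVec, Matrix.dotProduct_mulVec, ← Matrix.mulVec_transpose, hA.eq]
  rw [h1]
  simpa only [dotProduct, pow_two] using h

theorem Matrix.IsSymm.dotProduct_mulVec_sq_le_trace {A : Matrix W W ℝ} (hA : A.IsSymm)
    (u : W → ℝ) : (u ⬝ᵥ A *ᵥ u) ^ 2 ≤ (u ⬝ᵥ u) ^ 2 * (A ^ 2).trace := by
  refine (hA.dotProduct_mulVec_sq_le u).trans ?_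
  have hu : 0 ≤ u ⬝ᵥ u := Finset.sum_nonneg fun x _ => mul_self_nonneg _
  rw [pow_two (u ⬝ᵥ u), mul_assoc]
  refine mul_le_mul_of_nonneg_left ?_ hu
  have h1 : u ⬝ᵥ (A ^ 2) *ᵥ u = ∑ x, (∑ y, A x y * u y) ^ 2 := by
    rw [pow_two, ← Matrix.mulVec_mulVec, Matrix.dotProduct_mulVec, ← Matrix.mulVec_transpose, hA.eq]
    simp only [dotProduct, mulVec, pow_two]
  have h2 : (A ^ 2).trace = ∑ x, ∑ y, A x y ^ 2 := by
    rw [pow_two, Matrix.trace]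
    refine Finset.sum_congr rfl fun x _ => ?_
    rw [Matrix.diag_apply, Matrix.mul_apply]
    exact Finset.sum_congr rfl fun y _ => by rw [hA.apply x y, pow_two]
  rw [h1, h2, Finset.mul_sum]
  refine Finset.sum_le_sum fun x _ => ?_
  have h := Finset.sum_mul_sq_le_sq_mul_sq Finset.univ (A x) u
  rw [mul_comm] at h
  simpa only [dotProduct, pow_two] using h

/-- Replaces the comparison of operator norm and trace without any spectral theory: Cauchy–Schwarz
passes from A to A², and the induction ends at the Frobenius norm. -/
theorem Matrix.IsSymm.dotProduct_mulVec_pow_le_trace {A : Matrix W W ℝ} (hA : A.IsSymm)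
    (u : W → ℝ) {j : ℕ} (hj : 1 ≤ j) :
    (u ⬝ᵥ A *ᵥ u) ^ 2 ^ j ≤ (u ⬝ᵥ u) ^ 2 ^ j * (A ^ 2 ^ j).trace := by
  have hu : 0 ≤ u ⬝ᵥ u := Finset.sum_nonneg fun x _ => mul_self_nonneg _
  induction j, hj using Nat.le_induction generalizing A with
  | base => simpa using hA.dotProduct_mulVec_sq_le_trace u
  | succ j hj ih =>
    have h := ih (hA.pow 2)
    calc (u ⬝ᵥ A *ᵥ u) ^ 2 ^ (j + 1) = ((u ⬝ᵥ A *ᵥ u) ^ 2) ^ 2 ^ j := by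
          rw [← pow_mul, pow_succ' 2]
      _ ≤ ((u ⬝ᵥ u) * (u ⬝ᵥ (A ^ 2) *ᵥ u)) ^ 2 ^ j :=
          pow_le_pow_left₀ (sq_nonneg _) (hA.dotProduct_mulVec_sq_le u) _
      _ = (u ⬝ᵥ u) ^ 2 ^ j * (u ⬝ᵥ (A ^ 2) *ᵥ u) ^ 2 ^ j := mul_pow _ _ _
      _ ≤ (u ⬝ᵥ u) ^ 2 ^ j * ((u ⬝ᵥ u) ^ 2 ^ j * ((A ^ 2) ^ 2 ^ j).trace) := by gcongr
      _ = (u ⬝ᵥ u) ^ 2 ^ (j + 1) * (A ^ 2 ^ (j + 1)).trace := by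
          rw [← mul_assoc, ← pow_add, ← pow_mul, ← mul_two, pow_succ 2 j, mul_comm 2]

theorem sum_sq_eq_pairMatrix (z : I × V × V → ℝ) (u : V → ℝ) :
    ∑ i, (∑ x : V × V, z (i, x) * (u x.1 * u x.2)) ^ 2 =
      (fun x : V × V => u x.1 * u x.2) ⬝ᵥ pairMatrix z *ᵥ (fun x : V × V => u x.1 * u x.2) +
        ∑ x : V × V, (u x.1 * u x.2) ^ 2 * ∑ i, z (i, x) ^ 2 := by
  have h1 : ∀ i, (∑ x : V × V, z (i, x) * (u x.1 * u x.2)) ^ 2 =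
      ∑ x : V × V, ∑ y : V × V, (u x.1 * u x.2) * (u y.1 * u y.2) *
        (z (i, x.1, y.2) * z (i, y.1, x.2)) := fun i => by
    rw [pow_two, Finset.sum_mul_sum, ← Fintype.sum_prod_type', ← Fintype.sum_prod_type']
    -- The involution exchanges the second coordinates of the two pairs; it leaves the monomial in u
    -- unchanged and produces the rows and columns of `pairMatrix`.
    let e : (V × V) × (V × V) ≃ (V × V) × (V × V) :=
      ⟨fun q => ((q.1.1, q.2.2), (q.2.1, q.1.2)), fun q => ((q.1.1, q.2.2), (q.2.1, q.1.2)),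
        fun _ => rfl, fun _ => rfl⟩
    exact Fintype.sum_equiv e _ _ fun q => by simp only [e, Equiv.coe_fn_mk]; ring
  have h2 : ∀ x y : V × V, ∑ i, z (i, x.1, y.2) * z (i, y.1, x.2) =
      pairMatrix z x y + if x = y then ∑ i, z (i, x) ^ 2 else 0 := fun x y => by
    unfold pairMatrix
    split_ifs with h
    · subst h
      rw [zero_add]
      exact Finset.sum_congr rfl fun i _ => (pow_two _).symm
    · rw [add_zero]
  simp only [h1]
  rw [Finset.sum_comm]
  simp only [dotProduct, mulVec]
  rw [← Finset.sum_add_distrib]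
  refine Finset.sum_congr rfl fun x _ => ?_
  rw [Finset.sum_comm]
  simp only [← Finset.mul_sum, h2, mul_add, Finset.sum_add_distrib, mul_ite, mul_zero,
    Finset.sum_ite_eq, Finset.mem_univ, if_true]
  congr 1
  · rw [Finset.mul_sum]
    exact Finset.sum_congr rfl fun y _ => by ring
  · rw [pow_two]

theorem sq_sum_le_pairMatrix (z : I × V × V → ℝ) {y : I → ℝ} {u : V → ℝ} (hy : ∀ i, |y i| ≤ 1)
    (hu : ∀ a, |u a| ≤ 1) :
    (∑ e : I × V × V, z e * (y e.1 * (u e.2.1 * u e.2.2))) ^ 2 ≤ Fintype.card I *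
      ((fun x : V × V => u x.1 * u x.2) ⬝ᵥ pairMatrix z *ᵥ (fun x : V × V => u x.1 * u x.2) +
        ∑ e, z e ^ 2) := by
  have h1 : ∑ e : I × V × V, z e * (y e.1 * (u e.2.1 * u e.2.2)) =
      ∑ i, y i * ∑ x : V × V, z (i, x) * (u x.1 * u x.2) := by
    rw [Fintype.sum_prod_type]
    refine Finset.sum_congr rfl fun i _ => ?_
    rw [Finset.mul_sum]
    exact Finset.sum_congr rfl fun x _ => by ring
  have hu2 : ∀ x : V × V, (u x.1 * u x.2) ^ 2 ≤ 1 := fun x => by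
    rw [sq_le_one_iff_abs_le_one, abs_mul]
    exact mul_le_one₀ (hu _) (abs_nonneg _) (hu _)
  have h2 : ∑ i, y i ^ 2 ≤ Fintype.card I := by
    calc ∑ i, y i ^ 2 ≤ ∑ _i : I, (1 : ℝ) :=
          Finset.sum_le_sum fun i _ => by rw [sq_le_one_iff_abs_le_one]; exact hy i
      _ = _ := by simp
  rw [h1]
  refine (Finset.sum_mul_sq_le_sq_mul_sq _ _ _).trans ?_
  refine mul_le_mul h2 ?_ (Finset.sum_nonneg fun _ _ => sq_nonneg _) (by positivity)
  rw [sum_sq_eq_pairMatrix]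
  gcongr
  have h3 : ∑ e : I × V × V, z e ^ 2 = ∑ x : V × V, ∑ i, z (i, x) ^ 2 := by
    rw [Fintype.sum_prod_type, Finset.sum_comm]
  rw [h3]
  exact Finset.sum_le_sum fun x _ =>
    mul_le_of_le_one_left (Finset.sum_nonneg fun _ _ => sq_nonneg _) (hu2 x)

/-- The factors 2 allot θ²/2 to the quadratic form and θ²/2 to the diagonal part. -/
theorem abs_sum_le_of_certificate (z : I × V × V → ℝ) {y : I → ℝ} {u : V → ℝ}
    (hy : ∀ i, |y i| ≤ 1) (hu : ∀ a, |u a| ≤ 1) {θ : ℝ} (hθ : 0 ≤ θ) {j : ℕ} (hj : 1 ≤ j)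
    (h1 : 2 * Fintype.card I * ∑ e, z e ^ 2 ≤ θ ^ 2)
    (h2 : (2 * Fintype.card I * (Fintype.card V * Fintype.card V)) ^ 2 ^ j *
      (pairMatrix z ^ 2 ^ j).trace ≤ (θ ^ 2) ^ 2 ^ j) :
    |∑ e : I × V × V, z e * (y e.1 * (u e.2.1 * u e.2.2))| ≤ θ := by
  have hA := pairMatrix_isSymm z
  set U : V × V → ℝ := fun x => u x.1 * u x.2 with hU
  have hUU : U ⬝ᵥ U ≤ Fintype.card V * Fintype.card V := by
    calc U ⬝ᵥ U ≤ ∑ _x : V × V, (1 : ℝ) := Finset.sum_le_sum fun x _ => by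
          rw [← pow_two, sq_le_one_iff_abs_le_one, abs_mul]
          exact mul_le_one₀ (hu _) (abs_nonneg _) (hu _)
      _ = _ := by simp
  have hU0 : 0 ≤ U ⬝ᵥ U := Finset.sum_nonneg fun x _ => mul_self_nonneg _
  have hp := hA.dotProduct_mulVec_pow_le_trace U hj
  have ht := hA.trace_pow_nonneg hj
  have h3 : (2 * Fintype.card I * (U ⬝ᵥ pairMatrix z *ᵥ U)) ^ 2 ^ j ≤ (θ ^ 2) ^ 2 ^ j := by
    refine le_trans ?_ h2
    rw [mul_pow, mul_pow _ ((Fintype.card V : ℝ) * _), mul_assoc]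
    gcongr
    refine hp.trans ?_
    gcongr
  have h4 : 2 * Fintype.card I * (U ⬝ᵥ pairMatrix z *ᵥ U) ≤ θ ^ 2 := by
    by_contra hlt
    rw [not_le] at hlt
    exact absurd h3 (not_le.2 (pow_lt_pow_left₀ hlt (sq_nonneg _) (by positivity)))
  refine abs_le_of_sq_le_sq ?_ hθ
  refine (sq_sum_le_pairMatrix z hy hu).trans ?_
  linarith

end sound

theorem abs_sum_le_of_certified {n r N : ℕ} {z : ℕ → ℤ} {θ : ℤ} (h : Certified n r N z θ)
    {y : Fin r → ℝ} {u : Fin N → ℝ} (hy : ∀ i, |y i| ≤ 1) (hu : ∀ a, |u a| ≤ 1) :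
    |∑ e : Fin r × Fin N × Fin N, ((unflatten r N z e : ℤ) : ℝ) *
      (y e.1 * (u e.2.1 * u e.2.2))| ≤ θ := by
  obtain ⟨h0, h1, h2⟩ := certified_iff.1 h
  have hj : 1 ≤ levels n := Nat.clog_pos (by norm_num) (by omega)
  have hmap : pairMatrix (fun e => ((unflatten r N z e : ℤ) : ℝ)) =
      (pairMatrix (unflatten r N z)).map (Int.castRingHom ℝ) := by
    ext x y
    simp only [pairMatrix, Matrix.map_apply]
    split <;> simp
  refine abs_sum_le_of_certificate _ hy hu (by exact_mod_cast h0) hj ?_ ?_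
  · rw [Fintype.card_fin]
    exact_mod_cast h1
  · rw [Fintype.card_fin, Fintype.card_fin, hmap, ← RingHom.mapMatrix_apply, ← map_pow,
      RingHom.mapMatrix_apply, ← AddMonoidHom.map_trace]
    have : (((2 * r * (N * N)) ^ 2 ^ levels n *
        (pairMatrix (unflatten r N z) ^ 2 ^ levels n).trace : ℤ) : ℝ) ≤
        (((θ ^ 2) ^ 2 ^ levels n : ℤ) : ℝ) := by exact_mod_cast h2
    simpa using this

/-! ## Moments of the trace -/

section walks

variable {I V : Type*} [Fintype I] [Fintype V] [DecidableEq V]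

/-- The sum of `F` over the walks of length `t` from `x` without constant steps. Each step `x → y`
carries an index `i` and adds the two triples `(i, x₁, y₂)`, `(i, y₁, x₂)` to the list. -/
def walkSum (F : V × V → List (I × V × V) → ℝ) : ℕ → V × V → List (I × V × V) → ℝ
  | 0, x, L => F x L
  | t + 1, x, L => ∑ y, if x = y then 0 else
      ∑ i, walkSum F t y ((i, x.1, y.2) :: (i, y.1, x.2) :: L)

/-- A matrix power is a sum over walks, and the zero diagonal of `pairMatrix` excludes constant
steps. The list L keeps track of the entries used, so that expectations can be taken per walk. -/
theorem walkSum_prod (v : I × V × V → ℝ) (x₀ : V × V) (t : ℕ) (x : V × V) (L : List (I × V × V)) :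
    walkSum (fun y L => if y = x₀ then (L.map v).prod else 0) t x L =
      (L.map v).prod * (pairMatrix v ^ t) x x₀ := by
  induction t generalizing x L with
  | zero => by_cases h : x = x₀ <;> simp [walkSum, h]
  | succ t ih =>
    rw [walkSum, pow_succ', Matrix.mul_apply, Finset.mul_sum]
    refine Finset.sum_congr rfl fun y _ => ?_
    rw [pairMatrix]
    split_ifs with h
    · simp
    · rw [Finset.sum_mul, Finset.mul_sum]
      refine Finset.sum_congr rfl fun i _ => ?_
      rw [ih]
      simp only [List.map_cons, List.prod_cons]
      ring

theorem walkSum_mono {F G : V × V → List (I × V × V) → ℝ} {t n : ℕ} {x : V × V}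
    {L : List (I × V × V)} (hn : L.length + 2 * t = n)
    (h : ∀ y L', L'.length = n → F y L' ≤ G y L') : walkSum F t x L ≤ walkSum G t x L := by
  induction t generalizing x L with
  | zero => exact h x L (by omega)
  | succ t ih =>
    refine Finset.sum_le_sum fun y _ => ?_
    split_ifs
    · exact le_rfl
    · exact Finset.sum_le_sum fun i _ => ih (by simp only [List.length_cons]; omega)

theorem walkSum_const_mul (c : ℝ) (F : V × V → List (I × V × V) → ℝ) (t : ℕ) (x : V × V)
    (L : List (I × V × V)) : walkSum (fun y L => c * F y L) t x L = c * walkSum F t x L := by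
  induction t generalizing x L with
  | zero => rfl
  | succ t ih =>
    simp only [walkSum, ih, Finset.mul_sum]
    refine Finset.sum_congr rfl fun y _ => ?_
    split_ifs
    · simp
    · rw [Finset.mul_sum]

theorem integral_walkSum {Ω : Type*} [MeasurableSpace Ω] {μ : Measure Ω}
    {F : Ω → V × V → List (I × V × V) → ℝ} (hF : ∀ y L, Integrable (fun ω => F ω y L) μ)
    (t : ℕ) (x : V × V) (L : List (I × V × V)) :
    Integrable (fun ω => walkSum (F ω) t x L) μ ∧
      ∫ ω, walkSum (F ω) t x L ∂μ = walkSum (fun y L => ∫ ω, F ω y L ∂μ) t x L := by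
  induction t generalizing x L with
  | zero => exact ⟨hF x L, rfl⟩
  | succ t ih =>
    have h1 : ∀ y, Integrable (fun ω => if x = y then 0 else
        ∑ i, walkSum (F ω) t y ((i, x.1, y.2) :: (i, y.1, x.2) :: L)) μ := fun y => by
      split_ifs
      · exact integrable_zero _ _ _
      · exact integrable_finsetSum _ fun i _ => (ih _ _).1
    refine ⟨integrable_finsetSum _ fun y _ => h1 y, ?_⟩
    simp only [walkSum]
    rw [integral_finsetSum _ fun y _ => h1 y]
    refine Finset.sum_congr rfl fun y _ => ?_
    split_ifs
    · simp
    · rw [integral_finsetSum _ fun i _ => (ih _ _).1]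
      exact Finset.sum_congr rfl fun i _ => (ih _ _).2

variable [DecidableEq I]

theorem sum_indicator_le_card {α β : Type*} [Fintype α] [DecidableEq β] (f : α → β)
    (hf : Function.Injective f) (F : Finset β) :
    ∑ a, (if f a ∈ F then (1 : ℝ) else 0) ≤ F.card := by
  rw [Finset.sum_boole]
  exact_mod_cast Finset.card_le_card_of_injOn f (by intro a; simp) hf.injOn

/-- F is the set of entries already used and a is the price of a new one. If both entries of the
step are new, all choices of y and i together cost rN²a² ≤ 1. If one is old, it fixes i and one
coordinate of y, and the free coordinate costs Na ≤ 1, so each of the two cases gives at most |F|.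
If both are old there are at most |F|² choices. The total is (1 + |F|)². -/
theorem sum_step_le {a : ℝ} (hV : Fintype.card V * a ≤ 1)
    (hI : Fintype.card I * (Fintype.card V * Fintype.card V) * a ^ 2 ≤ 1) (F : Finset (I × V × V))
    (x : V × V) :
    ∑ y : V × V, ∑ i, (a + if (i, x.1, y.2) ∈ F then 1 else 0) *
      (a + if (i, y.1, x.2) ∈ F then 1 else 0) ≤ (1 + F.card : ℝ) ^ 2 := by
  set f : I → V → ℝ := fun i d => if (i, x.1, d) ∈ F then 1 else 0 with hf
  set g : I → V → ℝ := fun i c => if (i, c, x.2) ∈ F then 1 else 0 with hg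
  have hf0 : ∀ i d, 0 ≤ f i d := fun i d => by simp only [hf]; split_ifs <;> norm_num
  have hg0 : ∀ i c, 0 ≤ g i c := fun i c => by simp only [hg]; split_ifs <;> norm_num
  have hfs : ∑ d, ∑ i, f i d ≤ F.card := by
    rw [← Fintype.sum_prod_type']
    refine sum_indicator_le_card (fun q : V × I => (q.2, x.1, q.1)) ?_ F
    rintro ⟨d, i⟩ ⟨d', i'⟩ h
    simp only [Prod.mk.injEq] at h
    exact Prod.ext h.2.2 h.1
  have hgs : ∑ c, ∑ i, g i c ≤ F.card := by
    rw [← Fintype.sum_prod_type']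
    refine sum_indicator_le_card (fun q : V × I => (q.2, q.1, x.2)) ?_ F
    rintro ⟨d, i⟩ ⟨d', i'⟩ h
    simp only [Prod.mk.injEq] at h
    exact Prod.ext h.2.1 h.1
  have hfg : ∑ c, ∑ d, ∑ i, f i d * g i c ≤ F.card * F.card := by
    calc ∑ c, ∑ d, ∑ i, f i d * g i c ≤ ∑ c, ∑ d, ∑ i, f i d * ∑ j, g j c :=
          Finset.sum_le_sum fun c _ => Finset.sum_le_sum fun d _ => Finset.sum_le_sum fun i _ =>
            mul_le_mul_of_nonneg_left (Finset.single_le_sum (f := fun j => g j c)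
              (fun j _ => hg0 j c) (Finset.mem_univ i)) (hf0 i d)
      _ = (∑ d, ∑ i, f i d) * ∑ c, ∑ i, g i c := by
          simp only [← Finset.sum_mul, ← Finset.mul_sum]
      _ ≤ F.card * F.card := mul_le_mul hfs hgs
          (Finset.sum_nonneg fun c _ => Finset.sum_nonneg fun i _ => hg0 i c) (by positivity)
  have hsplit : ∑ y : V × V, ∑ i, (a + f i y.2) * (a + g i y.1) =
      Fintype.card I * (Fintype.card V * Fintype.card V) * a ^ 2 +
      (Fintype.card V * a) * (∑ d, ∑ i, f i d) + (Fintype.card V * a) * (∑ c, ∑ i, g i c) +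
      ∑ c, ∑ d, ∑ i, f i d * g i c := by
    have h1 : ∀ c d i, (a + f i d) * (a + g i c) = a ^ 2 + a * f i d + a * g i c + f i d * g i c :=
      fun c d i => by ring
    rw [Fintype.sum_prod_type]
    simp only [h1, Finset.sum_add_distrib, ← Finset.mul_sum, Finset.sum_const, Finset.card_univ,
      nsmul_eq_mul]
    ring
  rw [hsplit]
  have h2 : (Fintype.card V * a) * (∑ d, ∑ i, f i d) ≤ 1 * F.card :=
    mul_le_mul hV hfs (Finset.sum_nonneg fun d _ => Finset.sum_nonneg fun i _ => hf0 i d)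
      zero_le_one
  have h3 : (Fintype.card V * a) * (∑ c, ∑ i, g i c) ≤ 1 * F.card :=
    mul_le_mul hV hgs (Finset.sum_nonneg fun d _ => Finset.sum_nonneg fun i _ => hg0 i d)
      zero_le_one
  nlinarith

/-- Distinctness is why the diagonal is removed from `pairMatrix`: a new entry used twice in one
step would bring a single factor a instead of a². -/
theorem pow_card_insert_le {α : Type*} [DecidableEq α] {a : ℝ} (ha : 0 ≤ a) {e₁ e₂ : α}
    (h : e₁ ≠ e₂) (F : Finset α) : a ^ (insert e₁ (insert e₂ F)).card ≤
      a ^ F.card * ((a + if e₁ ∈ F then 1 else 0) * (a + if e₂ ∈ F then 1 else 0)) := by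
  have hp : 0 ≤ a ^ F.card := pow_nonneg ha _
  have key : ∀ (e : α) (G : Finset α), a ^ (insert e G).card ≤
      a ^ G.card * (a + if e ∈ G then 1 else 0) := fun e G => by
    have hG : 0 ≤ a ^ G.card := pow_nonneg ha _
    by_cases he : e ∈ G
    · rw [Finset.insert_eq_of_mem he, if_pos he]
      nlinarith
    · rw [Finset.card_insert_of_notMem he, if_neg he, pow_succ, add_zero]
  refine (key e₁ _).trans ?_
  have h1 : e₁ ∈ insert e₂ F ↔ e₁ ∈ F := by simp [h]
  simp only [h1]
  have h0 : 0 ≤ a + if e₁ ∈ F then (1 : ℝ) else 0 := by split_ifs <;> linarith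
  calc _ ≤ (a ^ F.card * (a + if e₂ ∈ F then 1 else 0)) * (a + if e₁ ∈ F then 1 else 0) :=
        mul_le_mul_of_nonneg_right (key e₂ F) h0
    _ = _ := by ring

/-- The number b bounds the final length of the list, hence 1 + |F| at every step, and each step
costs at most b². -/
theorem walkSum_pow_card_le {a : ℝ} (ha : 0 ≤ a) (hV : Fintype.card V * a ≤ 1)
    (hI : Fintype.card I * (Fintype.card V * Fintype.card V) * a ^ 2 ≤ 1) {b : ℕ} (t : ℕ)
    (x : V × V) (L : List (I × V × V)) (hb : L.length + 2 * t ≤ b) :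
    walkSum (fun _ L => a ^ L.toFinset.card) t x L ≤ a ^ L.toFinset.card * ((b : ℝ) ^ 2) ^ t := by
  induction t generalizing x L with
  | zero => simp [walkSum]
  | succ t ih =>
    have hcard : (1 + L.toFinset.card : ℝ) ≤ b := by
      have := L.toFinset_card_le
      exact_mod_cast (by omega : 1 + L.toFinset.card ≤ b)
    have hp : 0 ≤ a ^ L.toFinset.card := pow_nonneg ha _
    calc walkSum (fun _ L => a ^ L.toFinset.card) (t + 1) x L
        ≤ ∑ y : V × V, ∑ i, a ^ L.toFinset.card * ((a + if (i, x.1, y.2) ∈ L.toFinset then 1 else 0) *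
            (a + if (i, y.1, x.2) ∈ L.toFinset then 1 else 0)) * ((b : ℝ) ^ 2) ^ t := by
          refine Finset.sum_le_sum fun y _ => ?_
          split_ifs with hxy
          · refine Finset.sum_nonneg fun i _ => ?_
            have h0 : ∀ e, 0 ≤ a + if e ∈ L.toFinset then (1 : ℝ) else 0 := fun e => by
              split_ifs <;> linarith
            exact mul_nonneg (mul_nonneg hp (mul_nonneg (h0 _) (h0 _))) (by positivity)
          · refine Finset.sum_le_sum fun i _ => (ih y _ (by simp only [List.length_cons]; omega)).trans ?_
            refine mul_le_mul_of_nonneg_right ?_ (by positivity)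
            rw [List.toFinset_cons, List.toFinset_cons]
            refine pow_card_insert_le ha (fun h => hxy ?_) _
            simp only [Prod.mk.injEq, true_and] at h
            exact Prod.ext h.1 h.2.symm
      _ = a ^ L.toFinset.card * (∑ y : V × V, ∑ i, (a + if (i, x.1, y.2) ∈ L.toFinset then 1 else 0) *
            (a + if (i, y.1, x.2) ∈ L.toFinset then 1 else 0)) * ((b : ℝ) ^ 2) ^ t := by
          simp only [Finset.mul_sum, Finset.sum_mul]
      _ ≤ a ^ L.toFinset.card * ((b : ℝ) ^ 2) * ((b : ℝ) ^ 2) ^ t := by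
          gcongr
          exact (sum_step_le hV hI _ x).trans (pow_le_pow_left₀ (by positivity) hcard 2)
      _ = _ := by ring

end walks

/-! ### Moments of products of independent entries -/

section moments

variable {Ω E : Type*} [MeasurableSpace Ω] {μ : Measure Ω} [IsProbabilityMeasure μ] {v : E → Ω → ℝ}

theorem integrable_list_prod [Finite E] (hm : ∀ e, Measurable (v e))
    (hb : ∀ e, ∀ᵐ ω ∂μ, |v e ω| ≤ 1)
    (L : List E) : Integrable (fun ω => (L.map fun e => v e ω).prod) μ := by
  have hmeas : Measurable fun ω => (L.map fun e => v e ω).prod := by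
    induction L with
    | nil => simp
    | cons e L ih =>
      simp only [List.map_cons, List.prod_cons]
      exact (hm e).mul ih
  refine .of_bound hmeas.aestronglyMeasurable 1 ?_
  filter_upwards [ae_all_iff.2 hb] with ω hω
  rw [Real.norm_eq_abs]
  clear hmeas
  induction L with
  | nil => simp
  | cons e L ih =>
    simp only [List.map_cons, List.prod_cons, abs_mul]
    exact mul_le_one₀ (hω e) (abs_nonneg _) ih

variable [Fintype E] [DecidableEq E]

/-- The first power uses the small mean; higher powers use |f|^c ≤ |f| and q² ≤ q^c. A mean of size
a suffices, which leaves room for rounding. -/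
theorem abs_integral_pow_le {f : Ω → ℝ} (hf : Measurable f) (hb : ∀ᵐ ω ∂μ, |f ω| ≤ 1) {q a : ℝ}
    (hq : 1 ≤ q) (ha : 0 ≤ a) (h1 : ∫ ω, |f ω| ∂μ ≤ q ^ 2 * a) (h2 : |∫ ω, f ω ∂μ| ≤ a) {c : ℕ}
    (hc : c ≠ 0) : |∫ ω, f ω ^ c ∂μ| ≤ q ^ c * a := by
  have hint : Integrable f μ := .of_bound hf.aestronglyMeasurable 1 hb
  rcases (show c = 1 ∨ 2 ≤ c by omega) with rfl | hc2
  · simp only [pow_one]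
    exact h2.trans (le_mul_of_one_le_left ha hq)
  · calc |∫ ω, f ω ^ c ∂μ| ≤ ∫ ω, |f ω ^ c| ∂μ := abs_integral_le_integral_abs
      _ ≤ ∫ ω, |f ω| ∂μ := by
          refine integral_mono_of_nonneg (.of_forall fun ω => abs_nonneg _) hint.abs ?_
          filter_upwards [hb] with ω hω
          rw [abs_pow]
          exact pow_le_of_le_one (abs_nonneg _) hω hc
      _ ≤ q ^ 2 * a := h1
      _ ≤ q ^ c * a := by gcongr

theorem abs_integral_prod_le (hm : ∀ e, Measurable (v e)) (hi : iIndepFun v μ)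
    (hb : ∀ e, ∀ᵐ ω ∂μ, |v e ω| ≤ 1) {q a : ℝ} (hq : 1 ≤ q) (ha : 0 ≤ a)
    (h1 : ∀ e, ∫ ω, |v e ω| ∂μ ≤ q ^ 2 * a) (h2 : ∀ e, |∫ ω, v e ω ∂μ| ≤ a) (L : List E) :
    |∫ ω, (L.map fun e => v e ω).prod ∂μ| ≤ q ^ L.length * a ^ L.toFinset.card := by
  have hprod : ∀ ω, (L.map fun e => v e ω).prod = ∏ e, v e ω ^ L.count e := fun ω => by
    rw [Finset.prod_list_map_count]
    refine Finset.prod_subset (Finset.subset_univ _) fun e _ he => ?_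
    rw [List.count_eq_zero_of_not_mem (by simpa using he), pow_zero]
  simp only [hprod]
  rw [hi.integral_fun_prod_comp (f := fun e x => x ^ L.count e) (fun e => (hm e).aemeasurable)
    (fun e => (by fun_prop : Measurable fun x : ℝ => x ^ L.count e).aestronglyMeasurable),
    Finset.abs_prod]
  calc ∏ e, |∫ ω, v e ω ^ L.count e ∂μ|
      ≤ ∏ e, q ^ L.count e * (if e ∈ L.toFinset then a else 1) := by
        refine Finset.prod_le_prod (fun e _ => abs_nonneg _) fun e _ => ?_
        split_ifs with he
        · exact abs_integral_pow_le (hm e) (hb e) hq ha (h1 e) (h2 e)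
            (List.count_pos_iff.2 (by simpa using he)).ne'
        · rw [List.count_eq_zero_of_not_mem (by simpa using he)]
          simp
    _ = q ^ L.length * a ^ L.toFinset.card := by
        rw [Finset.prod_mul_distrib, Finset.prod_pow_eq_pow_sum, Finset.prod_ite_mem,
          Finset.univ_inter, Finset.prod_const]
        congr 2
        rw [← Finset.sum_subset (Finset.subset_univ L.toFinset), List.sum_toFinset_count_eq_length]
        intro e _ he
        exact List.count_eq_zero_of_not_mem (by simpa using he)

theorem integral_trace_pow_le {I V : Type*} [Fintype I] [Fintype V] [DecidableEq V] [DecidableEq I]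
    {v : I × V × V → Ω → ℝ} (hm : ∀ e, Measurable (v e)) (hi : iIndepFun v μ)
    (hb : ∀ e, ∀ᵐ ω ∂μ, |v e ω| ≤ 1) {q a : ℝ} (hq : 1 ≤ q) (ha : 0 ≤ a)
    (h1 : ∀ e, ∫ ω, |v e ω| ∂μ ≤ q ^ 2 * a) (h2 : ∀ e, |∫ ω, v e ω ∂μ| ≤ a)
    (hV : Fintype.card V * a ≤ 1)
    (hI : Fintype.card I * (Fintype.card V * Fintype.card V) * a ^ 2 ≤ 1) (t : ℕ) :
    Integrable (fun ω => (pairMatrix (fun e => v e ω) ^ t).trace) μ ∧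
      ∫ ω, (pairMatrix (fun e => v e ω) ^ t).trace ∂μ ≤
        Fintype.card V * Fintype.card V * (q ^ 2 * (2 * t) ^ 2) ^ t := by
  have htr : ∀ ω, (pairMatrix (fun e => v e ω) ^ t).trace = ∑ x, walkSum
      (fun y L => if y = x then (L.map fun e => v e ω).prod else 0) t x [] := fun ω => by
    rw [Matrix.trace]
    refine Finset.sum_congr rfl fun x _ => ?_
    rw [walkSum_prod]
    simp
  have hint : ∀ x y : V × V, ∀ L : List (I × V × V),
      Integrable (fun ω => if y = x then (L.map fun e => v e ω).prod else 0) μ := fun x y L => by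
    split_ifs
    · exact integrable_list_prod hm hb L
    · exact integrable_zero _ _ _
  simp only [htr]
  refine ⟨integrable_finsetSum _ fun x _ => (integral_walkSum (hint x) t x []).1, ?_⟩
  rw [integral_finsetSum _ fun x _ => (integral_walkSum (hint x) t x []).1]
  have hx : ∀ x : V × V, ∫ ω, walkSum (fun y L => if y = x then (L.map fun e => v e ω).prod else 0)
      t x [] ∂μ ≤ (q ^ 2 * (2 * t) ^ 2) ^ t := fun x => by
    rw [(integral_walkSum (hint x) t x []).2]
    calc _ ≤ walkSum (fun _ L => q ^ (2 * t) * a ^ L.toFinset.card) t x [] := by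
          -- The condition that the walk returns to x is given up; only an upper bound over all
          -- walks is needed.
          refine walkSum_mono (n := 2 * t) (by simp) fun y L hL => ?_
          split_ifs
          · rw [← hL]
            exact (le_abs_self _).trans (abs_integral_prod_le hm hi hb hq ha h1 h2 L)
          · rw [integral_zero]
            have := pow_nonneg ha L.toFinset.card
            positivity
      _ = q ^ (2 * t) * walkSum (fun _ L => a ^ L.toFinset.card) t x [] := walkSum_const_mul _ _ _ _ _
      _ ≤ q ^ (2 * t) * (((2 * t : ℕ) : ℝ) ^ 2) ^ t := by
          gcongr
          simpa using walkSum_pow_card_le ha hV hI t x [] (b := 2 * t) (by simp)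
      _ = _ := by rw [pow_mul q, ← mul_pow]; push_cast; rfl
  calc _ ≤ ∑ _x : V × V, (q ^ 2 * (2 * t) ^ 2) ^ t := Finset.sum_le_sum fun x _ => hx x
    _ = _ := by simp

end moments

/-! ## The certificate exists with high probability -/

theorem one_le_log_of_three_le {n : ℕ} (hn : 3 ≤ n) : 1 ≤ Real.log n := by
  rw [Real.le_log_iff_exp_le (by positivity)]
  have : (3 : ℝ) ≤ n := by exact_mod_cast hn
  linarith [Real.exp_one_lt_d9]

theorem size_add_two_le_log {n : ℕ} (hn : 3 ≤ n) : ((n.size + 2 : ℕ) : ℝ) ≤ 9 / 2 * Real.log n := by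
  have h1 := one_le_log_of_three_le hn
  have hs : 0 < n.size := Nat.size_pos.2 (by omega)
  have h2 : 2 ^ (n.size - 1) ≤ n := Nat.lt_size.1 (by omega)
  have h3 : ((n.size - 1 : ℕ) : ℝ) * Real.log 2 ≤ Real.log n := by
    rw [← Real.log_pow]
    exact Real.log_le_log (by positivity) (by exact_mod_cast h2)
  have h4 : ((n.size + 2 : ℕ) : ℝ) = ((n.size - 1 : ℕ) : ℝ) + 3 := by
    rw [Nat.cast_sub (by omega)]; push_cast; ring
  have h5 : (0 : ℝ) ≤ ((n.size - 1 : ℕ) : ℝ) := by positivity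
  have h6 := Real.log_two_gt_d9
  rw [h4]
  -- Uses 1 / log 2 + 3 < 9/2 together with 1 ≤ log n.
  nlinarith

theorem two_pow_levels_le_log {n : ℕ} (hn : 3 ≤ n) :
    ((2 ^ levels n : ℕ) : ℝ) ≤ 9 * Real.log n := by
  have h : ((2 ^ levels n : ℕ) : ℝ) ≤ ((2 * (n.size + 2) : ℕ) : ℝ) := by
    exact_mod_cast two_pow_levels_le n
  have := size_add_two_le_log hn
  push_cast at *
  linarith

/-- The lower bound on the trace exponent t: it gives n^k ≤ (2^k)^t, so the dimension costs only a
factor 2^k per step. -/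
theorem le_two_pow_two_pow_levels (n : ℕ) : n ≤ 2 ^ 2 ^ levels n := by
  have h1 : n.size ≤ 2 ^ levels n := by
    have := Nat.le_pow_clog (b := 2) (by norm_num) (n.size + 2)
    unfold levels
    omega
  exact (Nat.lt_size_self n).le.trans (Nat.pow_le_pow_right (by norm_num) h1)

theorem pairMatrix_const_mul {I V R : Type*} [Fintype I] [DecidableEq V] [CommRing R] (c : R)
    (z : I × V × V → R) : pairMatrix (fun e => c * z e) = c ^ 2 • pairMatrix z := by
  ext x y
  simp only [pairMatrix, Matrix.smul_apply, smul_eq_mul, mul_ite, mul_zero, Finset.mul_sum]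
  split_ifs
  · rfl
  · exact Finset.sum_congr rfl fun i _ => by ring

theorem trace_pow_unflatten {r N : ℕ} (z : ℕ → ℤ) (v : Fin r × Fin N × Fin N → ℝ) (R : ℝ)
    (h : ∀ e, (unflatten (R := ℤ) r N z e : ℝ) = R * v e) (t : ℕ) :
    ((pairMatrix (unflatten r N z) ^ t).trace : ℝ) = (R ^ 2) ^ t * (pairMatrix v ^ t).trace := by
  have hmap : (pairMatrix (unflatten r N z)).map (Int.castRingHom ℝ) =
      pairMatrix (fun e => R * v e) := by
    ext x y
    simp only [pairMatrix, Matrix.map_apply, ← h]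
    split <;> simp
  have h1 : ((pairMatrix (unflatten r N z) ^ t).trace : ℝ) =
      (pairMatrix (fun e => R * v e) ^ t).trace := by
    rw [← hmap, ← RingHom.mapMatrix_apply, ← map_pow, RingHom.mapMatrix_apply,
      ← AddMonoidHom.map_trace]
    rfl
  rw [h1, pairMatrix_const_mul, smul_pow, Matrix.trace_smul, smul_eq_mul]

/-! ### Markov bounds for the two inequalities of the certificate -/

section

variable {Ω : Type*} [MeasurableSpace Ω] {μ : Measure Ω}

theorem measure_le_div_of_integral_le {f : Ω → ℝ} (hf0 : 0 ≤ᵐ[μ] f) (hf : Integrable f μ)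
    {x B : ℝ} (hx : 0 < x) (hB : ∫ ω, f ω ∂μ ≤ B) : μ.real {ω | x ≤ f ω} ≤ B / x := by
  rw [le_div_iff₀ hx, mul_comm]
  exact (mul_meas_ge_le_integral_of_nonneg hf0 hf x).trans hB

variable [IsProbabilityMeasure μ]

/-- Markov's inequality for the t-th power: the ratio of the bases is at most 4^(-k), the prefactor
N² is at most n^k ≤ 2^(kt), and 2^(-kt) ≤ n^(-k) ≤ 1/n. -/
theorem measure_trace_ge_le {c m n : ℕ} (hm : 1 ≤ m) (hn : 3 ≤ n) {ρ p H : ℝ}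
    (hρ : 0 < ρ) (hρ2 : ρ ^ 2 = (n : ℝ) ^ (c + m + m)) (hp : ρ⁻¹ ≤ p)
    (hH : 256 ^ (c + m + m) * p * ρ ^ 3 * Real.log n ^ 3 ≤ H)
    {v : Fin (n ^ c) × Fin (n ^ m) × Fin (n ^ m) → Ω → ℝ} (hmv : ∀ e, Measurable (v e))
    (hi : iIndepFun v μ) (hb : ∀ e, ∀ᵐ ω ∂μ, |v e ω| ≤ 1) (h1 : ∀ e, ∫ ω, |v e ω| ∂μ ≤ p)
    (h2 : ∀ e, |∫ ω, v e ω ∂μ| ≤ ρ⁻¹) :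
    μ.real {ω | (H / (2 * ρ ^ 2)) ^ 2 ^ levels n ≤
      (pairMatrix (fun e => v e ω) ^ 2 ^ levels n).trace} ≤ 1 / n := by
  set k := c + m + m with hk
  set t := 2 ^ levels n with ht
  have hn0 : (0 : ℝ) < n := by positivity
  have hn1 : (1 : ℝ) ≤ n := by exact_mod_cast (by omega : 1 ≤ n)
  have hp0 : 0 < p := (inv_pos.2 hρ).trans_le hp
  have hq0 : 0 ≤ p * ρ := by positivity
  have hq1 : 1 ≤ √(p * ρ) := by
    rw [Real.one_le_sqrt]
    calc 1 = ρ⁻¹ * ρ := (inv_mul_cancel₀ hρ.ne').symm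
      _ ≤ p * ρ := by gcongr
  have hqa : √(p * ρ) ^ 2 * ρ⁻¹ = p := by
    rw [Real.sq_sqrt hq0, mul_assoc, mul_inv_cancel₀ hρ.ne', mul_one]
  have hNρ : (n : ℝ) ^ m ≤ ρ := by
    refine (pow_le_pow_iff_left₀ (by positivity) hρ.le two_ne_zero).1 ?_
    rw [hρ2, ← pow_mul]
    exact pow_le_pow_right₀ hn1 (by omega)
  obtain ⟨hint, hle⟩ := integral_trace_pow_le hmv hi hb hq1 (inv_nonneg.2 hρ.le)
    (fun e => by rw [hqa]; exact h1 e) h2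
    (by
      rw [Fintype.card_fin, ← div_eq_mul_inv, div_le_one hρ]
      exact_mod_cast hNρ)
    (by
      rw [Fintype.card_fin, Fintype.card_fin, inv_pow, hρ2, ← div_eq_mul_inv,
        div_le_one (by positivity)]
      push_cast
      rw [← pow_add, ← pow_add, hk, add_assoc]) t
  have hl := one_le_log_of_three_le hn
  have htl : (t : ℝ) ≤ 9 * Real.log n := two_pow_levels_le_log hn
  have hH0 : 0 < H := lt_of_lt_of_le (by positivity) hH
  refine (measure_le_div_of_integral_le (.of_forall fun ω => ?_) hint (by positivity) hle).trans ?_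
  · exact (pairMatrix_isSymm _).trace_pow_nonneg (Nat.clog_pos (by norm_num) (by omega))
  rw [Fintype.card_fin, Real.sq_sqrt hq0, mul_div_assoc, ← div_pow]
  -- With t ≤ 9 log n one has 8t² ≤ 648 (log n)², and 648 ≤ 64² ≤ 64^k since k ≥ 2. The
  -- factorisation 256 = 64 · 4 leaves the required 4^k.
  have hratio : p * ρ * (2 * t) ^ 2 / (H / (2 * ρ ^ 2)) ≤ ((4 : ℝ) ^ k)⁻¹ := by
    rw [div_div_eq_mul_div, div_le_iff₀ hH0, inv_mul_eq_div, le_div_iff₀ (by positivity)]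
    have h64 : (4096 : ℝ) ≤ 64 ^ k := by
      calc (4096 : ℝ) = 64 ^ 2 := by norm_num
        _ ≤ 64 ^ k := pow_le_pow_right₀ (by norm_num) (by omega)
    have h256 : (256 : ℝ) ^ k = 64 ^ k * 4 ^ k := by rw [← mul_pow]; norm_num
    have ht2 : (t : ℝ) ^ 2 ≤ (9 * Real.log n) ^ 2 := pow_le_pow_left₀ (by positivity) htl 2
    have hl3 : Real.log n ^ 2 ≤ Real.log n ^ 3 := pow_le_pow_right₀ hl (by norm_num)
    calc p * ρ * (2 * t) ^ 2 * (2 * ρ ^ 2) * 4 ^ k = (8 * t ^ 2) * (4 ^ k * p * ρ ^ 3) := by ring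
      _ ≤ (64 ^ k * Real.log n ^ 3) * (4 ^ k * p * ρ ^ 3) := by
          refine mul_le_mul_of_nonneg_right ?_ (by positivity)
          nlinarith [pow_pos (zero_lt_one.trans_le hl) 3]
      _ = 256 ^ k * p * ρ ^ 3 * Real.log n ^ 3 := by rw [h256]; ring
      _ ≤ H := hH
  have hnt : (n : ℝ) ^ k ≤ (2 ^ k) ^ t := by
    rw [← pow_mul, mul_comm, pow_mul]
    exact pow_le_pow_left₀ hn0.le (by exact_mod_cast le_two_pow_two_pow_levels n) k
  have hNN : ((n ^ m : ℕ) : ℝ) * ((n ^ m : ℕ) : ℝ) ≤ (n : ℝ) ^ k := by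
    push_cast
    rw [← pow_add]
    exact pow_le_pow_right₀ hn1 (by omega)
  calc _ ≤ (n : ℝ) ^ k * (((4 : ℝ) ^ k)⁻¹) ^ t := by
        refine mul_le_mul hNN (pow_le_pow_left₀ ?_ hratio t) (by positivity) (by positivity)
        positivity
    _ ≤ (2 ^ k) ^ t * (((4 : ℝ) ^ k)⁻¹) ^ t := by gcongr
    _ = 1 / (2 ^ k) ^ t := by
        have h4 : (4 : ℝ) ^ k = 2 ^ k * 2 ^ k := by rw [← mul_pow]; norm_num
        rw [← mul_pow, h4, mul_inv, ← mul_assoc, mul_inv_cancel₀ (by positivity), one_mul, inv_pow,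
          one_div]
    _ ≤ 1 / n := by
        refine one_div_le_one_div_of_le hn0 (le_trans ?_ hnt)
        exact le_self_pow₀ hn1 (by omega)

/-- Markov's inequality compares the mean, at most ρ²p, with a threshold of at least ρ³p / (2n^c).
What is gained is ρ / n^c ≥ √n, because 2c + 1 ≤ c + 2m. -/
theorem measure_sum_sq_ge_le {c m n : ℕ} (hc : c ≤ 1) (hm : 1 ≤ m) (hn : 3 ≤ n) {ρ p H : ℝ}
    (hρ : 0 < ρ) (hρ2 : ρ ^ 2 = (n : ℝ) ^ (c + m + m)) (hp : ρ⁻¹ ≤ p)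
    (hH : 256 ^ (c + m + m) * p * ρ ^ 3 * Real.log n ^ 3 ≤ H)
    {v : Fin (n ^ c) × Fin (n ^ m) × Fin (n ^ m) → Ω → ℝ} (hmv : ∀ e, Measurable (v e))
    (hb : ∀ e, ∀ᵐ ω ∂μ, |v e ω| ≤ 1) (h1 : ∀ e, ∫ ω, |v e ω| ∂μ ≤ p) :
    μ.real {ω | H / (2 * n ^ c) ≤ ∑ e, v e ω ^ 2} ≤ 2 / √n := by
  have hn0 : (0 : ℝ) < n := by positivity
  have hn1 : (1 : ℝ) ≤ n := by exact_mod_cast (by omega : 1 ≤ n)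
  have hp0 : 0 < p := (inv_pos.2 hρ).trans_le hp
  have hl := one_le_log_of_three_le hn
  have hH0 : 0 < H := lt_of_lt_of_le (by positivity) hH
  have hint : ∀ e, Integrable (fun ω => v e ω ^ 2) μ := fun e => by
    refine .of_bound ((hmv e).pow_const 2).aestronglyMeasurable 1 ?_
    filter_upwards [hb e] with ω hω
    rw [Real.norm_eq_abs, abs_pow]
    exact pow_le_one₀ (abs_nonneg _) hω
  have hsq : ∀ e, ∫ ω, v e ω ^ 2 ∂μ ≤ p := fun e => by
    refine le_trans (integral_mono_of_nonneg (.of_forall fun ω => sq_nonneg _)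
      (Integrable.of_bound (hmv e).aestronglyMeasurable 1 (hb e)).abs ?_) (h1 e)
    filter_upwards [hb e] with ω hω
    rw [← sq_abs]
    exact pow_le_of_le_one (abs_nonneg _) hω (by norm_num)
  have hsum : ∫ ω, ∑ e, v e ω ^ 2 ∂μ ≤ ρ ^ 2 * p := by
    rw [integral_finsetSum _ fun e _ => hint e]
    refine (Finset.sum_le_card_nsmul _ _ p fun e _ => hsq e).trans (le_of_eq ?_)
    rw [Finset.card_univ, Fintype.card_prod, Fintype.card_prod, Fintype.card_fin, Fintype.card_fin,
      nsmul_eq_mul, hρ2]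
    push_cast
    rw [← pow_add, ← pow_add, add_assoc]
  refine (measure_le_div_of_integral_le (.of_forall fun ω =>
    Finset.sum_nonneg fun e _ => sq_nonneg _) (integrable_finsetSum _ fun e _ => hint e)
    (by positivity) hsum).trans ?_
  have hs0 : 0 < √(n : ℝ) := Real.sqrt_pos.2 hn0
  have hcs : (n : ℝ) ^ c * √n ≤ ρ := by
    refine (pow_le_pow_iff_left₀ (by positivity) hρ.le two_ne_zero).1 ?_
    rw [hρ2, mul_pow, Real.sq_sqrt hn0.le, ← pow_mul, ← pow_succ]
    exact pow_le_pow_right₀ hn1 (by omega)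
  rw [div_div_eq_mul_div, div_le_div_iff₀ hH0 hs0]
  calc ρ ^ 2 * p * (2 * n ^ c) * √n = 2 * (ρ ^ 2 * p * ((n : ℝ) ^ c * √n)) := by ring
    _ ≤ 2 * (ρ ^ 2 * p * ρ) := by gcongr
    _ = 2 * (1 * p * ρ ^ 3 * 1 ) := by ring
    _ ≤ 2 * (256 ^ (c + m + m) * p * ρ ^ 3 * Real.log n ^ 3) := by
        gcongr
        · exact one_le_pow₀ (by norm_num)
        · exact one_le_pow₀ hl
    _ ≤ 2 * H := by gcongr

/-- R is the common denominator that makes the entries integral. The bound θ may be random, as it is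
for k-XOR, so the event includes the condition that it reaches the deterministic level θ₀. -/
theorem measure_not_certified_le {c m n : ℕ} (hc : c ≤ 1) (hm : 1 ≤ m) (hn : 3 ≤ n)
    {ρ p R θ₀ : ℝ} (hρ : 0 < ρ) (hρ2 : ρ ^ 2 = (n : ℝ) ^ (c + m + m)) (hp : ρ⁻¹ ≤ p) (hR : 0 < R)
    (hθ₀ : 0 ≤ θ₀) (hθ : R ^ 2 * (256 ^ (c + m + m) * p * ρ ^ 3 * Real.log n ^ 3) ≤ θ₀ ^ 2)
    {Z : Ω → ℕ → ℤ} {θ : Ω → ℤ} {v : Fin (n ^ c) × Fin (n ^ m) × Fin (n ^ m) → Ω → ℝ}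
    (hZ : ∀ ω e, (unflatten (R := ℤ) (n ^ c) (n ^ m) (Z ω) e : ℝ) = R * v e ω)
    (hmv : ∀ e, Measurable (v e)) (hi : iIndepFun v μ) (hb : ∀ e, ∀ᵐ ω ∂μ, |v e ω| ≤ 1)
    (h1 : ∀ e, ∫ ω, |v e ω| ∂μ ≤ p) (h2 : ∀ e, |∫ ω, v e ω ∂μ| ≤ ρ⁻¹) :
    μ.real {ω | θ₀ ≤ θ ω ∧ ¬ Certified n (n ^ c) (n ^ m) (Z ω) (θ ω)} ≤ 3 / √n := by
  have hn0 : (0 : ℝ) < n := by positivity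
  have hn1 : (1 : ℝ) ≤ n := by exact_mod_cast (by omega : 1 ≤ n)
  set H := θ₀ ^ 2 / R ^ 2 with hHdef
  have hH : 256 ^ (c + m + m) * p * ρ ^ 3 * Real.log n ^ 3 ≤ H := by
    rw [hHdef, le_div_iff₀ (by positivity), mul_comm]; exact hθ
  have hHR : θ₀ ^ 2 = R ^ 2 * H := by rw [hHdef]; field_simp
  have hH0 : 0 ≤ H := by positivity
  set t := 2 ^ levels n with ht
  have hsub : {ω | θ₀ ≤ θ ω ∧ ¬ Certified n (n ^ c) (n ^ m) (Z ω) (θ ω)} ⊆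
      {ω | (H / (2 * ρ ^ 2)) ^ t ≤ (pairMatrix (fun e => v e ω) ^ t).trace} ∪
      {ω | H / (2 * n ^ c) ≤ ∑ e, v e ω ^ 2} := by
    rintro ω ⟨h0, hC⟩
    by_contra hcon
    rw [Set.mem_union, not_or] at hcon
    obtain ⟨hc1, hc2⟩ := hcon
    simp only [Set.mem_ofPred_eq, not_le] at hc1 hc2
    apply hC
    have hsq : R ^ 2 * H ≤ (θ ω : ℝ) ^ 2 := by
      rw [← hHR]; exact pow_le_pow_left₀ hθ₀ h0 2
    rw [certified_iff]
    refine ⟨by exact_mod_cast hθ₀.trans h0, ?_, ?_⟩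
    · have : (2 : ℝ) * n ^ c * ∑ e, (unflatten (R := ℤ) (n ^ c) (n ^ m) (Z ω) e : ℝ) ^ 2 ≤
        (θ ω : ℝ) ^ 2 := by
        simp only [hZ, mul_pow, ← Finset.mul_sum]
        rw [lt_div_iff₀ (by positivity)] at hc2
        refine le_trans ?_ hsq
        nlinarith [sq_nonneg R]
      exact_mod_cast this
    · have : ((2 : ℝ) * n ^ c * (n ^ m * n ^ m)) ^ t *
          ((pairMatrix (unflatten (n ^ c) (n ^ m) (Z ω)) ^ t).trace : ℝ) ≤ ((θ ω : ℝ) ^ 2) ^ t := by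
        rw [trace_pow_unflatten _ _ R (hZ ω)]
        have hd : (2 : ℝ) * n ^ c * (n ^ m * n ^ m) = 2 * ρ ^ 2 := by
          rw [hρ2, mul_assoc, ← pow_add, ← pow_add, add_assoc]
        rw [hd]
        calc (2 * ρ ^ 2) ^ t * ((R ^ 2) ^ t * (pairMatrix (fun e => v e ω) ^ t).trace)
            ≤ (2 * ρ ^ 2) ^ t * ((R ^ 2) ^ t * (H / (2 * ρ ^ 2)) ^ t) := by gcongr
          _ = (R ^ 2 * H) ^ t := by
              rw [← mul_pow, ← mul_pow]
              congr 1
              field_simp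
          _ ≤ _ := by gcongr
      exact_mod_cast this
  refine (measureReal_mono hsub).trans ((measureReal_union_le _ _).trans ?_)
  have e1 := measure_trace_ge_le hm hn hρ hρ2 hp hH hmv hi hb h1 h2
  have e2 := measure_sum_sq_ge_le hc hm hn hρ hρ2 hp hH hmv hb h1
  have e3 : 1 / (n : ℝ) ≤ 1 / √n := by
    refine one_div_le_one_div_of_le (Real.sqrt_pos.2 hn0) ?_
    rw [Real.sqrt_le_left hn0.le]
    exact le_self_pow₀ hn1 (by norm_num)
  calc _ ≤ 1 / √n + 2 / √n := add_le_add (e1.trans e3) e2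
    _ = 3 / √n := by ring

end

/-! ## Tensors on `[n] ^ (c + m + m)` as three-dimensional arrays -/

/-- Cuts a tuple into three pieces, and encodes each of them by a number. -/
def splitEquiv (c m n : ℕ) :
    (Fin (c + m + m) → Fin n) ≃ Fin (n ^ c) × Fin (n ^ m) × Fin (n ^ m) :=
  (Fin.appendEquiv (c + m) m).symm.trans <|
    ((Fin.appendEquiv c m).symm.prodCongr (Equiv.refl _)).trans <|
      (Equiv.prodAssoc _ _ _).trans <|
        finFunctionFinEquiv.prodCongr (finFunctionFinEquiv.prodCongr finFunctionFinEquiv)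

section

variable {c m n : ℕ}

theorem splitEquiv_apply (T : Fin (c + m + m) → Fin n) : splitEquiv c m n T =
    (finFunctionFinEquiv fun i => T (Fin.castAdd m (Fin.castAdd m i)),
      finFunctionFinEquiv fun i => T (Fin.castAdd m (Fin.natAdd c i)),
      finFunctionFinEquiv fun i => T (Fin.natAdd (c + m) i)) := rfl

/-- The base-n code has its least significant digit first, so the code of T is already the array
index of its three pieces and the input needs no rearrangement. -/
theorem finFunctionFinEquiv_eq_splitEquiv (T : Fin (c + m + m) → Fin n) :
    (finFunctionFinEquiv T : ℕ) = (splitEquiv c m n T).1 +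
      n ^ c * ((splitEquiv c m n T).2.1 + n ^ m * (splitEquiv c m n T).2.2) := by
  simp only [splitEquiv_apply, finFunctionFinEquiv_apply, Fin.sum_univ_add, Fin.val_castAdd,
    Fin.val_natAdd, pow_add, Finset.mul_sum, mul_add]
  rw [← add_assoc]
  refine congrArg₂ _ (congrArg₂ _ rfl ?_) ?_ <;>
  exact Finset.sum_congr rfl fun i _ => by ring

theorem prod_eq_splitEquiv (T : Fin (c + m + m) → Fin n) (x : Fin n → ℝ) :
    ∏ i, x (T i) = (∏ i, x (finFunctionFinEquiv.symm (splitEquiv c m n T).1 i)) *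
      ((∏ i, x (finFunctionFinEquiv.symm (splitEquiv c m n T).2.1 i)) *
        ∏ i, x (finFunctionFinEquiv.symm (splitEquiv c m n T).2.2 i)) := by
  simp only [splitEquiv_apply, Equiv.symm_apply_apply, Fin.prod_univ_add]
  ring

theorem unflatten_splitEquiv {R : Type*} (Z : ℕ → R) (T : Fin (c + m + m) → Fin n) :
    unflatten (n ^ c) (n ^ m) Z (splitEquiv c m n T) = Z (finFunctionFinEquiv T) := by
  rw [finFunctionFinEquiv_eq_splitEquiv]; rfl

theorem abs_prod_le_one {ι α : Type*} [Fintype ι] {x : α → ℝ} (hx : ∀ i, |x i| ≤ 1) (f : ι → α) :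
    |∏ i, x (f i)| ≤ 1 := by
  rw [Finset.abs_prod]
  exact Finset.prod_le_one (fun i _ => abs_nonneg _) fun i _ => hx _

theorem Certified.abs_tensor_sum_le {Z : ℕ → ℤ} {θ : ℤ}
    (h : Certified n (n ^ c) (n ^ m) Z θ) {x : Fin n → ℝ} (hx : ∀ i, |x i| ≤ 1) :
    |∑ T : Fin (c + m + m) → Fin n, (Z (finFunctionFinEquiv T) : ℝ) * ∏ i, x (T i)| ≤ θ := by
  have h1 := abs_sum_le_of_certified h
    (y := fun j => ∏ i, x (finFunctionFinEquiv.symm j i))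
    (u := fun j => ∏ i, x (finFunctionFinEquiv.symm j i))
    (fun j => abs_prod_le_one hx _) (fun j => abs_prod_le_one hx _)
  rw [← (splitEquiv c m n).sum_comp] at h1
  convert h1 using 4 with T
  · rw [unflatten_splitEquiv]
  · exact prod_eq_splitEquiv T x

theorem measure_tensor_not_certified_le {Ω : Type*} [MeasurableSpace Ω] {μ : Measure Ω}
    [IsProbabilityMeasure μ] (hc : c ≤ 1) (hm : 1 ≤ m) (hn : 3 ≤ n)
    {ρ p R θ₀ : ℝ} (hρ : 0 < ρ) (hρ2 : ρ ^ 2 = (n : ℝ) ^ (c + m + m)) (hp : ρ⁻¹ ≤ p) (hR : 0 < R)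
    (hθ₀ : 0 ≤ θ₀) (hθ : R ^ 2 * (256 ^ (c + m + m) * p * ρ ^ 3 * Real.log n ^ 3) ≤ θ₀ ^ 2)
    {Z : Ω → ℕ → ℤ} {θ : Ω → ℤ} {v : (Fin (c + m + m) → Fin n) → Ω → ℝ}
    (hZ : ∀ ω T, (Z ω (finFunctionFinEquiv T) : ℝ) = R * v T ω)
    (hmv : ∀ T, Measurable (v T)) (hi : iIndepFun v μ) (hb : ∀ T, ∀ᵐ ω ∂μ, |v T ω| ≤ 1)
    (h1 : ∀ T, ∫ ω, |v T ω| ∂μ ≤ p) (h2 : ∀ T, |∫ ω, v T ω ∂μ| ≤ ρ⁻¹) :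
    μ.real {ω | θ₀ ≤ θ ω ∧ ¬ Certified n (n ^ c) (n ^ m) (Z ω) (θ ω)} ≤ 3 / √n := by
  refine measure_not_certified_le hc hm hn hρ hρ2 hp hR hθ₀ hθ
    (v := fun e => v ((splitEquiv c m n).symm e)) (fun ω e => ?_) (fun e => hmv _)
    (hi.precomp (splitEquiv c m n).symm.injective) (fun e => hb _) (fun e => h1 _) (fun e => h2 _)
  have h := unflatten_splitEquiv (Z ω) ((splitEquiv c m n).symm e)
  rw [Equiv.apply_symm_apply] at h
  rw [h, hZ]

end

/-- The value 1 makes the claim trivial for n < 3, where 1 ≤ log n fails. -/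
theorem tendsto_ite_div_sqrt (a : ℝ) :
    Tendsto (fun n : ℕ => if n < 3 then (1 : ℝ) else a / √n) atTop (𝓝 0) := by
  have h : Tendsto (fun n : ℕ => a / √(n : ℝ)) atTop (𝓝 0) :=
    tendsto_const_nhds.div_atTop (Real.tendsto_sqrt_atTop.comp tendsto_natCast_atTop_atTop)
  refine h.congr' ?_
  filter_upwards [eventually_ge_atTop 3] with n hn
  rw [if_neg (by omega)]

theorem exists_eq_add_add {k : ℕ} (hk : 2 ≤ k) : ∃ c m, c ≤ 1 ∧ 1 ≤ m ∧ k = c + m + m :=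
  ⟨k % 2, k / 2, by omega, by omega, by omega⟩

theorem pow_mul_pow_mul_pow (n c m : ℕ) : n ^ c * (n ^ m * n ^ m) = n ^ (c + m + m) := by
  rw [← pow_add, ← pow_add, add_assoc]

theorem rpow_half_sq (x : ℝ) (hx : 0 ≤ x) (k : ℕ) : (x ^ ((k : ℝ) / 2)) ^ 2 = x ^ k := by
  rw [← Real.rpow_natCast, ← Real.rpow_mul hx, ← Real.rpow_natCast]
  congr 1
  push_cast
  ring

theorem sq_sqrt_mul_rpow_mul_rpow {p x l : ℝ} (hp : 0 ≤ p) (hx : 0 ≤ x) (hl : 0 ≤ l) (k : ℕ) :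
    (√p * x ^ (3 * (k : ℝ) / 4) * l ^ (3 / 2 : ℝ)) ^ 2 = p * (x ^ ((k : ℝ) / 2)) ^ 3 * l ^ 3 := by
  rw [mul_pow, mul_pow, Real.sq_sqrt hp, ← Real.rpow_natCast (x ^ _), ← Real.rpow_mul hx,
    ← Real.rpow_natCast (l ^ _), ← Real.rpow_mul hl, ← Real.rpow_natCast (x ^ _),
    ← Real.rpow_mul hx, ← Real.rpow_natCast l 3]
  congr 2
  · congr 1
    push_cast
    ring
  · norm_num

/-! ## Certification of polynomials with independent coefficients -/

section

variable {k : ℕ}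

/-- The `q`-th coefficient in the encoding. -/
def TensorInput.coeff (d : TensorInput k) (q : ℕ) : ℤ := d.encode.getD (3 + q) 0

/-- The bound for the integer coefficients. -/
def TensorInput.intBound (d : TensorInput k) : ℤ := d.scale * d.bound - (d.n ^ k : ℕ)

theorem TensorInput.coeff_finFunctionFinEquiv (d : TensorInput k) (T : Fin k → Fin d.n) :
    d.coeff (finFunctionFinEquiv T) = d.entry T := by
  have h : (List.ofFn fun j : Fin (d.n ^ k) => d.entry (finFunctionFinEquiv.symm j)).getD
      (finFunctionFinEquiv T) 0 = d.entry T := by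
    rw [List.getD_eq_getElem _ _ (by rw [List.length_ofFn]; exact (finFunctionFinEquiv T).2),
      List.getElem_ofFn]
    exact congrArg d.entry (finFunctionFinEquiv.symm_apply_apply T)
  rw [coeff, encode, add_comm]
  exact h

/-- The certificate for an input. -/
def TensorInput.IsCertified (c m : ℕ) (d : TensorInput k) : Prop :=
  Certified d.n (d.n ^ c) (d.n ^ m)
    (fun q => if q < d.n ^ c * (d.n ^ m * d.n ^ m) then d.coeff q else 0) d.intBound

open Classical in
theorem TensorInput.polyTime_isCertified {c m : ℕ} (hc : c ≤ 1) (hm : 1 ≤ m) :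
    PolyTime TensorInput.encode fun d : TensorInput (c + m + m) => decide (d.IsCertified c m) := by
  have hlen : ∀ d : TensorInput (c + m + m), d.n ^ c * (d.n ^ m * d.n ^ m) ≤ inputSize d.encode :=
    fun d => by
      refine le_trans ?_ (length_le_inputSize _)
      rw [pow_mul_pow_mul_pow]
      simp only [encode, List.length_cons, List.length_ofFn]
      omega
  have hpow : ∀ d : TensorInput (c + m + m), (2 : ℤ) ^ inputSize d.encode ≤
      2 ^ (2 * (inputSize d.encode + 1)) := fun d => pow_le_pow_right₀ (by norm_num) (by omega)
  -- The choice κ = 2 allows for the product of scale and bound. The offset 3 skips n, the scale and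
  -- the bound.
  refine polyTime_certified (κ := 2) hc hm (zE := .get 0 (.add (.lit 3) (.var 9))) (cE := .lit 0)
    (tE := .sub (.mul (.get 0 (.lit 1)) (.get 0 (.lit 2))) (.var 5)) (n := fun d => d.n)
    (Z := fun d => d.coeff) (C := fun _ _ => 0) (θ := fun d => d.intBound) (fun d => rfl)
    hlen (fun d q => (abs_getD_le_two_pow_inputSize _ _).trans (hpow d)) (fun d => by simp)
    (fun d => ?_) ?_ ?_
  · have h1 := abs_getD_le_two_pow_inputSize d.encode 1
    have h2 := abs_getD_le_two_pow_inputSize d.encode 2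
    have h3 : (d.n ^ (c + m + m) : ℕ) ≤ 2 ^ inputSize d.encode := by
      rw [← pow_mul_pow_mul_pow]
      exact (hlen d).trans Nat.lt_two_pow_self.le
    have h4 : |(d.scale : ℤ)| ≤ 2 ^ inputSize d.encode := h1
    have h5 : |d.bound| ≤ 2 ^ inputSize d.encode := h2
    have h6 : ((d.n ^ (c + m + m) : ℕ) : ℤ) ≤ 2 ^ inputSize d.encode := by exact_mod_cast h3
    have h7 : (1 : ℤ) ≤ 2 ^ inputSize d.encode := one_le_pow₀ (by norm_num)
    calc |d.intBound| ≤ |(d.scale : ℤ) * d.bound| + |((d.n ^ (c + m + m) : ℕ) : ℤ)| := abs_sub _ _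
      _ ≤ 2 ^ inputSize d.encode * 2 ^ inputSize d.encode + 2 ^ inputSize d.encode := by
          rw [abs_mul, abs_of_nonneg (Int.natCast_nonneg (d.n ^ (c + m + m)))]
          exact add_le_add (mul_le_mul h4 h5 (abs_nonneg _) (by positivity)) h6
      _ ≤ 2 ^ (2 * (inputSize d.encode + 1)) := by
          rw [show 2 * (inputSize d.encode + 1) =
            inputSize d.encode + inputSize d.encode + 2 by ring, pow_add, pow_add]
          nlinarith
  · intro d q s' hq h9 _ h0
    refine ⟨?_, rfl⟩
    simp only [AExp.value, h9, h0]
    rfl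
  · intro d s' h5 _ h0 _
    simp only [AExp.value, h0, h5, pow_mul_pow_mul_pow]
    rfl

theorem TensorInput.IsCertified.tensorPoly_le {c m : ℕ} {d : TensorInput (c + m + m)}
    (h : d.IsCertified c m) {w : (Fin (c + m + m) → Fin d.n) → ℝ} (hw : d.Represents w)
    {x : Fin d.n → ℝ} (hx : ‖x‖ ≤ 1) : tensorPoly w x ≤ d.bound := by
  have hx' : ∀ i, |x i| ≤ 1 := fun i => (norm_le_pi_norm x i).trans hx
  have hN : (0 : ℝ) < d.scale := by exact_mod_cast d.scale_pos
  have h1 := (le_abs_self _).trans (h.abs_tensor_sum_le hx')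
  have h2 : ∀ T : Fin (c + m + m) → Fin d.n,
      (if (finFunctionFinEquiv T : ℕ) < d.n ^ c * (d.n ^ m * d.n ^ m) then
        d.coeff (finFunctionFinEquiv T) else 0) = d.entry T := fun T => by
    rw [if_pos (by rw [pow_mul_pow_mul_pow]; exact (finFunctionFinEquiv T).2),
      d.coeff_finFunctionFinEquiv]
  simp only [h2] at h1
  -- After scaling, each coefficient is off by at most 1 and each monomial is at most 1 in absolute
  -- value: the n^k errors are what `intBound` subtracts.
  have h3 : d.scale * tensorPoly w x ≤ ∑ T, (d.entry T : ℝ) * ∏ i, x (T i) +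
      (d.n : ℝ) ^ (c + m + m) := by
    have h4 : ∀ T : Fin (c + m + m) → Fin d.n, d.scale * (w T * ∏ i, x (T i)) ≤
        d.entry T * ∏ i, x (T i) + 1 := fun T => by
      have h5 : |(d.scale * w T - d.entry T) * ∏ i, x (T i)| ≤ 1 := by
        rw [abs_mul]
        refine mul_le_one₀ ?_ (abs_nonneg _) (abs_prod_le_one hx' _)
        have := hw T
        rw [le_div_iff₀ hN] at this
        calc |d.scale * w T - d.entry T| = |w T - d.entry T / d.scale| * d.scale := by
              rw [← abs_of_pos hN, ← abs_mul, abs_of_pos hN]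
              congr 1
              field_simp
          _ ≤ 1 := this
      have := (le_abs_self _).trans h5
      linarith
    rw [tensorPoly, Finset.mul_sum]
    refine (Finset.sum_le_sum fun T _ => h4 T).trans (le_of_eq ?_)
    rw [Finset.sum_add_distrib]
    simp
  have h6 : (d.intBound : ℝ) = d.scale * d.bound - (d.n : ℝ) ^ (c + m + m) := by
    rw [intBound]; push_cast; rfl
  rw [h6] at h1
  exact le_of_mul_le_mul_left (by linarith) hN

end

/-! ### Rounded random coefficients -/

section

variable {Ω : Type*} [MeasurableSpace Ω] {μ : Measure Ω} [IsProbabilityMeasure μ]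

/-- Rounding down keeps the bound 1, as -N is an integer, and keeps zeros, hence sparsity. Only the
vanishing of the mean is lost. -/
theorem floor_mul_div_bounds {N : ℕ} (hN : 0 < N) {w : ℝ} :
    |(⌊N * w⌋ : ℝ) / N - w| ≤ 1 / N ∧ (|w| ≤ 1 → |(⌊N * w⌋ : ℝ) / N| ≤ 1) ∧
      (w = 0 → (⌊N * w⌋ : ℝ) / N = 0) := by
  have hN' : (0 : ℝ) < N := by exact_mod_cast hN
  have h1 := Int.floor_le ((N : ℝ) * w)
  have h2 := Int.lt_floor_add_one ((N : ℝ) * w)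
  refine ⟨?_, fun hw => ?_, fun hw => by simp [hw]⟩
  · rw [le_div_iff₀ hN', ← abs_of_pos hN', ← abs_mul, abs_of_pos hN', sub_mul,
      div_mul_cancel₀ _ hN'.ne', abs_le]
    constructor <;> linarith
  · rw [abs_div, abs_of_pos hN', div_le_one hN', abs_le]
    rw [abs_le] at hw
    constructor
    · have : (-(N : ℤ)) ≤ ⌊(N : ℝ) * w⌋ := by
        rw [Int.le_floor]; push_cast; nlinarith
      exact_mod_cast this
    · nlinarith

open Classical in
theorem measure_roundedInput_not_certified_le {c m n : ℕ} (hc : c ≤ 1) (hm : 1 ≤ m) (hn : 3 ≤ n)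
    {p : ℝ} (hp : (n : ℝ) ^ (-((c + m + m : ℕ) : ℝ) / 2) ≤ p)
    {w : (Fin (c + m + m) → Fin n) → Ω → ℝ} (hmw : ∀ T, Measurable (w T)) (hi : iIndepFun w μ)
    (h0 : ∀ T, ∫ ω, w T ω ∂μ = 0) (hwp : ∀ T, μ.real {ω | w T ω ≠ 0} ≤ p)
    (hb : ∀ T, ∀ᵐ ω ∂μ, |w T ω| ≤ 1) {N : ℕ} (hN : 0 < N) (hnN : n ^ (c + m + m) ≤ N) {θ : ℤ}
    (hθ : 32 ^ (c + m + m) * √p * (n : ℝ) ^ (3 * ((c + m + m : ℕ) : ℝ) / 4) *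
      Real.log n ^ (3 / 2 : ℝ) ≤ θ) :
    μ.real {ω | ¬ (roundedInput (fun T => w T ω) N hN θ).IsCertified c m} ≤ 3 / √n := by
  have h256 : ((16 : ℝ) ^ (c + m + m)) ^ 2 = 256 ^ (c + m + m) := by
    rw [← pow_mul, mul_comm, pow_mul]; norm_num
  have hn0 : (0 : ℝ) < n := by positivity
  have hn1 : (1 : ℝ) ≤ n := by exact_mod_cast (by omega : 1 ≤ n)
  have hN' : (0 : ℝ) < N := by exact_mod_cast hN
  have hl := one_le_log_of_three_le hn
  set ρ : ℝ := (n : ℝ) ^ (((c + m + m : ℕ) : ℝ) / 2) with hρdef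
  have hρ : 0 < ρ := Real.rpow_pos_of_pos hn0 _
  have hρ2 : ρ ^ 2 = (n : ℝ) ^ (c + m + m) := rpow_half_sq _ hn0.le (c + m + m)
  have hρ1 : 1 ≤ ρ := Real.one_le_rpow hn1 (by positivity)
  have hpρ : ρ⁻¹ ≤ p := by
    rw [hρdef, ← Real.rpow_neg hn0.le, ← neg_div]; exact hp
  have hp0 : 0 < p := (inv_pos.2 hρ).trans_le hpρ
  set Y : ℝ := √p * (n : ℝ) ^ (3 * ((c + m + m : ℕ) : ℝ) / 4) * Real.log n ^ (3 / 2 : ℝ) with hY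
  have hY2 : Y ^ 2 = p * ρ ^ 3 * Real.log n ^ 3 :=
    sq_sqrt_mul_rpow_mul_rpow hp0.le hn0.le (by linarith) (c + m + m)
  have hY0 : 0 ≤ Y := by positivity
  have hY1 : 1 ≤ Y := by
    rw [← one_le_sq_iff₀ hY0, hY2]
    have h1 : 1 ≤ p * ρ ^ 3 := by
      calc (1 : ℝ) = ρ⁻¹ * ρ := (inv_mul_cancel₀ hρ.ne').symm
        _ ≤ p * ρ ^ 3 := mul_le_mul hpρ (le_self_pow₀ hρ1 (by norm_num)) hρ.le hp0.le
    exact one_le_mul_of_one_le_of_one_le h1 (one_le_pow₀ hl)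
  set v : (Fin (c + m + m) → Fin n) → Ω → ℝ := fun T ω => (⌊N * w T ω⌋ : ℝ) / N with hv
  have hfm : Measurable fun x : ℝ => (⌊N * x⌋ : ℝ) / N := by fun_prop
  have hmv : ∀ T, Measurable (v T) := fun T => hfm.comp (hmw T)
  have hiv : iIndepFun v μ := hi.comp (fun _ x => (⌊N * x⌋ : ℝ) / N) fun _ => hfm
  have hbv : ∀ T, ∀ᵐ ω ∂μ, |v T ω| ≤ 1 := fun T => by
    filter_upwards [hb T] with ω hω
    exact (floor_mul_div_bounds hN).2.1 hω
  have hvint : ∀ T, Integrable (v T) μ := fun T => .of_bound (hmv T).aestronglyMeasurable 1 (hbv T)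
  have hwint : ∀ T, Integrable (w T) μ := fun T => .of_bound (hmw T).aestronglyMeasurable 1 (hb T)
  have h1 : ∀ T, ∫ ω, |v T ω| ∂μ ≤ p := fun T => by
    have hset : MeasurableSet {ω | w T ω ≠ 0} := (hmw T) (measurableSet_singleton 0).compl
    refine le_trans ?_ (hwp T)
    rw [← integral_indicator_one hset]
    refine integral_mono_of_nonneg (.of_forall fun ω => abs_nonneg _)
      ((integrable_const (1 : ℝ)).indicator hset) ?_
    filter_upwards [hbv T] with ω hω
    by_cases h : w T ω = 0
    · have : v T ω = 0 := (floor_mul_div_bounds hN).2.2 h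
      simp [this, h]
    · simpa [Set.indicator, h] using hω
  -- The bias from rounding is at most 1/N ≤ n^(-k) = ρ^(-2) ≤ ρ^(-1); this is where N ≥ n^k enters
  -- the moment bound.
  have h2 : ∀ T, |∫ ω, v T ω ∂μ| ≤ ρ⁻¹ := fun T => by
    have h3 : ∫ ω, v T ω ∂μ = ∫ ω, (v T ω - w T ω) ∂μ := by
      rw [integral_sub (hvint T) (hwint T), h0 T, sub_zero]
    have h4 : |∫ ω, (v T ω - w T ω) ∂μ| ≤ 1 / N := by
      have := norm_integral_le_of_norm_le_const (μ := μ) (f := fun ω => v T ω - w T ω)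
        (C := 1 / (N : ℝ)) (.of_forall fun ω => (floor_mul_div_bounds hN).1)
      simpa using this
    rw [h3]
    refine h4.trans ?_
    rw [one_div]
    refine inv_anti₀ hρ ?_
    calc ρ ≤ ρ ^ 2 := le_self_pow₀ hρ1 (by norm_num)
      _ = (n : ℝ) ^ (c + m + m) := hρ2
      _ ≤ N := by exact_mod_cast hnN
  have key := measure_tensor_not_certified_le (μ := μ) (θ₀ := N * (16 ^ (c + m + m) * Y)) (R := N)
    (Z := fun ω q => if q < n ^ c * (n ^ m * n ^ m) then
      (roundedInput (fun T => w T ω) N hN θ).coeff q else 0)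
    (θ := fun ω => (roundedInput (fun T => w T ω) N hN θ).intBound)
    hc hm hn hρ hρ2 hpρ hN' (by positivity) (le_of_eq ?_) (fun ω T => ?_) hmv hiv hbv h1 h2
  · suffices h : ∀ u : (Fin (c + m + m) → Fin n) → ℝ,
        (N : ℝ) * (16 ^ (c + m + m) * Y) ≤ (roundedInput u N hN θ).intBound by
      refine le_trans (measureReal_mono ?_) key
      exact fun ω hω => ⟨h _, hω⟩
    intro u
    have h5 : ∀ u : (Fin (c + m + m) → Fin n) → ℝ, ((roundedInput u N hN θ).intBound : ℝ) =
        N * θ - (n : ℝ) ^ (c + m + m) :=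
      fun u => by simp [TensorInput.intBound, roundedInput]
    have h6 : (n : ℝ) ^ (c + m + m) ≤ N := by exact_mod_cast hnN
    have h7 : 32 ^ (c + m + m) * Y ≤ θ := by
      rw [hY, ← mul_assoc, ← mul_assoc]; exact hθ
    -- The 16 is the square root of the 256 in the certificate bound. The spare 2^k ≥ 2 pays for the
    -- n^k ≤ N subtracted in `intBound`.
    have h8 : (32 : ℝ) ^ (c + m + m) = 2 ^ (c + m + m) * 16 ^ (c + m + m) := by
      rw [← mul_pow]; norm_num
    have h9 : (2 : ℝ) ≤ 2 ^ (c + m + m) := le_self_pow₀ (by norm_num) (by omega)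
    have h10 : (1 : ℝ) ≤ 16 ^ (c + m + m) * Y :=
      one_le_mul_of_one_le_of_one_le (one_le_pow₀ (by norm_num)) hY1
    have h11 : 2 * (16 ^ (c + m + m) * Y) ≤ 32 ^ (c + m + m) * Y := by
      rw [h8, mul_assoc]; gcongr
    rw [h5]
    nlinarith
  · rw [mul_pow, mul_pow, hY2, h256]
    ring
  · rw [if_pos (by rw [pow_mul_pow_mul_pow]; exact (finFunctionFinEquiv T).2)]
    have := (roundedInput (fun T => w T ω) N hN θ).coeff_finFunctionFinEquiv T
    simp only [hv]
    rw [mul_div_cancel₀ _ hN'.ne']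
    exact congrArg Int.cast this

end

/-! ## Instances of `k`-XOR as tensors -/

theorem AExp.value_foldr_add (s : Store) (l : List AExp) :
    (l.foldr AExp.add (.lit 0)).value s = (l.map (AExp.value s)).sum := by
  induction l with
  | nil => rfl
  | cons e l ih => simp [AExp.value, ih]

/-- Bits as signs. -/
noncomputable def bitSignEquiv : Fin 2 ≃ ℤˣ :=
  Equiv.ofBijective (fun b => (-1) ^ (b : ℕ)) (by decide)

/-- Numbers below `2 ^ k` as patterns of signs. -/
noncomputable def signEquiv (k : ℕ) : Fin (2 ^ k) ≃ (Fin k → ℤˣ) :=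
  finFunctionFinEquiv.symm.trans (Equiv.piCongrRight fun _ => bitSignEquiv)

section

variable {k n : ℕ}

/-- The number of constraints in the `q`-th scope, weighted by `s`, for an encoded instance. -/
noncomputable def scopeSum (s : (Fin k → ℤˣ) → ℤ) (d : (n : ℕ) × Instance k n) (q : ℕ) : ℤ :=
  ∑ a : Fin (2 ^ k), s (signEquiv k a) * (encodeInstance d).getD (1 + q + d.1 ^ k * a) 0

theorem getD_encodeInstance (I : Instance k n) (a : Fin (2 ^ k)) (S : Fin k → Fin n) :
    (encodeInstance ⟨n, I⟩).getD (1 + finFunctionFinEquiv S + n ^ k * a) 0 =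
      I (signEquiv k a, S) := by
  have h1 : 1 + (finFunctionFinEquiv S : ℕ) + n ^ k * a =
      (finProdFinEquiv (a, finFunctionFinEquiv S) : ℕ) + 1 := by
    rw [finProdFinEquiv_apply_val]; ring
  rw [h1, encodeInstance, List.getD_cons_succ,
    List.getD_eq_getElem _ _ (by rw [List.length_ofFn]; exact (finProdFinEquiv _).2),
    List.getElem_ofFn]
  simp only [Fin.eta, Equiv.symm_apply_apply]
  rfl

theorem scopeSum_finFunctionFinEquiv (s : (Fin k → ℤˣ) → ℤ) (I : Instance k n)
    (S : Fin k → Fin n) :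
    scopeSum s ⟨n, I⟩ (finFunctionFinEquiv S) = ∑ c, s c * I (c, S) := by
  simp only [scopeSum, getD_encodeInstance]
  exact (signEquiv k).sum_comp fun c => s c * (I (c, S) : ℤ)

/-- The expression that computes `scopeSum s`. -/
noncomputable def scopeExp (s : (Fin k → ℤˣ) → ℤ) : AExp :=
  ((List.finRange (2 ^ k)).map fun a => .mul (.lit (s (signEquiv k a)))
    (.get 0 (.add (.add (.lit 1) (.var 9)) (.mul (.var 5) (.lit (a : ℕ)))))).foldr .add (.lit 0)

theorem value_scopeExp (s : (Fin k → ℤˣ) → ℤ) (d : (n : ℕ) × Instance k n) {q : ℕ} {σ : Store}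
    (h9 : σ.var 9 = q) (h5 : σ.var 5 = (d.1 ^ k : ℕ))
    (h0 : ∀ j, σ.arr 0 j = (encodeInstance d).getD j 0) :
    (scopeExp s).value σ = scopeSum s d q := by
  rw [scopeExp, AExp.value_foldr_add, List.map_map, scopeSum, Fin.sum_univ_def]
  refine congrArg List.sum (List.map_congr_left fun a _ => ?_)
  simp only [Function.comp, AExp.value, h9, h5, h0]
  rfl

theorem abs_scopeSum_le {s : (Fin k → ℤˣ) → ℤ} (hs : ∀ c, |s c| ≤ 1)
    (d : (n : ℕ) × Instance k n) (q : ℕ) :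
    |scopeSum s d q| ≤ 2 ^ k * 2 ^ inputSize (encodeInstance d) := by
  refine (Finset.abs_sum_le_sum_abs _ _).trans ?_
  calc _ ≤ ∑ _a : Fin (2 ^ k), (2 : ℤ) ^ inputSize (encodeInstance d) :=
        Finset.sum_le_sum fun a _ => by
          rw [abs_mul]
          exact (mul_le_of_le_one_left (abs_nonneg _) (hs _)).trans
            (abs_getD_le_two_pow_inputSize _ _)
    _ = _ := by simp

/-- The product of the signs. -/
def signProd (c : Fin k → ℤˣ) : ℤ := (∏ i, c i : ℤˣ)

theorem abs_signProd (c : Fin k → ℤˣ) : |signProd c| = 1 := by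
  rw [signProd, Int.abs_eq_natAbs, Int.units_natAbs]; rfl

/-- The number of constraints of an encoded instance. -/
noncomputable def numConstraints (d : (n : ℕ) × Instance k n) : ℤ :=
  ∑ q ∈ Finset.range (d.1 ^ k), scopeSum (fun _ => 1) d q

theorem numConstraints_mk (I : Instance k n) :
    numConstraints ⟨n, I⟩ = ∑ C, (I C : ℤ) := by
  rw [numConstraints, Finset.sum_range, ← finFunctionFinEquiv.sum_comp, Fintype.sum_prod_type_right]
  refine Finset.sum_congr rfl fun S _ => ?_
  rw [scopeSum_finFunctionFinEquiv]
  simp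

/-- The certificate for an instance. -/
def IsCertifiedInstance (c m : ℕ) (d : (n : ℕ) × Instance k n) : Prop :=
  Certified d.1 (d.1 ^ c) (d.1 ^ m)
    (fun q => if q < d.1 ^ c * (d.1 ^ m * d.1 ^ m) then scopeSum signProd d q else 0)
    (2 * numConstraints d / (d.1.size + 2 : ℕ))

end

open Classical in
theorem polyTime_isCertifiedInstance {c m : ℕ} (hc : c ≤ 1) (hm : 1 ≤ m) :
    PolyTime encodeInstance fun d : (n : ℕ) × Instance (c + m + m) n =>
      decide (IsCertifiedInstance c m d) := by
  have hlen : ∀ d : (n : ℕ) × Instance (c + m + m) n,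
      d.1 ^ c * (d.1 ^ m * d.1 ^ m) ≤ inputSize (encodeInstance d) := fun d => by
    refine le_trans ?_ (length_le_inputSize _)
    rw [pow_mul_pow_mul_pow]
    simp only [encodeInstance, List.length_cons, List.length_ofFn]
    exact (Nat.le_mul_of_pos_left _ (by positivity)).trans (Nat.le_succ _)
  have hsum : ∀ d : (n : ℕ) × Instance (c + m + m) n,
      ∑ q ∈ Finset.range (d.1 ^ c * (d.1 ^ m * d.1 ^ m)), |scopeSum (fun _ => 1) d q| ≤
        2 ^ (c + m + m) * 2 ^ inputSize (encodeInstance d) * 2 ^ inputSize (encodeInstance d) :=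
    fun d => by
      refine (Finset.sum_le_card_nsmul _ _ _ fun q _ =>
        abs_scopeSum_le (fun _ => by simp) d q).trans ?_
      rw [Finset.card_range, nsmul_eq_mul, mul_comm]
      refine mul_le_mul_of_nonneg_left ?_ (by positivity)
      exact_mod_cast (hlen d).trans Nat.lt_two_pow_self.le
  have hpow : ∀ (s : ℕ), (2 : ℤ) * (2 ^ (c + m + m) * 2 ^ s * 2 ^ s) ≤
      2 ^ ((c + m + m + 2) * (s + 1)) := fun s => by
    rw [← pow_add, ← pow_add, ← pow_succ']
    exact pow_le_pow_right₀ (by norm_num) (by nlinarith)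
  have hpos : ∀ s : ℕ, (1 : ℤ) ≤ 2 ^ s := fun s => one_le_pow₀ (by norm_num)
  -- Twice the number of constraints is at most 2 · 2^k · 2^s · 2^s for input size s, which
  -- determines κ. The divisor in the bound is variable 7, already computed for the squaring loop.
  refine polyTime_certified (κ := c + m + m + 2) hc hm (zE := scopeExp (k := c + m + m) signProd)
    (cE := scopeExp (k := c + m + m) fun _ => 1)
    (tE := .div (.mul (.lit 2) (.var 12)) (.var 7)) (n := fun d => d.1)
    (Z := fun d => scopeSum signProd d) (C := fun d => scopeSum (fun _ => 1) d)
    (θ := fun d => 2 * numConstraints d / (d.1.size + 2 : ℕ)) (fun d => rfl)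
    hlen (fun d q => ?_) (fun d => ?_) (fun d => ?_) ?_ ?_
  · refine le_trans (abs_scopeSum_le (fun c => (abs_signProd c).le) d q) (le_trans ?_ (hpow _))
    have h : (0 : ℤ) ≤ 2 ^ (c + m + m) * 2 ^ inputSize (encodeInstance d) := by positivity
    linarith [mul_le_mul_of_nonneg_left (hpos (inputSize (encodeInstance d))) h]
  · refine (hsum d).trans (le_trans ?_ (hpow _))
    exact le_mul_of_one_le_left (by positivity) (by norm_num)
  · have h1 := (Finset.abs_sum_le_sum_abs _ _).trans (hsum d)
    rw [pow_mul_pow_mul_pow] at h1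
    refine (Int.abs_ediv_le_abs _ _).trans ?_
    rw [abs_mul]
    exact (mul_le_mul_of_nonneg_left h1 (abs_nonneg _)).trans (hpow _)
  · intro d q s' hq h9 h5 h0
    rw [pow_mul_pow_mul_pow] at h5
    exact ⟨value_scopeExp _ d h9 h5 h0, value_scopeExp _ d h9 h5 h0⟩
  · intro d s' h5 h7 h0 h12
    rw [pow_mul_pow_mul_pow] at h12
    simp only [AExp.value, h7, h12]
    rfl

/-! ### Parity constraints as a polynomial -/

section

variable {k n : ℕ}

theorem Int.units_ite_eq (u : ℤˣ) (a : ℝ) :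
    (if u = -1 then a else 0) = (a - a * ((u : ℤ) : ℝ)) / 2 := by
  rcases Int.units_eq_one_or u with rfl | rfl
  · rw [if_neg (by decide)]; simp
  · rw [if_pos rfl]; simp

/-- For a sign u the indicator of u = -1 is (1 - u)/2, and the product of signs separates the
negation pattern from the assignment. -/
theorem Instance.sum_ite_kXor (I : Instance k n) (x : Fin n → ℤˣ) :
    (∑ C : Constraint k n, if kXor k (fun i => C.1 i * x (C.2 i)) then (I C : ℝ) else 0) =
      ((∑ C, (I C : ℝ)) - ∑ S : Fin k → Fin n,
        (scopeSum signProd ⟨n, I⟩ (finFunctionFinEquiv S) : ℝ) * ∏ i, (((x (S i) : ℤˣ) : ℤ) : ℝ)) / 2 := by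
  simp only [kXor, Int.units_ite_eq]
  rw [← Finset.sum_div, Finset.sum_sub_distrib]
  congr 2
  rw [Fintype.sum_prod_type_right]
  refine Finset.sum_congr rfl fun S _ => ?_
  rw [scopeSum_finFunctionFinEquiv, Int.cast_sum, Finset.sum_mul]
  refine Finset.sum_congr rfl fun c _ => ?_
  rw [Finset.prod_mul_distrib, signProd]
  push_cast
  ring

end

theorem log_le_size {n : ℕ} (hn : 0 < n) : Real.log n ≤ n.size := by
  have h1 : (n : ℝ) ≤ 2 ^ n.size := by exact_mod_cast (Nat.lt_size_self n).le
  calc Real.log n ≤ Real.log (2 ^ n.size) := Real.log_le_log (by exact_mod_cast hn) h1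
    _ = n.size * Real.log 2 := Real.log_pow _ _
    _ ≤ n.size := mul_le_of_le_one_right (by positivity) (by linarith [Real.log_two_lt_d9])

/-- With M constraints the excess over 1/2 is at most θ/(2M), and θ ≤ 2M / log n because `n.size +
2` ≥ log n. The two-sided certificate is used from below. -/
theorem IsCertifiedInstance.opt_le {c m n : ℕ} (hn : 2 ≤ n) {I : Instance (c + m + m) n}
    (h : IsCertifiedInstance c m ⟨n, I⟩) :
    I.opt (kXor (c + m + m)) ≤ 1 / 2 + 1 / Real.log n := by
  have hlog : 0 < Real.log n := Real.log_pos (by exact_mod_cast hn)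
  refine ciSup_le fun x => ?_
  have hm0 : 0 ≤ ∑ C : Constraint (c + m + m) n, (I C : ℝ) :=
    Finset.sum_nonneg fun _ _ => Nat.cast_nonneg _
  rw [Instance.val, Instance.sum_ite_kXor]
  have h1 := (neg_abs_le _).trans' (neg_le_neg (h.abs_tensor_sum_le
    (x := fun j => (((x j : ℤˣ) : ℤ) : ℝ)) fun i => by
      rcases Int.units_eq_one_or (x i) with h | h <;> simp [h]))
  have h2 : ∀ S : Fin (c + m + m) → Fin n,
      (if (finFunctionFinEquiv S : ℕ) < n ^ c * (n ^ m * n ^ m) then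
        scopeSum signProd ⟨n, I⟩ (finFunctionFinEquiv S) else 0) =
      scopeSum signProd ⟨n, I⟩ (finFunctionFinEquiv S) := fun S =>
    if_pos (by rw [pow_mul_pow_mul_pow]; exact (finFunctionFinEquiv S).2)
  simp only [h2] at h1
  have h3 : ((2 * numConstraints ⟨n, I⟩ / (n.size + 2 : ℕ) : ℤ) : ℝ) ≤
      2 * (∑ C : Constraint (c + m + m) n, (I C : ℝ)) / Real.log n := by
    have h4 : ((2 * numConstraints ⟨n, I⟩ / (n.size + 2 : ℕ) : ℤ) : ℝ) * (n.size + 2 : ℕ) ≤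
        2 * (∑ C : Constraint (c + m + m) n, (I C : ℝ)) := by
      rw [numConstraints_mk]
      have := (Int.cast_le (R := ℝ)).2 (Int.ediv_mul_le (2 * ∑ C, (I C : ℤ))
        (b := ((n.size + 2 : ℕ) : ℤ)) (by positivity))
      rw [Int.cast_mul, Int.cast_natCast] at this
      exact this.trans (le_of_eq (by push_cast; rfl))
    rw [← le_div_iff₀ (by positivity)] at h4
    refine h4.trans (div_le_div_of_nonneg_left (by positivity) hlog ?_)
    push_cast
    linarith [log_le_size (n := n) (by omega)]
  rcases hm0.eq_or_lt with h5 | h5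
  -- Without constraints the value is 0/0 = 0.
  · rw [← h5, div_zero]; positivity
  rw [div_le_iff₀ h5]
  have h6 : (1 / 2 + 1 / Real.log n) * ∑ C : Constraint (c + m + m) n, (I C : ℝ) =
      ((∑ C : Constraint (c + m + m) n, (I C : ℝ)) +
        2 * (∑ C : Constraint (c + m + m) n, (I C : ℝ)) / Real.log n) / 2 := by
    field_simp
  rw [h6]
  linarith

/-! ## Random instances -/

/-- The law of a random variable that is `1` with probability `p` and `0` otherwise. -/
noncomputable def bernoulliNat (p : ℝ) : Measure ℕ :=
  ENNReal.ofReal (1 - p) • Measure.dirac 0 + ENNReal.ofReal p • Measure.dirac 1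

section

variable {p : ℝ}

theorem isProbabilityMeasure_bernoulliNat (h0 : 0 ≤ p) (h1 : p ≤ 1) :
    IsProbabilityMeasure (bernoulliNat p) := ⟨by
  simp only [bernoulliNat, Measure.add_apply, Measure.smul_apply, measure_univ, smul_eq_mul,
    mul_one]
  rw [← ENNReal.ofReal_add (by linarith) h0]
  simp⟩

theorem integral_bernoulliNat (h0 : 0 ≤ p) (h1 : p ≤ 1) (f : ℕ → ℝ) :
    ∫ x, f x ∂bernoulliNat p = (1 - p) * f 0 + p * f 1 := by
  rw [bernoulliNat, integral_add_measure, integral_smul_measure, integral_smul_measure,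
    integral_dirac, integral_dirac, ENNReal.toReal_ofReal (by linarith), ENNReal.toReal_ofReal h0]
  · rfl
  · exact (integrable_dirac (by simp)).smul_measure ENNReal.ofReal_ne_top
  · exact (integrable_dirac (by simp)).smul_measure ENNReal.ofReal_ne_top

theorem ae_bernoulliNat_le_one : ∀ᵐ x ∂bernoulliNat p, x ≤ 1 := by
  rw [bernoulliNat, ae_add_measure_iff]
  constructor <;> refine Measure.ae_smul_measure ?_ _ <;> simp [ae_dirac_eq]

variable {ι κ : Type*} [Fintype ι] [Fintype κ]

/-- Groups the constraints by scope: the coefficients of different scopes then depend on different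
coordinates of a product space, hence are independent. -/
theorem measurePreserving_uncurry_swap {X : Type*} [MeasurableSpace X] (ν : Measure X)
    [IsProbabilityMeasure ν] :
    MeasurePreserving (fun (J : ι → κ → X) (C : κ × ι) => J C.2 C.1)
      (Measure.pi fun _ => Measure.pi fun _ => ν) (Measure.pi fun _ => ν) := by
  have hm : Measurable fun (J : ι → κ → X) (C : κ × ι) => J C.2 C.1 := by fun_prop
  refine ⟨hm, (Measure.pi_eq fun s hs => ?_).symm⟩
  rw [Measure.map_apply hm (.univ_pi hs)]
  have : (fun (J : ι → κ → X) (C : κ × ι) => J C.2 C.1) ⁻¹' (Set.univ.pi s) =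
      Set.univ.pi fun i => Set.univ.pi fun j => s (j, i) := by
    ext J
    simp only [Set.mem_preimage, Set.mem_pi, Set.mem_univ, true_imp_iff, Prod.forall]
    exact forall_comm
  rw [this, Measure.pi_pi, Fintype.prod_prod_type_right]
  exact Finset.prod_congr rfl fun i _ => Measure.pi_pi _ _

theorem measurePreserving_eval_eval {X : Type*} [MeasurableSpace X] (ν : Measure X)
    [IsProbabilityMeasure ν] (i : ι) (j : κ) :
    MeasurePreserving (fun J : ι → κ → X => J i j)
      (Measure.pi fun _ => Measure.pi fun _ => ν) ν :=
  (measurePreserving_eval (fun _ => ν) j).comp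
    (measurePreserving_eval (fun _ => Measure.pi fun _ => ν) i)

/-- Chebyshev's inequality at distance half the mean; the variance is at most the mean. -/
theorem measure_sum_lt_half_le (h0 : 0 ≤ p) (h1 : p ≤ 1) (hp : 0 < Fintype.card ι * p) :
    (Measure.pi fun _ : ι => bernoulliNat p).real
      {I | (∑ i, (I i : ℝ)) < Fintype.card ι * p / 2} ≤ 4 / (Fintype.card ι * p) := by
  have := isProbabilityMeasure_bernoulliNat h0 h1
  set μ := Measure.pi fun _ : ι => bernoulliNat p with hμ
  set M : ℝ := Fintype.card ι * p with hM
  have hmem : MemLp (fun x : ℕ => (x : ℝ)) 2 (bernoulliNat p) := by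
    refine MemLp.of_bound (measurable_of_countable _).aestronglyMeasurable 1 ?_
    filter_upwards [ae_bernoulliNat_le_one] with x hx
    simpa using hx
  have hev : ∀ i, MeasurePreserving (fun I : ι → ℕ => I i) μ (bernoulliNat p) :=
    fun i => measurePreserving_eval (fun _ => bernoulliNat p) i
  have hmem' : ∀ i, MemLp (fun I : ι → ℕ => (I i : ℝ)) 2 μ := fun i =>
    hmem.comp_measurePreserving (hev i)
  have hE : ∫ I, ∑ i, (I i : ℝ) ∂μ = M := by
    rw [integral_finsetSum _ fun i _ => (hmem' i).integrable (by norm_num)]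
    have : ∀ i, ∫ I, (I i : ℝ) ∂μ = p := fun i => by
      rw [← integral_map_of_stronglyMeasurable (hev i).measurable
        (f := fun x : ℕ => (x : ℝ)) (measurable_of_countable _).stronglyMeasurable, (hev i).map_eq,
        integral_bernoulliNat h0 h1]
      simp
    simp [this, hM]
  have hvar : Var[fun x : ℕ => (x : ℝ); bernoulliNat p] ≤ p := by
    refine (variance_le_expectation_sq hmem.1).trans ?_
    refine (integral_bernoulliNat h0 h1 fun x => (x : ℝ) ^ 2).le.trans ?_
    simp
  have hVar : Var[fun I : ι → ℕ => ∑ i, (I i : ℝ); μ] ≤ M := by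
    have h := variance_sum_pi (μ := fun _ : ι => bernoulliNat p)
      (X := fun _ (x : ℕ) => (x : ℝ)) fun _ => hmem
    have h' : (∑ i, fun I : ι → ℕ => (I i : ℝ)) = fun I : ι → ℕ => ∑ i, (I i : ℝ) := by
      ext I; simp
    rw [h'] at h
    rw [h, hM, ← nsmul_eq_mul]
    exact Finset.sum_le_card_nsmul _ _ _ fun _ _ => hvar
  have hch := meas_ge_le_variance_div_sq (μ := μ) (X := fun I => ∑ i, (I i : ℝ))
    (memLp_finsetSum _ fun i _ => hmem' i) (c := M / 2) (by positivity)
  have hle : Var[fun I : ι → ℕ => ∑ i, (I i : ℝ); μ] / (M / 2) ^ 2 ≤ 4 / M := by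
    rw [div_le_div_iff₀ (by positivity) hp]
    nlinarith
  refine ENNReal.toReal_le_of_le_ofReal (by positivity) (le_trans (measure_mono ?_)
    (hch.trans (ENNReal.ofReal_le_ofReal hle)))
  intro I hI
  have hI' : (∑ i, (I i : ℝ)) < M / 2 := hI
  show M / 2 ≤ |(∑ i, (I i : ℝ)) - ∫ I, ∑ i, (I i : ℝ) ∂μ|
  rw [hE, abs_sub_comm]
  exact le_trans (by linarith) (le_abs_self _)

end

/-- The sum of `signProd` over all patterns vanishes. -/
theorem sum_signProd {k : ℕ} (hk : 0 < k) : ∑ c : Fin k → ℤˣ, signProd c = 0 := by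
  have : ∀ c : Fin k → ℤˣ, signProd c = ∏ i, (c i : ℤ) := fun c => by
    rw [signProd]; push_cast; rfl
  simp only [this]
  rw [← Fintype.prod_sum fun (_ : Fin k) (u : ℤˣ) => (u : ℤ)]
  simp [hk.ne']

/-- The tensor entries are the signed counts per scope divided by R = 2^k: bounded by 1, with E|v| ≤
p, and centred because the sign products sum to 0. The failure probability 7/√n is 3/√n for the
certificate plus 4/√n for too few constraints. -/
theorem measure_not_isCertifiedInstance_le {c m n : ℕ} (hc : c ≤ 1) (hm : 1 ≤ m) (hn : 3 ≤ n)
    {p : ℝ} (h0 : 0 ≤ p) (h1 : p ≤ 1)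
    (hp : 4608 ^ (c + m + m) * (n : ℝ) ^ (((c + m + m : ℕ) : ℝ) / 2) * Real.log n ^ 5 ≤
      2 ^ (c + m + m) * (n : ℝ) ^ (c + m + m) * p) :
    (randomInstance (c + m + m) n p).real {I | ¬ IsCertifiedInstance c m ⟨n, I⟩} ≤ 7 / √n := by
  have := isProbabilityMeasure_bernoulliNat h0 h1
  have hn0 : (0 : ℝ) < n := by positivity
  have hn1 : (1 : ℝ) ≤ n := by exact_mod_cast (by omega : 1 ≤ n)
  have hl := one_le_log_of_three_le hn
  have hl0 : 0 < Real.log n := by linarith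
  set ρ : ℝ := (n : ℝ) ^ (((c + m + m : ℕ) : ℝ) / 2) with hρdef
  have hρ : 0 < ρ := Real.rpow_pos_of_pos hn0 _
  have hρ2 : ρ ^ 2 = (n : ℝ) ^ (c + m + m) := rpow_half_sq _ hn0.le (c + m + m)
  have hρn : n ≤ ρ := by
    refine Real.self_le_rpow_of_one_le hn1 ?_
    rw [le_div_iff₀ (by norm_num)]
    exact_mod_cast (by omega : 1 * 2 ≤ c + m + m)
  have hl5 : 1 ≤ Real.log n ^ 5 := one_le_pow₀ hl
  -- 4608 = 2 · 256 · 9: the 2 matches 2^k, the 256 is that of the certificate bound, and 9^k ≥ 81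
  -- covers the square of the 9 in θ₀.
  have h4608 : (4608 : ℝ) ^ (c + m + m) =
      2 ^ (c + m + m) * (256 ^ (c + m + m) * 9 ^ (c + m + m)) := by
    rw [← mul_pow, ← mul_pow]; norm_num
  have h9 : (81 : ℝ) ≤ 9 ^ (c + m + m) := by
    calc (81 : ℝ) = 9 ^ 2 := by norm_num
      _ ≤ 9 ^ (c + m + m) := pow_le_pow_right₀ (by norm_num) (by omega)
  have h256 : (1 : ℝ) ≤ 256 ^ (c + m + m) := one_le_pow₀ (by norm_num)
  have h2 : (1 : ℝ) ≤ 2 ^ (c + m + m) := one_le_pow₀ (by norm_num)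
  have hx : 81 * 256 ^ (c + m + m) * Real.log n ^ 5 ≤ ρ * p := by
    rw [← hρ2, h4608] at hp
    have h3 : 2 ^ (c + m + m) * ρ * (256 ^ (c + m + m) * 9 ^ (c + m + m) * Real.log n ^ 5) ≤
        2 ^ (c + m + m) * ρ * (ρ * p) := by linarith
    refine le_trans ?_ (le_of_mul_le_mul_left h3 (by positivity))
    rw [mul_comm (81 : ℝ)]
    gcongr
  set M : ℝ := 2 ^ (c + m + m) * (n : ℝ) ^ (c + m + m) * p with hM
  have hMρ : M = 2 ^ (c + m + m) * ρ * (ρ * p) := by rw [hM, ← hρ2]; ring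
  have hx1 : 81 * Real.log n ≤ ρ * p := by
    refine le_trans ?_ hx
    calc 81 * Real.log n ≤ 81 * 256 ^ (c + m + m) * Real.log n := by
          gcongr; linarith
      _ ≤ _ := by gcongr; exact le_self_pow₀ hl (by norm_num)
  have hx0 : 1 ≤ ρ * p := by linarith
  have hpρ : ρ⁻¹ ≤ p := by rwa [inv_le_iff_one_le_mul₀' hρ]
  have hp0 : 0 < p := (inv_pos.2 hρ).trans_le hpρ
  have hMn : n ≤ M := by
    rw [hMρ]
    calc (n : ℝ) ≤ 1 * ρ * 1 := by linarith
      _ ≤ _ := by gcongr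
  have hM9 : 9 * Real.log n ≤ M := by
    rw [hMρ]
    calc 9 * Real.log n ≤ 1 * 1 * (ρ * p) := by linarith
      _ ≤ _ := by gcongr; linarith
  -- Half of M / ((9/2) log n), a lower bound for the quotient when there are at least M/2
  -- constraints; the other half is at least 1 and pays for the integer division.
  set θ₀ : ℝ := M / (9 * Real.log n) with hθ₀
  have hθ₀sq : (2 ^ (c + m + m)) ^ 2 * (256 ^ (c + m + m) * p * ρ ^ 3 * Real.log n ^ 3) ≤
      θ₀ ^ 2 := by
    rw [hθ₀, div_pow, le_div_iff₀ (by positivity), hMρ]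
    calc _ = (2 ^ (c + m + m)) ^ 2 * ρ ^ 2 * (ρ * p) *
          (81 * 256 ^ (c + m + m) * Real.log n ^ 5) := by ring
      _ ≤ (2 ^ (c + m + m)) ^ 2 * ρ ^ 2 * (ρ * p) * (ρ * p) := by gcongr
      _ = _ := by ring
  have hθ₀1 : 1 ≤ θ₀ := by rw [hθ₀, one_le_div (by positivity)]; exact hM9
  have hcard : (Fintype.card (Constraint (c + m + m) n) : ℝ) * p = M := by
    rw [hM]; simp
  have hthr : ∀ I : Instance (c + m + m) n, M / 2 ≤ ∑ C, (I C : ℝ) →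
      θ₀ ≤ ((2 * numConstraints ⟨n, I⟩ / (n.size + 2 : ℕ) : ℤ) : ℝ) := fun I hI => by
    have hL : (0 : ℝ) < (n.size + 2 : ℕ) := by positivity
    have h3 : ((2 * numConstraints ⟨n, I⟩ : ℤ) : ℝ) = 2 * ∑ C, (I C : ℝ) := by
      rw [numConstraints_mk]; push_cast; rfl
    have h4 := (Int.cast_lt (R := ℝ)).2 (Int.lt_ediv_add_one_mul_self
      (2 * numConstraints ⟨n, I⟩) (b := ((n.size + 2 : ℕ) : ℤ)) (by positivity))
    rw [h3, Int.cast_mul, Int.cast_add, Int.cast_one, Int.cast_natCast] at h4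
    have h5 : 2 * θ₀ * (n.size + 2 : ℕ) ≤ M := by
      calc 2 * θ₀ * (n.size + 2 : ℕ) ≤ 2 * θ₀ * (9 / 2 * Real.log n) := by
            gcongr; exact size_add_two_le_log hn
        _ = M := by rw [hθ₀]; field_simp
    have h6 := lt_of_mul_lt_mul_right ((h5.trans (by linarith)).trans_lt h4) hL.le
    linarith
  have hu := measurePreserving_uncurry_swap (ι := Fin (c + m + m) → Fin n)
    (κ := Fin (c + m + m) → ℤˣ) (bernoulliNat p)
  set Q := Measure.pi fun _ : Fin (c + m + m) → Fin n =>
    Measure.pi fun _ : Fin (c + m + m) → ℤˣ => bernoulliNat p with hQ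
  have hev := measurePreserving_eval_eval (ι := Fin (c + m + m) → Fin n)
    (κ := Fin (c + m + m) → ℤˣ) (bernoulliNat p)
  have hR : (0 : ℝ) < 2 ^ (c + m + m) := by positivity
  set g : ((Fin (c + m + m) → ℤˣ) → ℕ) → ℝ := fun f =>
    (∑ b, (signProd b : ℝ) * f b) / 2 ^ (c + m + m) with hg
  have hgm : Measurable g := measurable_of_countable _
  have hgabs : ∀ f, |g f| ≤ (∑ b, (f b : ℝ)) / 2 ^ (c + m + m) := fun f => by
    rw [hg, abs_div, abs_of_pos hR]
    gcongr
    refine (Finset.abs_sum_le_sum_abs _ _).trans (Finset.sum_le_sum fun b _ => ?_)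
    rw [abs_mul, ← Int.cast_abs, abs_signProd]
    simp
  have hone : ∀ S b, ∀ᵐ J ∂Q, J S b ≤ 1 := fun S b =>
    (hev S b).quasiMeasurePreserving.ae ae_bernoulliNat_le_one
  have hint : ∀ S b, Integrable (fun J : (Fin (c + m + m) → Fin n) →
      (Fin (c + m + m) → ℤˣ) → ℕ => (J S b : ℝ)) Q := fun S b => by
    refine .of_bound ((measurable_of_countable (fun x : ℕ => (x : ℝ))).comp
      (hev S b).measurable).aestronglyMeasurable 1 ?_
    filter_upwards [hone S b] with J hJ
    simpa using hJ
  have hmean : ∀ S b, ∫ J, (J S b : ℝ) ∂Q = p := fun S b => by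
    rw [← integral_map_of_stronglyMeasurable (hev S b).measurable
      (f := fun x : ℕ => (x : ℝ)) (measurable_of_countable _).stronglyMeasurable, (hev S b).map_eq,
      integral_bernoulliNat h0 h1]
    simp
  have key := measure_tensor_not_certified_le (μ := Q) (θ₀ := θ₀) (R := 2 ^ (c + m + m)) (p := p)
    (Z := fun J q => if q < n ^ c * (n ^ m * n ^ m) then
      scopeSum signProd ⟨n, fun C : Constraint (c + m + m) n => J C.2 C.1⟩ q else 0)
    (θ := fun J => 2 * numConstraints ⟨n, fun C : Constraint (c + m + m) n => J C.2 C.1⟩ /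
      (n.size + 2 : ℕ))
    (v := fun S J => g (J S)) hc hm hn hρ hρ2 hpρ hR (by linarith) hθ₀sq (fun J S => ?_)
    (fun S => hgm.comp (measurable_pi_apply S)) (iIndepFun_pi fun S => hgm.aemeasurable)
    (fun S => ?_) (fun S => ?_) (fun S => ?_)
  · set E : Set (Instance (c + m + m) n) := {I | θ₀ ≤
      ((2 * numConstraints ⟨n, I⟩ / (n.size + 2 : ℕ) : ℤ) : ℝ) ∧
        ¬ IsCertifiedInstance c m ⟨n, I⟩} with hE
    have hEm : MeasurableSet E := E.to_countable.measurableSet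
    -- The estimate was proved on the space grouped by scope and is carried over by the
    -- measure-preserving regrouping.
    have hEQ : (randomInstance (c + m + m) n p).real E ≤ 3 / √n := by
      refine le_trans (le_of_eq ?_) key
      exact (hu.measureReal_preimage hEm.nullMeasurableSet).symm
    have hlow := measure_sum_lt_half_le (ι := Constraint (c + m + m) n) h0 h1
      (by rw [hcard]; linarith)
    rw [hcard] at hlow
    have hsub : {I : Instance (c + m + m) n | ¬ IsCertifiedInstance c m ⟨n, I⟩} ⊆
        {I | (∑ C, (I C : ℝ)) < M / 2} ∪ E := fun I hI => by
      by_cases h : (∑ C, (I C : ℝ)) < M / 2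
      · exact .inl h
      · exact .inr ⟨hthr I (not_lt.1 h), hI⟩
    have : IsProbabilityMeasure (randomInstance (c + m + m) n p) :=
      inferInstanceAs (IsProbabilityMeasure (Measure.pi fun _ => bernoulliNat p))
    have hsq : √(n : ℝ) ≤ M := by
      refine le_trans ?_ hMn
      rw [Real.sqrt_le_left hn0.le]
      exact le_self_pow₀ hn1 (by norm_num)
    calc _ ≤ (randomInstance (c + m + m) n p).real ({I | (∑ C, (I C : ℝ)) < M / 2} ∪ E) :=
          measureReal_mono hsub
      _ ≤ 4 / M + 3 / √n := (measureReal_union_le _ _).trans (add_le_add hlow hEQ)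
      _ ≤ 4 / √n + 3 / √n := by gcongr
      _ = 7 / √n := by ring
  · rw [if_pos (by rw [pow_mul_pow_mul_pow]; exact (finFunctionFinEquiv S).2),
      scopeSum_finFunctionFinEquiv]
    simp only [hg]
    rw [mul_div_cancel₀ _ hR.ne']
    push_cast
    rfl
  · filter_upwards [ae_all_iff.2 (hone S)] with J hJ
    refine (hgabs _).trans ?_
    rw [div_le_one hR]
    refine (Finset.sum_le_card_nsmul _ _ 1 fun b _ => by exact_mod_cast hJ b).trans (le_of_eq ?_)
    simp
  · refine (integral_mono_of_nonneg (.of_forall fun _ => abs_nonneg _)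
      ((integrable_finsetSum _ fun b _ => hint S b).div_const _)
      (.of_forall fun J => hgabs (J S))).trans (le_of_eq ?_)
    rw [integral_div, integral_finsetSum _ fun b _ => hint S b]
    simp [hmean]
  · have : ∫ J, g (J S) ∂Q = 0 := by
      simp only [hg]
      rw [integral_div, integral_finsetSum _ fun b _ => (hint S b).const_mul _]
      simp only [integral_const_mul, hmean]
      rw [← Finset.sum_mul, ← Int.cast_sum, sum_signProd (by omega)]
      simp
    rw [this]
    simpa using hρ.le

theorem mainTheorem5 :
    (∃ K : ℝ, 0 < K ∧ ∀ k : ℕ, 2 ≤ k →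
      ∃ A : TensorInput k → Bool,
        PolyTime TensorInput.encode A ∧
        (∀ d : TensorInput k, A d = true →
          ∀ w : (Fin k → Fin d.n) → ℝ, d.Represents w →
            ∀ x : Fin d.n → ℝ, ‖x‖ ≤ 1 → tensorPoly w x ≤ d.bound) ∧
        ∃ ε : ℕ → ℝ, Tendsto ε atTop (𝓝 0) ∧
          ∀ (n : ℕ) (p : ℝ), (n : ℝ) ^ (-(k : ℝ) / 2) ≤ p →
          ∀ (Ω : Type*) [MeasurableSpace Ω] (μ : Measure Ω) [IsProbabilityMeasure μ]
            (w : (Fin k → Fin n) → Ω → ℝ),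
            (∀ T, Measurable (w T)) → iIndepFun w μ →
            (∀ T, ∫ ω, w T ω ∂μ = 0) →
            (∀ T, μ.real {ω | w T ω ≠ 0} ≤ p) →
            (∀ T, ∀ᵐ ω ∂μ, |w T ω| ≤ 1) →
          ∀ (N : ℕ) (hN : 0 < N), n ^ k ≤ N →
          ∀ θ : ℤ,
            K ^ k * √p * (n : ℝ) ^ (3 * (k : ℝ) / 4) * Real.log n ^ (3 / 2 : ℝ) ≤ θ →
            μ.real {ω | A (roundedInput (fun T => w T ω) N hN θ) = false} ≤ ε n) ∧
    (∃ K : ℝ, 0 < K ∧ ∀ k : ℕ, 2 ≤ k →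
      ∃ A : ((n : ℕ) × Instance k n) → Bool,
        PolyTime encodeInstance A ∧
        (∀ n : ℕ, 2 ≤ n → ∀ I : Instance k n, A ⟨n, I⟩ = true →
          I.opt (kXor k) ≤ 1 / 2 + 1 / Real.log n) ∧
        ∃ ε : ℕ → ℝ, Tendsto ε atTop (𝓝 0) ∧
          ∀ (n : ℕ) (p : ℝ), 0 ≤ p → p ≤ 1 →
            K ^ k * (n : ℝ) ^ ((k : ℝ) / 2) * Real.log n ^ 5 ≤ 2 ^ k * (n : ℝ) ^ k * p →
            (randomInstance k n p).real {I | A ⟨n, I⟩ = false} ≤ ε n) := by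
  classical
  refine ⟨⟨32, by norm_num, fun k hk => ?_⟩, ⟨4608, by norm_num, fun k hk => ?_⟩⟩
  · obtain ⟨c, m, hc, hm, rfl⟩ := exists_eq_add_add hk
    refine ⟨fun d => decide (d.IsCertified c m), TensorInput.polyTime_isCertified hc hm,
      fun d hd w hw x hx => (of_decide_eq_true hd).tensorPoly_le hw hx, _,
      tendsto_ite_div_sqrt 3, ?_⟩
    intro n p hp Ω _ μ _ w hmw hi h0 hwp hb N hN hnN θ hθ
    simp only [decide_eq_false_iff_not]
    split_ifs with hn
    · exact measureReal_le_one
    · exact measure_roundedInput_not_certified_le hc hm (not_lt.1 hn) hp hmw hi h0 hwp hb hN hnN hθ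
  · obtain ⟨c, m, hc, hm, rfl⟩ := exists_eq_add_add hk
    refine ⟨fun d => decide (IsCertifiedInstance c m d), polyTime_isCertifiedInstance hc hm,
      fun n hn I hI => (of_decide_eq_true hI).opt_le hn, _, tendsto_ite_div_sqrt 7, ?_⟩
    intro n p h0 h1 hp
    simp only [decide_eq_false_iff_not]
    split_ifs with hn
    · have := isProbabilityMeasure_bernoulliNat h0 h1
      have : IsProbabilityMeasure (randomInstance (c + m + m) n p) :=
        inferInstanceAs (IsProbabilityMeasure (Measure.pi fun _ => bernoulliNat p))
      exact measureReal_le_one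
    · exact measure_not_isCertifiedInstance_le hc hm (not_lt.1 hn) h0 h1 hp
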